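/- Let $A$ be a set of $K\ge 3$ alternatives. A preference is a strict total order on $A$; a profile is a list $\pi=(\succ_1,\dots,\succ_n)$ of preferences; $\mu_\pi(\succ)$ is the number of $i$ with $\succ_i=\succ$; and $d(\succ,\succ')$ is the number of sets $\{a,b\}\subseteq A$ that $\succ$ and $\succ'$ rank differently. The profile $\pi$ exhibits level-1 consensus around a preference $\succ_0$ if (1) for all preferences $\succ,\succ'$, $d(\succ,\succ_0)\le d(\succ',\succ_0)$ implies $\mu_\pi(\succ)\ge\mu_\pi(\succ')$, and (2) there are preferences $\succ,\succ'$ with $d(\succ,\succ_0)<d(\succ',\succ_0)$ and $\mu_\pi(\succ)>\mu_\pi(\succ')$. Algorithm 1 (input $\pi$). Compute the frequencies of the $m$ distinct preferences of $\pi$. If they are all equal and $m=K!$, answer "no consensus". Otherwise order the distinct preferences by descending frequency. For each of the preferences of maximal frequency, in this order, call Algorithm 2; if it returns True, return that preference. If it never does, answer "no consensus". Algorithm 2 (input $\pi$ and a candidate $\succ_0$). Order the $m$ distinct preferences of $\pi$ by descending frequency and, within equal frequency, by ascending distance from $\succ_0$. If some two consecutive preferences $\succ_i,\succ_{i+1}$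 in this order have $\mu_\pi(\succ_i)>\mu_\pi(\succ_{i+1})$ and $d(\succ_i,\succ_0)\ge d(\succ_{i+1},\succ_0)$, return False. Otherwise let $\widehat d$ be the distance of the last preference from $\succ_0$, and return True if and only if $\sum_{j=0}^{\widehat d}|T(K,j)|=m$, where $T(K,j)$ is the set of permutations of $K$ elements with exactly $j$ inversions. **Theorem.** (a) For every profile, and however ties are broken in the orderings, Algorithm 1 decides correctly whether the profile exhibits level-1 consensus: if it returns a preference, then the profile exhibits level-1 consensus around it, and it answers "no consensus" if and only if there is no preference around which the profile exhibits level-1 consensus. (b) Let $n'=\min(K!,n)$. Algorithm 1 can be implemented by a single word-RAM program, for all $K\ge3$, $n\ge1$ and all word lengths of at least a constant times the logarithm of the input size plus the number of voters, such that, if the profile is given by the list of its distinct preferences with their frequencies, the program takes time $$O\bigl(n'^2K\sqrt{\log K}+n'^2\log n'\bigr).$$ If the profile is given instead as a list of $n$ ballots, so that the frequencies have to be counted first, the same program takes time $O(nK)$ (linear in the length of the input) plus the above. In particular, the running time is polynomial in the profile size $nK$. Here the program implements Algorithm 1 in the sense that it outputs, in order, the values that a run of Algorithm 1 computes: $m$,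 the descending frequencies, for each candidate tried the candidate itself, the frequencies and distances in the order of Algorithm 2 and its verdict, and finally the answer. -/

import Mathlib

noncomputable section

/-! ### Preferences, profiles, level-1 consensus -/

/-- A preference: a strict total order on the alternatives `0, …, K - 1`. -/
@[ext] structure Preference (K : ℕ) where
  prefers : Fin K → Fin K → Prop
  irrefl : ∀ a, ¬ prefers a a
  trans : ∀ a b c, prefers a b → prefers b c → prefers a c
  total : ∀ a b, a ≠ b → prefers a b ∨ prefers b a

/-- A profile of `n` voters. -/
abbrev Profile (K n : ℕ) := Fin n → Preference K

open Classical in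
/-- The frequency of `p` in the profile: the number of voters whose preference is `p`. -/
def freq {K n : ℕ} (π : Profile K n) (p : Preference K) : ℕ :=
  (Finset.univ.filter fun i => π i = p).card

open Classical in
/-- The inversion distance: the number of sets `{a, b}` that `p` and `q` rank differently.
Each such set is counted once, as the pair `(a, b)` listed in the order of `p`. -/
def invDist {K : ℕ} (p q : Preference K) : ℕ :=
  (Finset.univ.filter fun x : Fin K × Fin K => p.prefers x.1 x.2 ∧ q.prefers x.2 x.1).card

/-- The profile exhibits consensus of level 1 around `p₀`. -/
def LevelOneConsensus {K n : ℕ} (π : Profile K n) (p₀ : Preference K) : Prop :=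
  (∀ p q : Preference K, invDist p p₀ ≤ invDist q p₀ → freq π q ≤ freq π p) ∧
  (∃ p q : Preference K, invDist p p₀ < invDist q p₀ ∧ freq π q < freq π p)

/-- The Mahonian number: how many permutations of `K` elements have exactly `j` inversions. -/
def mahonian (K j : ℕ) : ℕ :=
  (Finset.univ.filter fun σ : Equiv.Perm (Fin K) =>
    (Finset.univ.filter fun x : Fin K × Fin K => x.1 < x.2 ∧ σ x.2 < σ x.1).card = j).card

/-- The rank of `a` in `p`: how many alternatives are preferred to `a` (the best one has rank 0). -/
def Preference.rank {K : ℕ} (p : Preference K) (a : Fin K) : ℕ :=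
  open Classical in (Finset.univ.filter fun b => p.prefers b a).card

/-- A preference written as `K` numbers, the rank of each alternative. -/
def Preference.code {K : ℕ} (p : Preference K) : List ℕ := List.ofFn p.rank

/-! ### The algorithm

Ties in the two orderings are broken arbitrarily, so the orderings are arguments of the algorithm,
constrained only by the two predicates that follow. Besides its answer the algorithm keeps a record
of the values it computes, in the order in which it computes them. -/

/-- `l` lists the distinct preferences of the profile by descending frequency. -/
def IsFreqOrder {K n : ℕ} (π : Profile K n) (l : List (Preference K)) : Prop :=
  l.Nodup ∧ (∀ p, p ∈ l ↔ ∃ i, π i = p) ∧ l.Pairwise fun p q => freq π q ≤ freq π p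

/-- `l` lists the distinct preferences of the profile by descending frequency, and those of equal
frequency by ascending inversion distance from `p₀`. -/
def IsLexOrder {K n : ℕ} (π : Profile K n) (p₀ : Preference K) (l : List (Preference K)) : Prop :=
  l.Nodup ∧ (∀ p, p ∈ l ↔ ∃ i, π i = p) ∧
    l.Pairwise fun p q =>
      freq π q < freq π p ∨ (freq π p = freq π q ∧ invDist p p₀ ≤ invDist q p₀)

/-- The scan of adjacent pairs: `False` as soon as some pair has strictly decreasing frequency but
no strictly increasing distance. -/
def scan {K n : ℕ} (π : Profile K n) (p₀ : Preference K) : List (Preference K) → Prop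
  | p :: q :: l =>
      ¬ (freq π q < freq π p ∧ invDist q p₀ ≤ invDist p p₀) ∧ scan π p₀ (q :: l)
  | _ => True

/-- The test that, for the distance `d` of the last listed preference, the number of all
preferences at distance at most `d` is the number of listed preferences. -/
def countTest {K : ℕ} (p₀ : Preference K) (l : List (Preference K)) : Prop :=
  ∃ p ∈ l.getLast?, ∑ j ∈ Finset.range (invDist p p₀ + 1), mahonian K j = l.length

/-- The verdict of the subroutine on candidate `p₀`, where `l` is the lexicographic ordering
for `p₀`. -/
def subroutine {K n : ℕ} (π : Profile K n) (p₀ : Preference K) (l : List (Preference K)) : Prop :=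
  scan π p₀ l ∧ countTest p₀ l

open Classical in
/-- The record of one call of the subroutine: the candidate, the frequency and the distance of each
preference in lexicographic order, and the verdict. -/
def subroutineRecord {K n : ℕ} (π : Profile K n) (p₀ : Preference K) (l : List (Preference K)) :
    List ℕ :=
  p₀.code ++ (l.flatMap fun p => [freq π p, invDist p p₀]) ++
    [if subroutine π p₀ l then 1 else 0]

open Classical in
/-- Try the candidates in turn until the subroutine accepts one; return it, and the record. -/
def tryCandidates {K n : ℕ} (π : Profile K n) (lex : Preference K → List (Preference K)) :
    List (Preference K) → Option (Preference K) × List ℕ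
  | [] => (none, [])
  | c :: cs =>
      if subroutine π c (lex c) then (some c, subroutineRecord π c (lex c))
      else
        ((tryCandidates π lex cs).1, subroutineRecord π c (lex c) ++ (tryCandidates π lex cs).2)

open Classical in
/-- The main algorithm. Here `l` is the ordering by descending frequency and `lex c` the
lexicographic ordering for candidate `c`. It stops at once if all frequencies are equal and all `K!`
preferences occur; otherwise it tries the leading preferences of `l` whose frequency equals the
maximum, which is the frequency of the first one. The answer `none` means no consensus. -/
def detect {K n : ℕ} (π : Profile K n) (l : List (Preference K))
    (lex : Preference K → List (Preference K)) : Option (Preference K) × List ℕ :=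
  if (∀ p ∈ l, ∀ q ∈ l, freq π p = freq π q) ∧ l.length = K.factorial then (none, [])
  else
    tryCandidates π lex (l.takeWhile fun p => decide (freq π p = (l.map (freq π)).headD 0))

/-- The answer as a list of numbers. -/
def answerCode {K : ℕ} : Option (Preference K) → List ℕ
  | none => [0]
  | some p => 1 :: p.code

/-- Everything that a run computes, in order: the number of distinct preferences, their frequencies
in descending order, the records of the subroutine calls, and the answer. -/
def transcript {K n : ℕ} (π : Profile K n) (l : List (Preference K))
    (lex : Preference K → List (Preference K)) : List ℕ :=
  l.length :: (l.map (freq π) ++ (detect π l lex).2 ++ answerCode (detect π l lex).1)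

/-! ### Word RAM

Programs are finite texts over registers and a random access memory of `w`-bit words, with an
append-only output. The cost of a run is the number of expression nodes evaluated plus the number of
commands (and loop tests) executed. -/

namespace WordRam

/-- Binary operations on words. -/
inductive Op
  | add | sub | mul | div | mod | land | lor | xor | shl | shr | lt | eq

/-- The value of an operation on `w`-bit words: the result is reduced modulo `2 ^ w`; subtraction
stops at zero; comparisons yield 0 or 1; division by zero yields zero. -/
def Op.eval (w : ℕ) (o : Op) (a b : ℕ) : ℕ :=
  (match o with
    | .add => a + b
    | .sub => a - b
    | .mul => a * b
    | .div => a / b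
    | .mod => a % b
    | .land => a &&& b
    | .lor => a ||| b
    | .xor => a ^^^ b
    | .shl => a <<< b
    | .shr => a >>> b
    | .lt => if a < b then 1 else 0
    | .eq => if a = b then 1 else 0) % 2 ^ w

/-- Expressions: constants, registers, memory reads, operations. -/
inductive Expr
  | const (k : ℕ)
  | reg (r : ℕ)
  | load (e : Expr)
  | bin (o : Op) (e₁ e₂ : Expr)

/-- A machine state. -/
structure State where
  reg : ℕ → ℕ
  mem : ℕ → ℕ
  out : List ℕ

/-- The value of an expression. -/
def Expr.eval (w : ℕ) (s : State) : Expr → ℕ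
  | .const k => k % 2 ^ w
  | .reg r => s.reg r
  | .load e => s.mem (e.eval w s)
  | .bin o e₁ e₂ => o.eval w (e₁.eval w s) (e₂.eval w s)

/-- The cost of evaluating an expression: its number of nodes. -/
def Expr.cost : Expr → ℕ
  | .const _ => 1
  | .reg _ => 1
  | .load e => e.cost + 1
  | .bin _ e₁ e₂ => e₁.cost + e₂.cost + 1

/-- Programs. -/
inductive Cmd
  | skip
  | set (r : ℕ) (e : Expr)
  | store (addr e : Expr)
  | emit (e : Expr)
  | seq (c₁ c₂ : Cmd)
  | cond (e : Expr) (c₁ c₂ : Cmd)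
  | loop (e : Expr) (c : Cmd)

/-- `Exec w c s t s'`: on `w`-bit words, program `c` started in state `s` halts in state `s'` after
exactly `t` steps. -/
inductive Exec (w : ℕ) : Cmd → State → ℕ → State → Prop
  | skip (s : State) : Exec w .skip s 1 s
  | set (s : State) (r : ℕ) (e : Expr) :
      Exec w (.set r e) s (e.cost + 1) { s with reg := Function.update s.reg r (e.eval w s) }
  | store (s : State) (a e : Expr) :
      Exec w (.store a e) s (a.cost + e.cost + 1)
        { s with mem := Function.update s.mem (a.eval w s) (e.eval w s) }
  | emit (s : State) (e : Expr) :
      Exec w (.emit e) s (e.cost + 1) { s with out := s.out ++ [e.eval w s] }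
  | seq {c₁ c₂ : Cmd} {s s₁ s₂ : State} {t₁ t₂ : ℕ} :
      Exec w c₁ s t₁ s₁ → Exec w c₂ s₁ t₂ s₂ → Exec w (.seq c₁ c₂) s (t₁ + t₂) s₂
  | condTrue {e : Expr} {c₁ c₂ : Cmd} {s s' : State} {t : ℕ} :
      e.eval w s ≠ 0 → Exec w c₁ s t s' → Exec w (.cond e c₁ c₂) s (e.cost + 1 + t) s'
  | condFalse {e : Expr} {c₁ c₂ : Cmd} {s s' : State} {t : ℕ} :
      e.eval w s = 0 → Exec w c₂ s t s' → Exec w (.cond e c₁ c₂) s (e.cost + 1 + t) s'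
  | loopDone {e : Expr} {c : Cmd} {s : State} :
      e.eval w s = 0 → Exec w (.loop e c) s (e.cost + 1) s
  | loopStep {e : Expr} {c : Cmd} {s s₁ s₂ : State} {t₁ t₂ : ℕ} :
      e.eval w s ≠ 0 → Exec w c s t₁ s₁ → Exec w (.loop e c) s₁ t₂ s₂ →
        Exec w (.loop e c) s (e.cost + 1 + t₁ + t₂) s₂

/-- The initial state: the input words at the addresses `0, 1, …`, and zero everywhere else. -/
def State.init (input : List ℕ) : State where
  reg := fun _ => 0
  mem := fun a => input.getD a 0
  out := []

end WordRam

/-! ### The input of the machine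

The profile is a list of rows, each a preference with a multiplicity. -/

/-- The profile given ballot by ballot: row `i` is the preference of voter `i`, with
multiplicity 1. -/
def IsBallotList {K n : ℕ} (π : Profile K n) (rows : List (Preference K × ℕ)) : Prop :=
  rows = List.ofFn fun i => (π i, 1)

/-- The profile given by its frequencies: each distinct preference once, in any order, with its
frequency. -/
def IsFreqTable {K n : ℕ} (π : Profile K n) (rows : List (Preference K × ℕ)) : Prop :=
  rows.Nodup ∧ ∀ p k, (p, k) ∈ rows ↔ (∃ i, π i = p) ∧ k = freq π p

/-- The input words: `K`, the number of rows, and the rows (`K` ranks and the multiplicity). -/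
def inputWords {K : ℕ} (rows : List (Preference K × ℕ)) : List ℕ :=
  K :: rows.length :: rows.flatMap fun r => r.1.code ++ [r.2]

/-- The function `n'² K √(log K) + n'² log n'` with `n' = min (K!) n`. -/
def timeBound (K n : ℕ) : ℝ :=
  ((min K.factorial n : ℕ) : ℝ) ^ 2 * K * √(Real.log K) +
    ((min K.factorial n : ℕ) : ℝ) ^ 2 * Real.log ((min K.factorial n : ℕ) : ℝ)

end

/-! Correctness. Fix a candidate c and list the occurring preferences lexicographically. If every
adjacent drop in frequency comes with a rise in distance, then distances are nondecreasing along the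
whole list, and a more frequent listed preference is strictly closer to c (`scan_iff`). The last
preference is then a farthest one, and the counting test says that the ball around c reaching up to
it has as many elements as there are occurring preferences. These all lie in the ball, so they fill
it. Preferences outside have frequency 0, and condition (1) follows. Condition (2) could then fail
only if all K! preferences occur equally often, which the initial test of the algorithm excludes.
Conversely, consensus around c makes frequency a nonincreasing function of distance, so the
occurring preferences form a ball and both tests succeed; moreover c, at distance 0 from itself, has
maximal frequency and is among the candidates. See `levelOneConsensus_of_subroutine`,
`subroutine_of_levelOneConsensus`, `detect_correct`.

Running time. With m distinct preferences up to m² distances are needed, and each may cost only O(K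
√log K). A distance is the number of inversions of a permutation, for which merge sort would take K
log K; the gain comes from treating many elements at once inside a machine word. Pad the permutation
to N = 2^L < 2K elements. Halving blocks of values repeatedly writes the number of inversions as a
sum over the bits of the number of crossings between half blocks (`innerInv_two_mul`). Let g be a
power of two with 2g² ≤ L < 8g². A round treats up to g bits: a counting sort groups the elements by
their higher bits, after which only digits of g bits are kept, g digits to a word. A word has g² ≤
L/2 bits, so whatever must be known about a single word fits into tables with at most √N entries.
One bit then costs O(N/g) plus the tables, a round O(N), and the O(L/g) = O(g) rounds O(Ng). The log
g lowest bits are left to a comparison of all pairs in blocks of g values, again O(Ng)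
(`inversions_spec`).

Everything else is cheaper. Equal rows are merged by a trie in linear time. Frequencies are replaced
by their ranks, so that a pair of rank and distance is a key below mK², and radix sort takes O(m
log(mK)). Ball sizes come from a recursion with sliding windows, cut off above m. Over at most m
candidates this gives m²K√log K + m² log m, since log K ≤ K√log K.

Ties. The keys in sorted order are the same for all admissible lexicographic orders
(`eq_map_sortKey`), and the order in which the program tries the candidates is the beginning of some
admissible frequency order (`exists_freqOrder`).

Machine. The program is written in a small array language over unbounded naturals, in which safety,
running time and result are proved together (`wp`). `exec_comp` transfers this to the word RAM at
constant cost per command, provided that assigned values stay below some M a fixed power of which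
fits into a word. -/

set_option linter.constructorNameAsVariable false
set_option linter.unusedSimpArgs false

/-! ### An array language over unbounded natural numbers, compiled to the word RAM -/

namespace ArrayRam

/-- Register names. -/
inductive Reg
  | K | R | m | i | j | k | nm | x | y | ad
  | q | p2 | NB | b | d | W | fc | ne | L | N | gm | g | D | DG | KK
  | ci | res | rd | lo | LO | h | S | a | lv | bp | nb | wd | u | dg | zc | oc | z | acc | cnt
  | v | dh | found | ans | HI
  deriving DecidableEq

/-- Array names. -/
inductive Arr
  | TR | COD | IDX | F | RK | FR | KEY | KY2 | BA | BB | PW | X | T | CNT | PK | PK2 | TZ | TO | TN | TI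
  deriving DecidableEq

theorem Reg.ctorIdx_injective : Function.Injective Reg.ctorIdx := fun r r' h => by
  rw [← Reg.ofNat_ctorIdx r, h, Reg.ofNat_ctorIdx]

theorem Arr.ctorIdx_injective : Function.Injective Arr.ctorIdx := fun r r' h => by
  rw [← Arr.ofNat_ctorIdx r, h, Arr.ofNat_ctorIdx]

/-- The number 64 is the stride at which `cell` interleaves the arrays; any fixed bound on the
number of arrays would serve. -/
theorem Arr.ctorIdx_lt (a : Arr) : a.ctorIdx < 64 := by cases a <;> decide

/-- Binary operations. -/
inductive Bop
  | add | sub | mul | div | mod | lt | eq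

/-- The value of an operation on natural numbers. -/
def Bop.eval : Bop → ℕ → ℕ → ℕ
  | .add, a, b => a + b
  | .sub, a, b => a - b
  | .mul, a, b => a * b
  | .div, a, b => a / b
  | .mod, a, b => a % b
  | .lt, a, b => if a < b then 1 else 0
  | .eq, a, b => if a = b then 1 else 0

/-- Expressions over registers, arrays and the read-only input. -/
inductive Expr
  | const (k : ℕ)
  | reg (r : Reg)
  | arr (a : Arr) (e : Expr)
  | inp (e : Expr)
  | bin (o : Bop) (e₁ e₂ : Expr)

/-- A state: registers, arrays, the output so far, and the input. -/
structure St where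
  reg : Reg → ℕ
  arr : Arr → ℕ → ℕ
  out : List ℕ
  inp : List ℕ

/-- The value of an expression. -/
def Expr.eval (s : St) : Expr → ℕ
  | .const k => k
  | .reg r => s.reg r
  | .arr a e => s.arr a (e.eval s)
  | .inp e => s.inp.getD (e.eval s) 0
  | .bin o e₁ e₂ => o.eval (e₁.eval s) (e₂.eval s)

/-- All reads of the input are within its bounds. -/
def Expr.Ok (s : St) : Expr → Prop
  | .const _ => True
  | .reg _ => True
  | .arr _ e => e.Ok s
  | .inp e => e.Ok s ∧ e.eval s < s.inp.length
  | .bin _ e₁ e₂ => e₁.Ok s ∧ e₂.Ok s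

/-- Assignment to a register. -/
def St.setReg (s : St) (r : Reg) (v : ℕ) : St := { s with reg := Function.update s.reg r v }

/-- Assignment to an array cell. -/
def St.setArr (s : St) (a : Arr) (i v : ℕ) : St :=
  { s with arr := Function.update s.arr a (Function.update (s.arr a) i v) }

/-- Output of one number. -/
def St.emit (s : St) (v : ℕ) : St := { s with out := s.out ++ [v] }

section simps
variable (s : St) (r r' : Reg) (a a' : Arr) (i v : ℕ)
@[simp] theorem St.reg_setReg : (s.setReg r v).reg r' = if r' = r then v else s.reg r' := by
  simp [setReg, Function.update_apply]
@[simp] theorem St.arr_setReg : (s.setReg r v).arr = s.arr := rfl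
@[simp] theorem St.out_setReg : (s.setReg r v).out = s.out := rfl
@[simp] theorem St.inp_setReg : (s.setReg r v).inp = s.inp := rfl
@[simp] theorem St.reg_setArr : (s.setArr a i v).reg = s.reg := rfl
@[simp] theorem St.arr_setArr :
    (s.setArr a i v).arr a' = if a' = a then Function.update (s.arr a) i v else s.arr a' := by
  by_cases h : a' = a
  · subst h; simp [setArr]
  · simp [setArr, h]
@[simp] theorem St.out_setArr : (s.setArr a i v).out = s.out := rfl
@[simp] theorem St.inp_setArr : (s.setArr a i v).inp = s.inp := rfl
@[simp] theorem St.reg_emit : (s.emit v).reg = s.reg := rfl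
@[simp] theorem St.arr_emit : (s.emit v).arr = s.arr := rfl
@[simp] theorem St.out_emit : (s.emit v).out = s.out ++ [v] := rfl
@[simp] theorem St.inp_emit : (s.emit v).inp = s.inp := rfl
end simps

instance : Coe Reg Expr := ⟨.reg⟩
instance (n : ℕ) : OfNat Expr n := ⟨.const n⟩
instance : Add Expr := ⟨.bin .add⟩
instance : Sub Expr := ⟨.bin .sub⟩
instance : Mul Expr := ⟨.bin .mul⟩
instance : Div Expr := ⟨.bin .div⟩
instance : Mod Expr := ⟨.bin .mod⟩

section evals
variable (s : St) (e f : Expr)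
@[simp] theorem Expr.eval_ofNat (n : ℕ) : (no_index (OfNat.ofNat n) : Expr).eval s = n := rfl
@[simp] theorem Expr.eval_reg (r : Reg) : (Expr.reg r).eval s = s.reg r := rfl
@[simp] theorem Expr.eval_arr (a : Arr) : (Expr.arr a e).eval s = s.arr a (e.eval s) := rfl
@[simp] theorem Expr.eval_inp : (Expr.inp e).eval s = s.inp.getD (e.eval s) 0 := rfl
@[simp] theorem Expr.eval_add : (e + f).eval s = e.eval s + f.eval s := rfl
@[simp] theorem Expr.eval_sub : (e - f).eval s = e.eval s - f.eval s := rfl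
@[simp] theorem Expr.eval_mul : (e * f).eval s = e.eval s * f.eval s := rfl
@[simp] theorem Expr.eval_div : (e / f).eval s = e.eval s / f.eval s := rfl
@[simp] theorem Expr.eval_mod : (e % f).eval s = e.eval s % f.eval s := rfl
@[simp] theorem Expr.eval_lt :
    (Expr.bin .lt e f).eval s = if e.eval s < f.eval s then 1 else 0 := rfl
@[simp] theorem Expr.eval_eq :
    (Expr.bin .eq e f).eval s = if e.eval s = f.eval s then 1 else 0 := rfl
@[simp] theorem Expr.ok_ofNat (n : ℕ) : (no_index (OfNat.ofNat n) : Expr).Ok s := trivial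
@[simp] theorem Expr.ok_reg (r : Reg) : (Expr.reg r).Ok s := trivial
@[simp] theorem Expr.ok_arr (a : Arr) : (Expr.arr a e).Ok s ↔ e.Ok s := Iff.rfl
@[simp] theorem Expr.ok_inp : (Expr.inp e).Ok s ↔ e.Ok s ∧ e.eval s < s.inp.length := Iff.rfl
@[simp] theorem Expr.ok_bin (o : Bop) : (Expr.bin o e f).Ok s ↔ e.Ok s ∧ f.Ok s := Iff.rfl
@[simp] theorem Expr.ok_add : (e + f).Ok s ↔ e.Ok s ∧ f.Ok s := Iff.rfl
@[simp] theorem Expr.ok_sub : (e - f).Ok s ↔ e.Ok s ∧ f.Ok s := Iff.rfl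
@[simp] theorem Expr.ok_mul : (e * f).Ok s ↔ e.Ok s ∧ f.Ok s := Iff.rfl
@[simp] theorem Expr.ok_div : (e / f).Ok s ↔ e.Ok s ∧ f.Ok s := Iff.rfl
@[simp] theorem Expr.ok_mod : (e % f).Ok s ↔ e.Ok s ∧ f.Ok s := Iff.rfl
end evals

/-- Programs; `loop r e c` runs `c` for `r = 0, …, e - 1`, where `e` is evaluated once. -/
inductive Com
  | skip
  | set (r : Reg) (e : Expr)
  | store (a : Arr) (i e : Expr)
  | emit (e : Expr)
  | seq (c₁ c₂ : Com)
  | ite (e : Expr) (c₁ c₂ : Com)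
  | loop (r : Reg) (e : Expr) (c : Com)

infixr:60 " ;; " => Com.seq

/-- The state before iteration `n` of a loop over `r`. -/
def iter (f : St → St) (r : Reg) (s : St) : ℕ → St
  | 0 => s.setReg r 0
  | n + 1 => (f (iter f r s n)).setReg r (n + 1)

/-- The final state. -/
def run : Com → St → St
  | .skip, s => s
  | .set r e, s => s.setReg r (e.eval s)
  | .store a i e, s => s.setArr a (i.eval s) (e.eval s)
  | .emit e, s => s.emit (e.eval s)
  | .seq c₁ c₂, s => run c₂ (run c₁ s)
  | .ite e c₁ c₂, s => if e.eval s ≠ 0 then run c₁ s else run c₂ s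
  | .loop r e c, s => iter (run c) r s (e.eval s)

/-- The number of commands executed. -/
def cost : Com → St → ℕ
  | .skip, _ => 1
  | .set _ _, _ => 1
  | .store _ _ _, _ => 1
  | .emit _, _ => 1
  | .seq c₁ c₂, s => cost c₁ s + cost c₂ (run c₁ s)
  | .ite e c₁ c₂, s => 1 + if e.eval s ≠ 0 then cost c₁ s else cost c₂ s
  | .loop r e c, s => 1 + ∑ n ∈ Finset.range (e.eval s), (1 + cost c (iter (run c) r s n))

/-- Every assigned value is less than `M`, and the input is read only within its bounds. -/
def Safe (M : ℕ) : Com → St → Prop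
  | .skip, _ => True
  | .set _ e, s => e.Ok s ∧ e.eval s < M
  | .store _ i e, s => i.Ok s ∧ e.Ok s ∧ e.eval s < M
  | .emit e, s => e.Ok s
  | .seq c₁ c₂, s => Safe M c₁ s ∧ Safe M c₂ (run c₁ s)
  | .ite e c₁ c₂, s => e.Ok s ∧ if e.eval s ≠ 0 then Safe M c₁ s else Safe M c₂ s
  | .loop r e c, s => e.Ok s ∧ e.eval s < M ∧ ∀ n < e.eval s, Safe M c (iter (run c) r s n)

/-- The registers that a program may change. -/
def Com.regs : Com → List Reg
  | .skip => []
  | .set r _ => [r]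
  | .store _ _ _ => []
  | .emit _ => []
  | .seq c₁ c₂ => c₁.regs ++ c₂.regs
  | .ite _ c₁ c₂ => c₁.regs ++ c₂.regs
  | .loop r _ c => r :: c.regs

/-- The arrays that a program may change. -/
def Com.arrs : Com → List Arr
  | .skip => []
  | .set _ _ => []
  | .store a _ _ => [a]
  | .emit _ => []
  | .seq c₁ c₂ => c₁.arrs ++ c₂.arrs
  | .ite _ c₁ c₂ => c₁.arrs ++ c₂.arrs
  | .loop _ _ c => c.arrs

/-- Whether a program may produce output. -/
def Com.emits : Com → Bool
  | .emit _ => true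
  | .seq c₁ c₂ => c₁.emits || c₂.emits
  | .ite _ c₁ c₂ => c₁.emits || c₂.emits
  | .loop _ _ c => c.emits
  | _ => false

/-- No loop changes its own counter. -/
def Com.Wf : Com → Bool
  | .seq c₁ c₂ => c₁.Wf && c₂.Wf
  | .ite _ c₁ c₂ => c₁.Wf && c₂.Wf
  | .loop r _ c => decide (r ∉ c.regs) && c.Wf
  | _ => true

/-- What does not change when `c` turns `s` into `s'`. -/
structure Frame (c : Com) (s s' : St) : Prop where
  reg : ∀ r, r ∉ c.regs → s'.reg r = s.reg r
  arr : ∀ a, a ∉ c.arrs → s'.arr a = s.arr a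
  inp : s'.inp = s.inp
  out : c.emits = false → s'.out = s.out

/-- Stated for every partial iteration and not just for the final state, because loop bodies are
verified at intermediate states. -/
theorem Frame.iter {r : Reg} {c : Com} (e : Expr) (h : ∀ s, Frame c s (run c s)) (s : St) (n : ℕ) :
    Frame (.loop r e c) s (iter (run c) r s n) := by
  induction n with
  | zero =>
    refine ⟨fun x hx => ?_, fun a _ => rfl, rfl, fun _ => rfl⟩
    simp only [Com.regs, List.mem_cons, not_or] at hx
    simp [ArrayRam.iter, hx.1]
  | succ n ih =>
    have h' := h (ArrayRam.iter (run c) r s n)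
    refine ⟨fun x hx => ?_, fun a ha => ?_, h'.inp.trans ih.inp, fun ho => ?_⟩
    · have hx' := hx
      simp only [Com.regs, List.mem_cons, not_or] at hx'
      simp only [ArrayRam.iter, St.reg_setReg, hx'.1, if_false]
      rw [h'.reg x hx'.2, ih.reg x hx]
    · exact (h'.arr a ha).trans (ih.arr a ha)
    · exact (h'.out ho).trans (ih.out ho)

/-- The side conditions are membership in finite syntactic lists, so every later use for a concrete
program is settled by `decide`. -/
theorem frame_run (c : Com) : ∀ s, Frame c s (run c s) := by
  induction c with
  | skip => exact fun s => ⟨fun _ _ => rfl, fun _ _ => rfl, rfl, fun _ => rfl⟩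
  | set r e =>
    refine fun s => ⟨fun x hx => ?_, fun _ _ => rfl, rfl, fun _ => rfl⟩
    simp only [Com.regs, List.mem_singleton] at hx
    simp [run, hx]
  | store a i e =>
    refine fun s => ⟨fun _ _ => rfl, fun x hx => ?_, rfl, fun _ => rfl⟩
    simp only [Com.arrs, List.mem_singleton] at hx
    simp [run, hx]
  | emit e => exact fun s => ⟨fun _ _ => rfl, fun _ _ => rfl, rfl, fun h => by simp [Com.emits] at h⟩
  | seq c₁ c₂ h₁ h₂ =>
    intro s
    have a := h₁ s
    have b := h₂ (run c₁ s)
    refine ⟨fun x hx => ?_, fun x hx => ?_, b.inp.trans a.inp, fun ho => ?_⟩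
    · simp only [Com.regs, List.mem_append, not_or] at hx
      exact (b.reg x hx.2).trans (a.reg x hx.1)
    · simp only [Com.arrs, List.mem_append, not_or] at hx
      exact (b.arr x hx.2).trans (a.arr x hx.1)
    · simp only [Com.emits, Bool.or_eq_false_iff] at ho
      exact (b.out ho.2).trans (a.out ho.1)
  | ite e c₁ c₂ h₁ h₂ =>
    intro s
    simp only [run]
    split_ifs
    · have a := h₁ s
      refine ⟨fun x hx => ?_, fun x hx => ?_, a.inp, fun ho => ?_⟩
      · simp only [Com.regs, List.mem_append, not_or] at hx; exact a.reg x hx.1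
      · simp only [Com.arrs, List.mem_append, not_or] at hx; exact a.arr x hx.1
      · simp only [Com.emits, Bool.or_eq_false_iff] at ho; exact a.out ho.1
    · have a := h₂ s
      refine ⟨fun x hx => ?_, fun x hx => ?_, a.inp, fun ho => ?_⟩
      · simp only [Com.regs, List.mem_append, not_or] at hx; exact a.reg x hx.2
      · simp only [Com.arrs, List.mem_append, not_or] at hx; exact a.arr x hx.2
      · simp only [Com.emits, Bool.or_eq_false_iff] at ho; exact a.out ho.2
  | loop r e c h => exact fun s => Frame.iter e h s _

/-! ### Reasoning about programs -/

/-- Program `c` started in `s` is safe, takes at most `T` steps and ends in a state satisfying `Q`. -/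
def wp (M : ℕ) (c : Com) (s : St) (T : ℕ) (Q : St → Prop) : Prop :=
  Safe M c s ∧ cost c s ≤ T ∧ Q (run c s)

variable {M : ℕ}

/-- Handing the frame to the consequence step lets postconditions mention only what a program
changes. -/
theorem wp.mono {c : Com} {s : St} {T T' : ℕ} {Q Q' : St → Prop} (h : wp M c s T Q) (hT : T ≤ T')
    (hQ : ∀ s', Frame c s s' → Q s' → Q' s') : wp M c s T' Q' :=
  ⟨h.1, h.2.1.trans hT, hQ _ (frame_run c s) h.2.2⟩

theorem wp.seq {c₁ c₂ : Com} {s : St} {T₁ T₂ : ℕ} {P Q : St → Prop} (h : wp M c₁ s T₁ P)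
    (h' : ∀ s', Frame c₁ s s' → P s' → wp M c₂ s' T₂ Q) : wp M (c₁ ;; c₂) s (T₁ + T₂) Q :=
  have k := h' _ (frame_run c₁ s) h.2.2
  ⟨⟨h.1, k.1⟩, Nat.add_le_add h.2.1 k.2.1, k.2.2⟩

theorem wp.ite {e : Expr} {c₁ c₂ : Com} {s : St} {T : ℕ} {Q : St → Prop} (he : e.Ok s)
    (h₁ : e.eval s ≠ 0 → wp M c₁ s T Q) (h₂ : e.eval s = 0 → wp M c₂ s T Q) :
    wp M (.ite e c₁ c₂) s (T + 1) Q := by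
  by_cases h : e.eval s = 0
  · have := h₂ h
    simp only [wp, Safe, cost, run, h, ne_eq, not_true, if_false]
    exact ⟨⟨he, this.1⟩, by have := this.2.1; omega, this.2.2⟩
  · have := h₁ h
    simp only [wp, Safe, cost, run, h, ne_eq, not_false_eq_true, if_true]
    exact ⟨⟨he, this.1⟩, by have := this.2.1; omega, this.2.2⟩

/-- The invariant speaks of states whose counter is already set. The body is verified from any state
that agrees with the starting state outside the footprint of the loop, so facts about untouched
registers need not be part of the invariant. -/
theorem wp.loop {r : Reg} {e : Expr} {c : Com} {s : St} {τ n : ℕ} (Inv : ℕ → St → Prop)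
    (he : e.Ok s) (hn : e.eval s = n) (hM : n < M) (h0 : Inv 0 (s.setReg r 0))
    (hstep : ∀ i < n, ∀ s', Frame (.loop r e c) s s' → s'.reg r = i → Inv i s' →
      wp M c s' τ fun s'' => Inv (i + 1) (s''.setReg r (i + 1))) :
    wp M (.loop r e c) s (1 + n * (τ + 1)) fun s' => s'.reg r = n ∧ Inv n s' := by
  subst hn
  have hr : ∀ i, (iter (run c) r s i).reg r = i := fun i => by cases i <;> simp [iter]
  have hI : ∀ i ≤ e.eval s, Inv i (iter (run c) r s i) := by
    intro i
    induction i with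
    | zero => exact fun _ => h0
    | succ i ih =>
      intro hi
      exact (hstep i hi _ (Frame.iter e (frame_run c) s i) (hr i) (ih (by omega))).2.2
  have hw := fun i (hi : i < e.eval s) =>
    hstep i hi _ (Frame.iter e (frame_run c) s i) (hr i) (hI i hi.le)
  refine ⟨⟨he, hM, fun i hi => (hw i hi).1⟩, ?_, hr _, hI _ le_rfl⟩
  simp only [cost]
  have : ∑ n ∈ Finset.range (e.eval s), (1 + cost c (iter (run c) r s n))
      ≤ ∑ n ∈ Finset.range (e.eval s), (τ + 1) :=
    Finset.sum_le_sum fun i hi => by have := (hw i (Finset.mem_range.1 hi)).2.1; omega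
  simpa using this

/-- Verification condition of a loop-free program. -/
def vc (M : ℕ) : Com → (St → Prop) → St → Prop
  | .skip, Q, s => Q s
  | .set r e, Q, s => e.Ok s ∧ e.eval s < M ∧ Q (s.setReg r (e.eval s))
  | .store a i e, Q, s => i.Ok s ∧ e.Ok s ∧ e.eval s < M ∧ Q (s.setArr a (i.eval s) (e.eval s))
  | .emit e, Q, s => e.Ok s ∧ Q (s.emit (e.eval s))
  | .seq c₁ c₂, Q, s => vc M c₁ (vc M c₂ Q) s
  | .ite e c₁ c₂, Q, s => e.Ok s ∧ (e.eval s ≠ 0 → vc M c₁ Q s) ∧ (e.eval s = 0 → vc M c₂ Q s)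
  | .loop _ _ _, _, _ => False

/-- The running time of a loop-free program. -/
def Com.ticks : Com → ℕ
  | .seq c₁ c₂ => c₁.ticks + c₂.ticks
  | .ite _ c₁ c₂ => 1 + max c₁.ticks c₂.ticks
  | .loop _ _ _ => 0
  | _ => 1

theorem wp.basic {c : Com} {s : St} {Q : St → Prop} (h : vc M c Q s) : wp M c s c.ticks Q := by
  induction c generalizing s Q with
  | skip => exact ⟨trivial, le_rfl, h⟩
  | set r e => exact ⟨⟨h.1, h.2.1⟩, le_rfl, h.2.2⟩
  | store a i e => exact ⟨⟨h.1, h.2.1, h.2.2.1⟩, le_rfl, h.2.2.2⟩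
  | emit e => exact ⟨h.1, le_rfl, h.2⟩
  | seq c₁ c₂ h₁ h₂ => exact (h₁ h).seq fun s' _ hs' => h₂ hs'
  | ite e c₁ c₂ h₁ h₂ =>
    refine (wp.ite (T := max c₁.ticks c₂.ticks) h.1
      (fun he => (h₁ (h.2.1 he)).mono (le_max_left _ _) fun _ _ => id)
      fun he => (h₂ (h.2.2 he)).mono (le_max_right _ _) fun _ _ => id).mono ?_ fun _ _ => id
    simp only [Com.ticks]; omega
  | loop => exact h.elim

theorem wp.basic' {c : Com} {s : St} {T : ℕ} {Q : St → Prop} (hT : c.ticks ≤ T) (h : vc M c Q s) :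
    wp M c s T Q := (wp.basic h).mono hT fun _ _ => id

/-! ### Compilation -/

/-- The word RAM operation. -/
def Bop.comp : Bop → WordRam.Op
  | .add => .add | .sub => .sub | .mul => .mul | .div => .div | .mod => .mod | .lt => .lt | .eq => .eq

/-- The register that holds `r`. -/
def Reg.adr (r : Reg) : ℕ := 2 * r.ctorIdx + 1

/-- The register that holds the bound of a loop over `r`. -/
def Reg.bnd (r : Reg) : ℕ := 2 * r.ctorIdx + 2

/-- The address of a cell of array `a`. Register 0 holds the end of the input; beyond it the arrays
are interleaved. -/
def cell (a : Arr) (e : WordRam.Expr) : WordRam.Expr :=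
  .bin .add (.reg 0) (.bin .add (.bin .mul e (.const 64)) (.const a.ctorIdx))

/-- Compilation of expressions. -/
def Expr.comp : Expr → WordRam.Expr
  | .const k => .const k
  | .reg r => .reg r.adr
  | .arr a e => .load (cell a e.comp)
  | .inp e => .load e.comp
  | .bin o e₁ e₂ => .bin o.comp e₁.comp e₂.comp

/-- Compilation of programs. -/
def Com.comp : Com → WordRam.Cmd
  | .skip => .skip
  | .set r e => .set r.adr e.comp
  | .store a i e => .store (cell a i.comp) e.comp
  | .emit e => .emit e.comp
  | .seq c₁ c₂ => .seq c₁.comp c₂.comp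
  | .ite e c₁ c₂ => .cond e.comp c₁.comp c₂.comp
  | .loop r e c => .seq (.set r.bnd e.comp) (.seq (.set r.adr (.const 0))
      (.loop (.bin .lt (.reg r.adr) (.reg r.bnd))
        (.seq c.comp (.set r.adr (.bin .add (.reg r.adr) (.const 1))))))

/-- The values occurring in the evaluation of an expression are less than `M ^ size`. -/
def Expr.size : Expr → ℕ
  | .const k => k + 1
  | .reg _ => 1
  | .arr _ e => e.size + 2
  | .inp e => e.size
  | .bin _ e₁ e₂ => e₁.size + e₂.size

/-- A bound for the exponents needed by all expressions of a program. -/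
def Com.size : Com → ℕ
  | .skip => 0
  | .set _ e => e.size
  | .store _ i e => i.size + 2 + e.size
  | .emit e => e.size
  | .seq c₁ c₂ => c₁.size + c₂.size
  | .ite e c₁ c₂ => e.size + c₁.size + c₂.size
  | .loop _ e c => e.size + c.size

/-- A bound for the number of machine steps per command. -/
def Com.weight : Com → ℕ
  | .skip => 1
  | .set _ e => e.comp.cost + 1
  | .store a i e => (cell a i.comp).cost + e.comp.cost + 1
  | .emit e => e.comp.cost + 1
  | .seq c₁ c₂ => c₁.weight + c₂.weight
  | .ite e c₁ c₂ => e.comp.cost + 1 + c₁.weight + c₂.weight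
  | .loop _ e c => e.comp.cost + c.weight + 20

theorem Expr.size_pos (e : Expr) : 1 ≤ e.size := by
  induction e <;> simp only [Expr.size] <;> omega

/-- The machine state `t` represents the state `s`; all values are less than `M`. -/
structure Repr (M : ℕ) (s : St) (t : WordRam.State) : Prop where
  reg : ∀ r, t.reg r.adr = s.reg r
  arr : ∀ a i, t.mem (s.inp.length + (i * 64 + a.ctorIdx)) = s.arr a i
  inp : ∀ i < s.inp.length, t.mem i = s.inp.getD i 0
  base : t.reg 0 = s.inp.length
  out : t.out = s.out
  reg_lt : ∀ r, s.reg r < M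
  arr_lt : ∀ a i, s.arr a i < M
  inp_lt : ∀ i, s.inp.getD i 0 < M
  len_lt : s.inp.length < M

/-- Exponents add under every operation: for bounds that are at least 2 a sum is at most the
product, so sums are covered together with products. -/
theorem Expr.eval_lt_pow {s : St} (hM : 2 ≤ M) (hr : ∀ r, s.reg r < M) (ha : ∀ a i, s.arr a i < M)
    (hi : ∀ i, s.inp.getD i 0 < M) (e : Expr) : e.eval s < M ^ e.size := by
  have one : ∀ k, 1 ≤ k → M ≤ M ^ k := fun k hk => Nat.le_self_pow (by omega) M
  induction e with
  | const k =>
    exact lt_of_lt_of_le (Nat.lt_succ_self k |>.trans Nat.lt_two_pow_self)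
      (Nat.pow_le_pow_left hM _)
  | reg r => simpa [Expr.size] using hr r
  | arr a e _ => exact (ha _ _).trans_le (one _ (by simp [Expr.size]))
  | inp e _ => exact (hi _).trans_le (one _ (by simpa [Expr.size] using e.size_pos))
  | bin o e₁ e₂ h₁ h₂ =>
    have p₁ := one _ e₁.size_pos
    have p₂ := one _ e₂.size_pos
    have l₁ : e₁.eval s < M ^ (e₁.size + e₂.size) :=
      h₁.trans_le (Nat.pow_le_pow_right (by omega) (by omega))
    have hadd : M ^ e₁.size + M ^ e₂.size ≤ M ^ (e₁.size + e₂.size) := by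
      rw [pow_add]; nlinarith
    have h1 : 1 < M ^ (e₁.size + e₂.size) := by omega
    cases o <;> simp only [Expr.eval, Bop.eval, Expr.size]
    · omega
    · omega
    · rw [pow_add]; exact Nat.mul_lt_mul'' h₁ h₂
    · exact (Nat.div_le_self _ _).trans_lt l₁
    · exact (Nat.mod_le _ _).trans_lt l₁
    · split_ifs <;> omega
    · split_ifs <;> omega

section simulation

variable {w : ℕ} {s : St} {t : WordRam.State}

/-- The two additional factors M pay for the stride 64 and for the offset by the length of the
input; hence no reduction modulo 2 ^ w takes effect in the address computation. -/
theorem Repr.cell (hR : Repr M s t) (hM : 64 ≤ M) (a : Arr) {e : Expr}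
    (hw : M ^ (e.size + 2) ≤ 2 ^ w) (he : e.comp.eval w t = e.eval s) :
    (ArrayRam.cell a e.comp).eval w t = s.inp.length + (e.eval s * 64 + a.ctorIdx) := by
  have h := e.eval_lt_pow (by omega) hR.reg_lt hR.arr_lt hR.inp_lt
  have ha := a.ctorIdx_lt
  have h1 : e.eval s * 64 + a.ctorIdx < M ^ (e.size + 1) := by
    rw [pow_succ]
    calc e.eval s * 64 + a.ctorIdx < (e.eval s + 1) * 64 := by omega
      _ ≤ _ := Nat.mul_le_mul h hM
  have h2 : s.inp.length + (e.eval s * 64 + a.ctorIdx) < M ^ (e.size + 2) := by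
    have := hR.len_lt
    have hp : M ≤ M ^ (e.size + 1) := Nat.le_self_pow (by omega) M
    calc _ < M ^ (e.size + 1) + M ^ (e.size + 1) := by omega
      _ = M ^ (e.size + 1) * 2 := by ring
      _ ≤ _ := by rw [pow_succ M (e.size + 1)]; exact Nat.mul_le_mul_left _ (by omega)
  have c1 : 64 % 2 ^ w = 64 := Nat.mod_eq_of_lt (by
    have : M ^ 2 ≤ M ^ (e.size + 2) := Nat.pow_le_pow_right (by omega) (by omega)
    nlinarith)
  have c2 : a.ctorIdx % 2 ^ w = a.ctorIdx := Nat.mod_eq_of_lt (by omega)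
  have c3 : e.eval s * 64 % 2 ^ w = e.eval s * 64 := Nat.mod_eq_of_lt (by omega)
  have c4 : (e.eval s * 64 + a.ctorIdx) % 2 ^ w = e.eval s * 64 + a.ctorIdx :=
    Nat.mod_eq_of_lt (by omega)
  have c5 := Nat.mod_eq_of_lt (h2.trans_le hw)
  simp only [ArrayRam.cell, WordRam.Expr.eval, WordRam.Op.eval, he, hR.base, c1, c2, c3, c4, c5]

theorem Repr.eval (hR : Repr M s t) (hM : 64 ≤ M) {e : Expr} (hw : M ^ e.size ≤ 2 ^ w)
    (he : e.Ok s) : e.comp.eval w t = e.eval s := by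
  induction e with
  | const k =>
    exact Nat.mod_eq_of_lt <| ((Expr.const k).eval_lt_pow (by omega) hR.reg_lt hR.arr_lt
      hR.inp_lt).trans_le hw
  | reg r => exact hR.reg r
  | arr a e ih =>
    have := ih ((Nat.pow_le_pow_right (by omega) (by simp [Expr.size])).trans hw) he
    rw [Expr.comp, WordRam.Expr.eval, hR.cell hM a hw this, hR.arr]; rfl
  | inp e ih =>
    rw [Expr.comp, WordRam.Expr.eval, ih hw he.1, hR.inp _ he.2]; rfl
  | bin o e₁ e₂ h₁ h₂ =>
    have a₁ := h₁ ((Nat.pow_le_pow_right (by omega) (by simp [Expr.size])).trans hw) he.1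
    have a₂ := h₂ ((Nat.pow_le_pow_right (by omega) (by simp [Expr.size])).trans hw) he.2
    have := ((Expr.bin o e₁ e₂).eval_lt_pow (by omega) hR.reg_lt hR.arr_lt hR.inp_lt).trans_le hw
    rw [Expr.comp, WordRam.Expr.eval, a₁, a₂]
    rw [Expr.eval] at this ⊢
    cases o <;> exact Nat.mod_eq_of_lt this

theorem Reg.adr_injective : Function.Injective Reg.adr := fun a b h =>
  Reg.ctorIdx_injective (by simp only [Reg.adr] at h; omega)

theorem Repr.setReg (hR : Repr M s t) (r : Reg) {v : ℕ} (hv : v < M) :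
    Repr M (s.setReg r v) { t with reg := Function.update t.reg r.adr v } where
  reg r' := by
    rw [St.reg_setReg]
    by_cases h : r' = r
    · simp [h]
    · simpa [h, Function.update_apply, Reg.adr_injective.eq_iff] using hR.reg r'
  arr := hR.arr
  inp := hR.inp
  base := by
    simpa [Function.update_apply, Reg.adr] using hR.base
  out := hR.out
  reg_lt r' := by rw [St.reg_setReg]; split_ifs; exacts [hv, hR.reg_lt r']
  arr_lt := hR.arr_lt
  inp_lt := hR.inp_lt
  len_lt := hR.len_lt

/-- Odd machine registers hold the program registers, positive even ones the loop bounds, and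
register 0 the base address. Writing a loop bound is therefore invisible to the represented state.
-/
theorem Repr.setBnd (hR : Repr M s t) (r : Reg) (v : ℕ) :
    Repr M s { t with reg := Function.update t.reg r.bnd v } where
  reg r' := by
    have : r'.adr ≠ r.bnd := by simp only [Reg.adr, Reg.bnd]; omega
    simpa [this] using hR.reg r'
  arr := hR.arr
  inp := hR.inp
  base := by simpa [Function.update_apply, Reg.bnd] using hR.base
  out := hR.out
  reg_lt := hR.reg_lt
  arr_lt := hR.arr_lt
  inp_lt := hR.inp_lt
  len_lt := hR.len_lt

/-- Array indices are below the stride, so an address beyond the input determines both the array and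
the position in it. -/
theorem Repr.setArr (hR : Repr M s t) (a : Arr) (i : ℕ) {v : ℕ} (hv : v < M) :
    Repr M (s.setArr a i v)
      { t with mem := Function.update t.mem (s.inp.length + (i * 64 + a.ctorIdx)) v } where
  reg := hR.reg
  arr a' i' := by
    have h1 := a.ctorIdx_lt
    have h2 := a'.ctorIdx_lt
    rw [St.arr_setArr, St.inp_setArr]
    by_cases h : a' = a
    · subst h
      by_cases hi : i' = i
      · simp [hi]
      · have hne : s.inp.length + (i' * 64 + a'.ctorIdx) ≠ s.inp.length + (i * 64 + a'.ctorIdx) := by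
          omega
        simpa [hi, hne] using hR.arr a' i'
    · have hne : s.inp.length + (i' * 64 + a'.ctorIdx) ≠ s.inp.length + (i * 64 + a.ctorIdx) :=
        fun hh => h (Arr.ctorIdx_injective (by omega))
      rw [if_neg h]
      exact (Function.update_of_ne hne _ _).trans (hR.arr a' i')
  inp i' hi' := by
    have hi'' : i' < s.inp.length := hi'
    have hne : i' ≠ s.inp.length + (i * 64 + a.ctorIdx) := by omega
    simpa [hne] using hR.inp i' hi''
  base := hR.base
  out := hR.out
  reg_lt := hR.reg_lt
  arr_lt a' i' := by
    rw [St.arr_setArr]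
    split_ifs with h
    · rw [Function.update_apply]; split_ifs; exacts [hv, hR.arr_lt _ _]
    · exact hR.arr_lt _ _
  inp_lt := hR.inp_lt
  len_lt := hR.len_lt

theorem Repr.emit (hR : Repr M s t) (v : ℕ) :
    Repr M (s.emit v) { t with out := t.out ++ [v] } where
  reg := hR.reg
  arr := hR.arr
  inp := hR.inp
  base := hR.base
  out := by simp [hR.out]
  reg_lt := hR.reg_lt
  arr_lt := hR.arr_lt
  inp_lt := hR.inp_lt
  len_lt := hR.len_lt

end simulation

/-- The machine carries out a safe program, at constant cost per command. -/
theorem exec_comp {w : ℕ} (hM : 64 ≤ M) {c : Com} (hc : c.Wf = true) (hw : M ^ c.size ≤ 2 ^ w)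
    {s : St} (hs : Safe M c s) {t : WordRam.State} (hR : Repr M s t) :
    ∃ T t', WordRam.Exec w c.comp t T t' ∧ Repr M (run c s) t' ∧ T ≤ c.weight * cost c s ∧
      ∀ r, r ∉ c.regs → t'.reg r.bnd = t.reg r.bnd := by
  have hle : ∀ {a b : ℕ}, a ≤ b → M ^ b ≤ 2 ^ w → M ^ a ≤ 2 ^ w := fun h h' =>
    (Nat.pow_le_pow_right (by omega) h).trans h'
  have hbne : ∀ r r' : Reg, r'.bnd ≠ r.adr := fun r r' => by simp only [Reg.adr, Reg.bnd]; omega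
  induction c generalizing s t with
  | skip => exact ⟨_, _, .skip t, hR, by simp [Com.weight, cost], fun _ _ => rfl⟩
  | set r e =>
    refine ⟨_, _, .set t _ _, ?_, by simp [Com.weight, cost], fun r' _ => ?_⟩
    · rw [hR.eval hM hw hs.1]; exact hR.setReg r hs.2
    · simp [hbne]
  | store a i e =>
    simp only [Com.size] at hw
    refine ⟨_, _, .store t _ _, ?_, by simp [Com.weight, cost], fun r' _ => rfl⟩
    rw [hR.eval hM (hle (by omega) hw) hs.2.1, hR.cell hM a (hle (by omega) hw)
      (hR.eval hM (hle (by omega) hw) hs.1)]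
    exact hR.setArr a _ hs.2.2
  | emit e =>
    refine ⟨_, _, .emit t _, ?_, by simp [Com.weight, cost], fun r' _ => rfl⟩
    rw [hR.eval hM hw hs]; exact hR.emit _
  | seq c₁ c₂ h₁ h₂ =>
    simp only [Com.size] at hw
    simp only [Com.Wf, Bool.and_eq_true] at hc
    obtain ⟨T₁, t₁, e₁, R₁, l₁, b₁⟩ := h₁ hc.1 (hle (by omega) hw) hs.1 hR
    obtain ⟨T₂, t₂, e₂, R₂, l₂, b₂⟩ := h₂ hc.2 (hle (by omega) hw) hs.2 R₁
    refine ⟨_, _, .seq e₁ e₂, R₂, ?_, fun r hr => ?_⟩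
    · simp only [Com.weight, cost]
      nlinarith [Nat.zero_le (c₁.weight * cost c₂ (run c₁ s)), Nat.zero_le (c₂.weight * cost c₁ s)]
    · simp only [Com.regs, List.mem_append, not_or] at hr
      rw [b₂ r hr.2, b₁ r hr.1]
  | ite e c₁ c₂ h₁ h₂ =>
    simp only [Com.size] at hw
    simp only [Com.Wf, Bool.and_eq_true] at hc
    have hev : e.comp.eval w t = e.eval s := hR.eval hM (hle (by omega) hw) hs.1
    have hs2 := hs.2
    simp only [Com.regs, List.mem_append, not_or]
    by_cases h : e.eval s = 0
    · simp only [h, ne_eq, not_true, if_false] at hs2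
      obtain ⟨T₂, t₂, e₂, R₂, l₂, b₂⟩ := h₂ hc.2 (hle (by omega) hw) hs2 hR
      refine ⟨_, t₂, .condFalse (hev.trans h) e₂, by simpa [run, h] using R₂, ?_,
        fun r hr => b₂ r hr.2⟩
      simp only [Com.weight, cost, h, ne_eq, not_true, if_false]
      nlinarith [Nat.zero_le (c₁.weight * cost c₂ s), Nat.zero_le (e.comp.cost * cost c₂ s)]
    · simp only [h, ne_eq, not_false_eq_true, if_true] at hs2
      obtain ⟨T₂, t₂, e₂, R₂, l₂, b₂⟩ := h₁ hc.1 (hle (by omega) hw) hs2 hR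
      refine ⟨_, t₂, .condTrue (by rwa [hev]) e₂, by simpa [run, h] using R₂, ?_,
        fun r hr => b₂ r hr.1⟩
      simp only [Com.weight, cost, h, ne_eq, not_false_eq_true, if_true]
      nlinarith [Nat.zero_le (c₂.weight * cost c₁ s), Nat.zero_le (e.comp.cost * cost c₁ s)]
  | loop r e c ih =>
    simp only [Com.size] at hw
    simp only [Com.Wf, Bool.and_eq_true, decide_eq_true_eq] at hc
    obtain ⟨hok, hn, hsafe⟩ := hs
    have hev : e.comp.eval w t = e.eval s := hR.eval hM (hle (by omega) hw) hok
    have hMw : M ≤ 2 ^ w :=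
      (Nat.le_self_pow (by have := e.size_pos; omega) M).trans hw
    set n := e.eval s with hnd
    have h0w : 0 % 2 ^ w = 0 := Nat.zero_mod _
    have h1w : 1 % 2 ^ w = 1 := Nat.mod_eq_of_lt (by omega)
    -- Induction on the number d of iterations still to come. The stored bound survives the body
    -- because the counter of a well-formed loop does not occur among the registers of its body;
    -- this is what the last clause of the theorem is for.
    have key : ∀ d k, k + d = n → ∀ t₁, Repr M (iter (run c) r s k) t₁ → t₁.reg r.bnd = n →
        ∃ T t', WordRam.Exec w (.loop (.bin .lt (.reg r.adr) (.reg r.bnd))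
          (.seq c.comp (.set r.adr (.bin .add (.reg r.adr) (.const 1))))) t₁ T t' ∧
          Repr M (iter (run c) r s n) t' ∧
          T ≤ 4 + ∑ i ∈ Finset.range d, (c.weight + 20) * (1 + cost c (iter (run c) r s (k + i))) ∧
          ∀ r', r' ∉ r :: c.regs → t'.reg r'.bnd = t₁.reg r'.bnd := by
      intro d
      induction d with
      | zero =>
        intro k hk t₁ hR₁ hb
        have hk' : k = n := by omega
        have hreg : (iter (run c) r s k).reg r = k := by cases k <;> simp [iter]
        refine ⟨_, t₁, .loopDone ?_, hk' ▸ hR₁, by simp [WordRam.Expr.cost], fun _ _ => rfl⟩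
        simp only [WordRam.Expr.eval, WordRam.Op.eval, hR₁.reg, hreg, hb]
        rw [if_neg (by omega), h0w]
      | succ d ihd =>
        intro k hk t₁ hR₁ hb
        have hreg : (iter (run c) r s k).reg r = k := by cases k <;> simp [iter]
        obtain ⟨T₂, t₂, e₂, R₂, l₂, b₂⟩ := ih hc.2 (hle (by omega) hw) (hsafe k (by omega)) hR₁
        have hreg₂ : (run c (iter (run c) r s k)).reg r = k := by
          rw [(frame_run c _).reg r hc.1, hreg]
        have hinc : (WordRam.Expr.bin .add (.reg r.adr) (.const 1)).eval w t₂ = k + 1 := by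
          simp only [WordRam.Expr.eval, WordRam.Op.eval, R₂.reg, hreg₂, h1w]
          exact Nat.mod_eq_of_lt (by omega)
        have R₃ := R₂.setReg r (v := k + 1) (by omega)
        have hb₃ : (Function.update t₂.reg r.adr (k + 1)) r.bnd = n := by
          rw [Function.update_of_ne (hbne r r), b₂ r hc.1, hb]
        obtain ⟨T₄, t₄, e₄, R₄, l₄, b₄⟩ := ihd (k + 1) (by omega) _ R₃ hb₃
        have e₃ := WordRam.Exec.set (w := w) t₂ r.adr (.bin .add (.reg r.adr) (.const 1))
        rw [hinc] at e₃
        refine ⟨_, t₄, .loopStep ?_ (.seq e₂ e₃) e₄, R₄, ?_, fun r' hr' => ?_⟩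
        · have : k < n := by omega
          simp only [WordRam.Expr.eval, WordRam.Op.eval, hR₁.reg, hreg, hb, this, if_true, h1w]
          exact one_ne_zero
        · rw [Finset.sum_range_succ']
          simp only [WordRam.Expr.cost, add_zero]
          have hk1 : ∀ i, k + 1 + i = k + (i + 1) := fun i => by omega
          simp only [hk1] at l₄
          have : c.weight * cost c (iter (run c) r s k) ≤
              (c.weight + 20) * cost c (iter (run c) r s k) := Nat.mul_le_mul_right _ (by omega)
          rw [Nat.mul_add (c.weight + 20)]
          omega
        · rw [b₄ r' hr']
          simp only [List.mem_cons, not_or] at hr'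
          simp only [Function.update_of_ne (hbne r r')]
          exact b₂ r' hr'.2
    have R₁ := (hR.setBnd r n).setReg r (v := 0) (by omega)
    obtain ⟨T, t', ex, R', l, b⟩ := key n 0 (by omega) _ R₁ (by
      simp [Function.update_of_ne (hbne r r)])
    have e₁ := WordRam.Exec.set (w := w) t r.bnd e.comp
    rw [hev] at e₁
    have e₂ := WordRam.Exec.set (w := w) { t with reg := Function.update t.reg r.bnd n } r.adr
      (.const 0)
    have hz : ∀ t : WordRam.State, (WordRam.Expr.const 0).eval w t = 0 := fun t => h0w
    rw [hz] at e₂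
    refine ⟨_, t', .seq e₁ (.seq e₂ ex), R', ?_, fun r' hr' => ?_⟩
    · simp only [Com.weight, cost, WordRam.Expr.cost, zero_add] at l ⊢
      rw [← Finset.mul_sum] at l
      set tot := ∑ i ∈ Finset.range n, (1 + cost c (iter (run c) r s i))
      nlinarith [Nat.zero_le (e.comp.cost * tot)]
    · rw [b r' hr']
      simp only [Com.regs, List.mem_cons, not_or] at hr'
      have : r'.bnd ≠ r.bnd := by
        simp only [Reg.bnd, ne_eq]
        intro h
        exact hr'.1 (Reg.ctorIdx_injective (by omega))
      simp [Function.update_of_ne (hbne r r'), Function.update_of_ne this]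

end ArrayRam

/-! ### Segments of functions, inversions, digits -/

/-- The values of `f` at `a, …, a + n - 1`. -/
def seg (f : ℕ → ℕ) (a n : ℕ) : List ℕ := (List.range n).map fun i => f (a + i)

section seg
variable {f f' : ℕ → ℕ} {a a' n k i v : ℕ}

@[simp] theorem length_seg : (seg f a n).length = n := by simp [seg]

@[simp] theorem seg_zero : seg f a 0 = [] := rfl

theorem seg_succ : seg f a (n + 1) = seg f a n ++ [f (a + n)] := by simp [seg, List.range_succ]

theorem seg_add : seg f a (n + k) = seg f a n ++ seg f (a + n) k := by
  induction k with
  | zero => simp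
  | succ k ih => rw [← add_assoc, seg_succ, ih, seg_succ, List.append_assoc, add_assoc]

theorem seg_congr (h : ∀ i < n, f (a + i) = f' (a' + i)) : seg f a n = seg f' a' n := by
  simp only [seg]
  exact List.map_congr_left fun i hi => h i (List.mem_range.1 hi)

theorem seg_update_of_notMem (h : i < a ∨ a + n ≤ i) :
    seg (Function.update f i v) a n = seg f a n :=
  seg_congr fun j hj => Function.update_of_ne (by omega) _ _

theorem seg_update_succ : seg (Function.update f (a + n) v) a (n + 1) = seg f a n ++ [v] := by
  rw [seg_succ, seg_update_of_notMem (Or.inr le_rfl), Function.update_self]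

theorem getElem_seg (h : i < (seg f a n).length) : (seg f a n)[i] = f (a + i) := by simp [seg]

theorem seg_eq_iff {l : List ℕ} (hl : l.length = n) :
    seg f a n = l ↔ ∀ i (h : i < l.length), f (a + i) = l[i] := by
  constructor
  · rintro rfl i h
    rw [getElem_seg]
  · intro h
    refine List.ext_getElem (by simp [hl]) fun i h₁ h₂ => ?_
    rw [getElem_seg, h i h₂]

theorem mem_seg {x : ℕ} : x ∈ seg f a n ↔ ∃ i < n, f (a + i) = x := by simp [seg]

theorem map_seg (φ : ℕ → ℕ) : (seg f a n).map φ = seg (fun i => φ (f i)) a n := by simp [seg]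

/-- A block of a segment, read off from a splitting of the segment. -/
theorem seg_of_append {l₁ l₂ l₃ : List ℕ} (h : seg f a n = l₁ ++ l₂ ++ l₃) :
    seg f (a + l₁.length) l₂.length = l₂ := by
  have hn : n = l₁.length + l₂.length + l₃.length := by
    have := congrArg List.length h; simpa [add_assoc] using this
  subst hn
  rw [seg_add, seg_add] at h
  have h1 := (List.append_inj h (by simp)).1
  exact (List.append_inj h1 (by simp)).2

end seg

/-- The number of inversions of a list. -/
def invL : List ℕ → ℕ
  | [] => 0
  | x :: l => l.countP (fun y => y < x) + invL l

/-- The number of pairs of an earlier element that satisfies `p` and a later one that does not. -/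
def crossL (p : ℕ → Bool) : List ℕ → ℕ
  | [] => 0
  | x :: l => (if p x then l.countP (fun y => !p y) else 0) + crossL p l

/-- The definition charges an inversion to its earlier element; loops that extend a list at the end
need the charge on the later one. -/
theorem invL_concat (l : List ℕ) (x : ℕ) : invL (l ++ [x]) = invL l + l.countP fun y => x < y := by
  induction l with
  | nil => simp [invL]
  | cons y l ih =>
    simp only [List.cons_append, invL, ih, List.countP_append, List.countP_cons, List.countP_nil,
      decide_eq_true_eq]
    split_ifs <;> omega

/-- This makes it possible to treat a packed word as a unit: a tabulated count inside the word plus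
one product of two counts. -/
theorem crossL_append (p : ℕ → Bool) (l l' : List ℕ) :
    crossL p (l ++ l') = crossL p l + crossL p l' + l.countP p * l'.countP fun y => !p y := by
  induction l with
  | nil => simp [crossL]
  | cons y l ih =>
    simp only [List.cons_append, crossL, ih, List.countP_append, List.countP_cons]
    by_cases h : p y
    · simp [h]; ring
    · simp [h]

theorem crossL_map (p : ℕ → Bool) (φ : ℕ → ℕ) (l : List ℕ) :
    crossL p (l.map φ) = crossL (fun x => p (φ x)) l := by
  induction l with
  | nil => rfl
  | cons y l ih => simp [crossL, ih, List.countP_map, Function.comp_def]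

theorem crossL_congr {p p' : ℕ → Bool} {l : List ℕ} (h : ∀ x ∈ l, p x = p' x) :
    crossL p l = crossL p' l := by
  induction l with
  | nil => rfl
  | cons y l ih =>
    have h1 := h y (by simp)
    have h2 := ih fun x hx => h x (by simp [hx])
    have h3 : l.countP (fun y => !p y) = l.countP fun y => !p' y :=
      List.countP_congr fun x hx => by simp [h x (List.mem_cons_of_mem _ hx)]
    simp [crossL, h1, h2, h3]

/-- Inversions are counted by splitting a list at a threshold. -/
theorem invL_split {p : ℕ → Bool} {l : List ℕ}
    (h : ∀ x ∈ l, ∀ y ∈ l, p x = true → p y = false → y < x) :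
    invL l = invL (l.filter fun y => !p y) + invL (l.filter p) + crossL p l := by
  induction l with
  | nil => rfl
  | cons x l ih =>
    have ih := ih fun a ha b hb => h a (by simp [ha]) b (by simp [hb])
    have hsum : l.countP (fun y => decide (y < x)) =
        (l.filter p).countP (fun y => decide (y < x)) +
          (l.filter fun y => !p y).countP fun y => decide (y < x) := by
      rw [List.countP_eq_countP_filter_add _ _ p]
    by_cases hx : p x = true
    · have h1 : (l.filter fun y => !p y).countP (fun y => decide (y < x)) =
          l.countP fun y => !p y := by
        rw [List.countP_filter]
        refine List.countP_congr fun y hy => ?_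
        simp only [Bool.and_eq_true, decide_eq_true_eq, Bool.not_eq_true', and_iff_right_iff_imp]
        exact fun hy' => h x (by simp) y (by simp [hy]) hx hy'
      simp [invL, crossL, hx, hsum, h1, ih]
      ring
    · have hx' : p x = false := by simpa using hx
      have h1 : (l.filter p).countP (fun y => decide (y < x)) = 0 := by
        rw [List.countP_eq_zero]
        intro y hy
        rw [List.mem_filter] at hy
        have := h y (by simp [hy.1]) x (by simp) hy.2 hx'
        simp; omega
      simp [invL, crossL, hx', hsum, h1, ih]
      ring

/-- The elements of a list whose quotient by `S` is `c`. -/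
def blk (P : List ℕ) (S c : ℕ) : List ℕ := P.filter fun x => x / S = c

/-! ### Blocks of values that share their high bits -/

section blk
variable {P : List ℕ} {N S : ℕ}

/-- A permutation contains each value of the interval [cS, (c + 1)S) exactly once. -/
theorem length_blk (hP : P.Perm (List.range N)) (hS : 0 < S) {c : ℕ}
    (hc : c < N / S) : (blk P S c).length = S := by
  rw [blk, (hP.filter _).length_eq]
  have hN : (c + 1) * S ≤ N := (Nat.le_div_iff_mul_le hS).1 hc
  have : ((List.range N).filter fun x => decide (x / S = c)).toFinset =
      Finset.Ico (c * S) ((c + 1) * S) := by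
    ext x
    simp only [List.toFinset_filter, List.toFinset_range, Finset.mem_filter, Finset.mem_range,
      decide_eq_true_eq, Finset.mem_Ico]
    rw [Nat.div_eq_iff hS]
    constructor
    · rintro ⟨_, h1, h2⟩
      rw [Nat.succ_mul]; omega
    · rintro ⟨h1, h2⟩
      rw [Nat.succ_mul] at h2 hN; omega
  rw [← List.toFinset_card_of_nodup (List.nodup_range.filter _), this, Nat.card_Ico, Nat.succ_mul]
  omega

theorem blk_two_mul (c : ℕ) :
    (blk P (2 * S) c).filter (fun x => !decide (x / S % 2 = 1)) = blk P S (2 * c) := by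
  simp only [blk, List.filter_filter]
  refine List.filter_congr fun x _ => ?_
  rw [mul_comm 2 S, ← Nat.div_div_eq_div_mul]
  rw [Bool.eq_iff_iff]
  simp
  omega

theorem blk_two_mul_add_one (c : ℕ) :
    (blk P (2 * S) c).filter (fun x => decide (x / S % 2 = 1)) = blk P S (2 * c + 1) := by
  simp only [blk, List.filter_filter]
  refine List.filter_congr fun x _ => ?_
  rw [mul_comm 2 S, ← Nat.div_div_eq_div_mul]
  rw [Bool.eq_iff_iff]
  simp
  omega

/-- Inside a block of size 2S the parity of x / S tells the two halves apart, and all values of the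
odd half exceed those of the even half, as `invL_split` requires. -/
theorem invL_blk_two_mul (c : ℕ) :
    invL (blk P (2 * S) c) = invL (blk P S (2 * c)) + invL (blk P S (2 * c + 1)) +
      crossL (fun x => decide (x / S % 2 = 1)) (blk P (2 * S) c) := by
  rw [invL_split (p := fun x => decide (x / S % 2 = 1)), blk_two_mul, blk_two_mul_add_one]
  intro x hx y hy h1 h2
  simp only [blk, List.mem_filter, mul_comm 2 S, ← Nat.div_div_eq_div_mul,
    decide_eq_true_eq] at hx hy
  simp only [decide_eq_true_eq, decide_eq_false_iff_not] at h1 h2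
  have : y / S < x / S := by omega
  by_contra hxy
  have := Nat.div_le_div_right (c := S) (not_lt.1 hxy)
  omega

/-- The inversions within the blocks of size `S`. -/
def innerInv (P : List ℕ) (N S : ℕ) : ℕ := ∑ c ∈ Finset.range (N / S), invL (blk P S c)

/-- The inversions within blocks of size `2 * S` between their two halves. -/
def crossInv (P : List ℕ) (N S : ℕ) : ℕ :=
  ∑ c ∈ Finset.range (N / (2 * S)),
    crossL (fun x => decide (x / S % 2 = 1)) (blk P (2 * S) c)

/-- The recursion behind the algorithm: each doubling of the block size accounts for one bit, so the
inversions telescope into crossings, bit by bit. -/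
theorem innerInv_two_mul (hS : 0 < S) (hd : 2 * S ∣ N) :
    innerInv P N (2 * S) = innerInv P N S + crossInv P N S := by
  obtain ⟨k, rfl⟩ := hd
  have h1 : 2 * S * k / (2 * S) = k := Nat.mul_div_cancel_left _ (by omega)
  have h2 : 2 * S * k / S = 2 * k := by
    rw [show 2 * S * k = S * (2 * k) by ring, Nat.mul_div_cancel_left _ hS]
  simp only [innerInv, crossInv, h1, h2, invL_blk_two_mul, Finset.sum_add_distrib]
  congr 1
  clear h1 h2
  induction k with
  | zero => simp
  | succ k ih =>
    rw [Finset.sum_range_succ, Finset.sum_range_succ, show 2 * (k + 1) = 2 * k + 1 + 1 by ring,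
      Finset.sum_range_succ, Finset.sum_range_succ, ← ih]
    ring

theorem innerInv_self (hP : P.Perm (List.range N)) (hN : 0 < N) : innerInv P N N = invL P := by
  simp only [innerInv, Nat.div_self hN, Finset.sum_range_one, blk]
  rw [List.filter_eq_self.2]
  intro x hx
  have := List.mem_range.1 (hP.subset hx)
  simp [Nat.div_eq_of_lt this]

end blk

section digits
variable {D : ℕ}

theorem ofDigits_lt {l : List ℕ} (h : ∀ x ∈ l, x < D) : Nat.ofDigits D l < D ^ l.length := by
  induction l with
  | nil => simp
  | cons x l ih =>
    have h1 := h x (by simp)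
    have h2 := ih fun y hy => h y (by simp [hy])
    rw [Nat.ofDigits_cons, List.length_cons, pow_succ]
    nlinarith

theorem ofDigits_div_mod {l : List ℕ} (h : ∀ x ∈ l, x < D) {i : ℕ} (hi : i < l.length) :
    Nat.ofDigits D l / D ^ i % D = l[i] := by
  induction l generalizing i with
  | nil => simp at hi
  | cons x l ih =>
    have h1 := h x (by simp)
    rw [Nat.ofDigits_cons]
    cases i with
    | zero => simp [Nat.mod_eq_of_lt h1]
    | succ i =>
      rw [pow_succ', ← Nat.div_div_eq_div_mul, Nat.add_mul_div_left _ _ (by omega),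
        Nat.div_eq_of_lt h1, zero_add]
      simpa using ih (fun y hy => h y (by simp [hy])) (by simpa using hi)

theorem ofDigits_concat (l : List ℕ) (x : ℕ) :
    Nat.ofDigits D (l ++ [x]) = Nat.ofDigits D l + D ^ l.length * x := by
  rw [Nat.ofDigits_append, Nat.ofDigits_singleton]

end digits

/-! ### Stable counting sort by the high bits -/

namespace ArrayRam

notation:max a "⟦" i "⟧" => Expr.arr a i
notation:61 a "⟦" i "⟧" " ⇐ " e:61 => Com.store a i e
infix:61 " ≔ " => Com.set
infix:63 " ≺ " => Expr.bin Bop.lt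
infix:63 " ≐ " => Expr.bin Bop.eq

variable {M : ℕ} {s : St}

theorem mul_add_lt_mul {a b r S : ℕ} (h : a < b) (hr : r < S) : a * S + r < b * S := by
  have := Nat.mul_le_mul_right S (Nat.succ_le_of_lt h)
  rw [Nat.succ_mul] at this; omega

open Reg Arr in
/-- Sort the permutation in `X` stably by the quotient by `S`, into `T`. -/
def distribute : Com :=
  .loop i (N / S) (CNT⟦i⟧ ⇐ 0) ;;
  .loop i N (
    v ≔ X⟦i⟧ ;;
    q ≔ v / S ;;
    x ≔ CNT⟦q⟧ ;;
    T⟦q * S + x⟧ ⇐ v ;;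
    CNT⟦q⟧ ⇐ x + 1)

/-- No prefix sums are needed: every block has exactly S elements, so block q owns the cells from q
* S on, and an element goes to the offset given by the number of earlier elements of its block. -/
theorem distribute_spec {P : List ℕ} {N S : ℕ} (hN : s.reg .N = N) (hS : s.reg .S = S)
    (hX : seg (s.arr .X) 0 N = P) (hP : P.Perm (List.range N)) (hd : S ∣ N) (h0 : 0 < S)
    (hM : N < M) :
    wp M distribute s (10 * N + 2) fun s' =>
      ∀ c < N / S, seg (s'.arr .T) (c * S) S = blk P S c := by
  have hNS : N / S ≤ N := Nat.div_le_self _ _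
  have hlen : P.length = N := by rw [← hX, length_seg]
  refine (wp.seq (T₁ := 1 + N / S * (1 + 1)) (T₂ := 1 + N * (5 + 1)) (wp.loop
    (fun i s' => ∀ q < i, s'.arr .CNT q = 0) (by simp) (by simp [hN, hS]) (by omega) (by simp)
    fun i hi s' f hi' hI => wp.basic' (by decide) ?_) fun s₁ f₁ hs₁ => ?_).mono (by omega)
    fun s' _ h => h
  · simp only [vc, Expr.ok_reg, Expr.ok_ofNat, Expr.eval_reg, Expr.eval_ofNat, true_and, hi',
      St.arr_setReg, St.arr_setArr, if_true]
    refine ⟨by omega, fun q hq => ?_⟩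
    rw [Function.update_apply]
    split_ifs
    · rfl
    · exact hI q (by omega)
  refine (wp.loop (n := N) (τ := 5) (fun i s' => ∀ q < N / S,
      s'.arr .CNT q = (blk (P.take i) S q).length ∧
      seg (s'.arr .T) (q * S) (blk (P.take i) S q).length = blk (P.take i) S q)
      (by simp) (by simpa [hN] using f₁.reg .N (by decide)) hM (by simpa [blk] using hs₁.2)
      fun i hi s' f hi' hI => wp.basic' (by decide) ?_).mono (by omega) ?_
  · have hS' : s'.reg .S = S := by rw [f.reg .S (by decide), f₁.reg .S (by decide), hS]
    have hX' : s'.arr .X = s.arr .X := by rw [f.arr .X (by decide), f₁.arr .X (by decide)]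
    have hv : s.arr .X i = P[i] := by
      have := (seg_eq_iff hlen).1 hX i (by omega)
      simpa using this
    have hvN : P[i] < N := List.mem_range.1 (hP.subset (List.getElem_mem _))
    have hq : P[i] / S < N / S := Nat.div_lt_div_of_lt_of_dvd hd hvN
    have hblk : ∀ q, blk (P.take (i + 1)) S q =
        blk (P.take i) S q ++ if P[i] / S = q then [P[i]] else [] := by
      intro q
      rw [← List.take_append_getElem (by omega : i < P.length)]
      simp only [blk, List.filter_append, List.filter_cons, List.filter_nil, decide_eq_true_eq]
    have hle : ∀ q < N / S, ∀ k, (blk (P.take k) S q).length ≤ S := by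
      intro q hq k
      refine le_of_le_of_eq ?_ (length_blk hP h0 hq)
      exact ((List.take_sublist k P).filter _).length_le
    -- The prefix of length i + 1 contains one more element of this block than the prefix of length
    -- i, so the counter is still below S; the store cannot spill into the next block.
    have hlt : (blk (P.take i) S (P[i] / S)).length < S := by
      have := hle _ hq (i + 1)
      rw [hblk] at this
      simpa using this
    have hSN : S ≤ N := Nat.le_of_dvd (by omega) hd
    simp only [vc, Expr.ok_reg, Expr.ok_ofNat, Expr.eval_reg, Expr.eval_ofNat, true_and, hi',
      St.arr_setReg, St.arr_setArr, if_true, Expr.ok_arr, Expr.eval_arr, Expr.ok_add, Expr.ok_mul,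
      Expr.ok_div, Expr.eval_add, Expr.eval_mul, Expr.eval_div, St.reg_setReg, St.reg_setArr,
      reduceCtorEq, if_false, hS', hX', hv, (hI _ hq).1]
    refine ⟨by omega, by omega, by omega, by omega, by omega, fun q hq' => ?_⟩
    rw [hblk]
    obtain ⟨c1, c2⟩ := hI q hq'
    by_cases hqq : P[i] / S = q
    · simp only [hqq, if_true, List.length_append, List.length_singleton, Function.update_self, true_and]
      rw [seg_update_succ, c2]
    · simp only [hqq, if_false, List.append_nil]
      rw [Function.update_of_ne (Ne.symm hqq), seg_update_of_notMem, c2]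
      · exact ⟨c1, rfl⟩
      · have := hle q hq' i
        rcases lt_or_gt_of_ne hqq with h | h
        · left; exact mul_add_lt_mul h hlt
        · right
          have := Nat.mul_le_mul_right S (Nat.succ_le_of_lt h)
          rw [Nat.succ_mul] at this; omega
  · rintro s' - ⟨-, h⟩ c hc
    obtain ⟨-, h⟩ := h c hc
    rw [← hlen, List.take_length, length_blk hP h0 (by omega)] at h
    exact h

end ArrayRam

/-! ### Packing digits into words and tabulating words -/

namespace ArrayRam

variable {M : ℕ} {s s' : St}

/-- The parameters of the packed representation: `N` elements, `g` digits in base `D` per word. -/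
structure Ctx (s : St) (N g D : ℕ) : Prop where
  regN : s.reg .N = N
  regg : s.reg .g = g
  regD : s.reg .D = D
  regDG : s.reg .DG = D ^ g
  arrPW : ∀ i ≤ g, s.arr .PW i = D ^ i

theorem Ctx.frame {N g D : ℕ} {c : Com} (h : Ctx s N g D) (f : Frame c s s')
    (hc : (∀ r ∈ [Reg.N, .g, .D, .DG], r ∉ c.regs) ∧ Arr.PW ∉ c.arrs) : Ctx s' N g D := by
  simp only [List.forall_mem_cons] at hc
  obtain ⟨⟨h1, h2, h3, h4, -⟩, h5⟩ := hc
  exact ⟨by rw [f.reg _ h1, h.regN], by rw [f.reg _ h2, h.regg], by rw [f.reg _ h3, h.regD],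
    by rw [f.reg _ h4, h.regDG], fun i hi => by rw [f.arr _ h5, h.arrPW i hi]⟩

open Reg Arr in
/-- Pack the digits of the entries of `T`, `g` to a word. -/
def pack : Com :=
  .loop j (N / g) (
    acc ≔ 0 ;;
    .loop i g (acc ≔ acc + T⟦j * g + i⟧ / LO % D * PW⟦i⟧) ;;
    PK⟦j⟧ ⇐ acc)

theorem ofDigits_seg_succ (D : ℕ) (f : ℕ → ℕ) (a n : ℕ) :
    Nat.ofDigits D (seg f a (n + 1)) = Nat.ofDigits D (seg f a n) + f (a + n) * D ^ n := by
  rw [seg_succ, ofDigits_concat, length_seg, mul_comm]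

theorem ofDigits_seg_lt {D : ℕ} {f : ℕ → ℕ} (h : ∀ i, f i < D) (a n : ℕ) :
    Nat.ofDigits D (seg f a n) < D ^ n := by
  have := ofDigits_lt (D := D) (l := seg f a n) fun x hx => by
    obtain ⟨i, -, rfl⟩ := mem_seg.1 hx; exact h _
  simpa using this

theorem pack_spec {N g D lo : ℕ} (hC : Ctx s N g D) (hlo : s.reg .LO = lo)
    (hD : 0 < D) (hN : N < M) (hgN : g < M) (hDM : D ^ g < M) :
    wp M pack s (N / g * (2 * g + 4) + 1) fun s' => ∀ j < N / g,
      s'.arr .PK j = Nat.ofDigits D (seg (fun i => s.arr .T i / lo % D) (j * g) g) := by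
  set y : ℕ → ℕ := fun i => s.arr .T i / lo % D with hy
  have hyD : ∀ i, y i < D := fun i => Nat.mod_lt _ hD
  have hle : N / g ≤ N := Nat.div_le_self _ _
  refine (wp.loop (n := N / g) (τ := 1 + (1 + g * (1 + 1)) + 1) (fun j s' => ∀ k < j,
    s'.arr .PK k = Nat.ofDigits D (seg y (k * g) g)) (by simp) (by simp [hC.regN, hC.regg]) (by omega)
    (by simp) fun j hj s₁ f₁ hj₁ hI => ?_).mono
      ((add_comm _ _).trans_le (Nat.add_le_add_right (Nat.mul_le_mul_left _ (by omega)) 1)) fun _ _ h => h.2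
  have hC₁ := hC.frame f₁ (by decide)
  have hT₁ := f₁.arr .T (by decide)
  have hlo₁ := (f₁.reg .LO (by decide)).trans hlo
  rw [add_assoc]
  refine wp.seq (wp.basic' (Q := fun s' => s'.reg .acc = 0) (by decide)
    (by simp [vc]; omega)) fun s₂ f₂ h₂ => ?_
  refine wp.seq (wp.loop (n := g) (fun i s' => s'.reg .acc = Nat.ofDigits D (seg y (j * g) i))
    (by simp) (by simpa using (hC₁.frame f₂ (by decide)).regg) hgN (by simpa using h₂)
    fun i hi s₃ f₃ hi₃ h₃ => wp.basic' (by decide) ?_) fun s₃ f₃ h₃ => wp.basic' (by decide) ?_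
  · have hC₃ := (hC₁.frame f₂ (by decide)).frame f₃ (by decide)
    have hj₃ : s₃.reg .j = j := by rw [f₃.reg .j (by decide), f₂.reg .j (by decide), hj₁]
    have hlo₃ : s₃.reg .LO = lo := by rw [f₃.reg .LO (by decide), f₂.reg .LO (by decide), hlo₁]
    have hT₃ : s₃.arr .T = s.arr .T := by rw [f₃.arr .T (by decide), f₂.arr .T (by decide), hT₁]
    have := ofDigits_seg_succ D y (j * g) i
    have hlt := ofDigits_seg_lt hyD (j * g) (i + 1)
    have hp : D ^ (i + 1) ≤ D ^ g := Nat.pow_le_pow_right hD hi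
    simp only [hy] at this hlt h₃
    simp [vc, hi₃, hj₃, hlo₃, hT₃, hC₃.regg, hC₃.regD, hC₃.arrPW i hi.le, h₃, hy, this]
    omega
  · have hj₃ : s₃.reg .j = j := by rw [f₃.reg .j (by decide), f₂.reg .j (by decide), hj₁]
    have hPK : s₃.arr .PK = s₁.arr .PK := by rw [f₃.arr .PK (by decide), f₂.arr .PK (by decide)]
    have hlt := ofDigits_seg_lt hyD (j * g) g
    simp only [vc, Expr.ok_reg, Expr.eval_reg, h₃.2, hj₃, St.arr_setReg, St.arr_setArr, if_true,
      true_and]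
    refine ⟨by omega, fun k hk => ?_⟩
    rw [Function.update_apply]
    split_ifs with hkj
    · rw [hkj]
    · rw [hPK, hI k (by omega)]

/-- The `g` base-`D` digits of `u`. -/
def digs (D g u : ℕ) : List ℕ := seg (fun i => u / D ^ i % D) 0 g

/-- Turns the contents of a table, described by the digits of its index, into statements about the
list that was packed. -/
theorem digs_ofDigits {D g : ℕ} {f : ℕ → ℕ} (h : ∀ i, f i < D) (a : ℕ) :
    digs D g (Nat.ofDigits D (seg f a g)) = seg f a g := by
  rw [digs, seg_eq_iff (by simp)]
  intro i hi
  rw [zero_add, ofDigits_div_mod fun x hx => by obtain ⟨i, -, rfl⟩ := mem_seg.1 hx; exact h _]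

/-- Whether the bit of weight `w` is set. -/
def bit (w x : ℕ) : Bool := decide (x / w % 2 = 1)

open Reg Arr in
/-- For all words, tabulate the digits with the bit of weight `bp` clear, those with the bit set,
the number of the former, and the number of pairs of an earlier set and a later clear bit. -/
def table : Com :=
  .loop u DG (
    (zc ≔ 0 ;; oc ≔ 0 ;; TZ⟦u⟧ ⇐ 0 ;; TO⟦u⟧ ⇐ 0 ;; TI⟦u⟧ ⇐ 0) ;;
    .loop i g (
      dg ≔ u / PW⟦i⟧ % D ;;
      .ite (dg / bp % 2 ≐ 1)
        (TO⟦u⟧ ⇐ TO⟦u⟧ + dg * PW⟦oc⟧ ;; oc ≔ oc + 1)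
        (TZ⟦u⟧ ⇐ TZ⟦u⟧ + dg * PW⟦zc⟧ ;; zc ≔ zc + 1 ;; TI⟦u⟧ ⇐ TI⟦u⟧ + oc)) ;;
    TN⟦u⟧ ⇐ zc)

/-- The contents of the tables at `u` for a list of digits `l`. -/
structure TableAt (s : St) (D b u : ℕ) (l : List ℕ) : Prop where
  TZ : s.arr .TZ u = Nat.ofDigits D (l.filter fun x => !bit b x)
  TO : s.arr .TO u = Nat.ofDigits D (l.filter (bit b))
  TN : s.arr .TN u = (l.filter fun x => !bit b x).length
  TI : s.arr .TI u = crossL (bit b) l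

theorem crossL_le (p : ℕ → Bool) (l : List ℕ) : crossL p l ≤ l.length * l.length := by
  induction l with
  | nil => simp [crossL]
  | cons x l ih =>
    have := List.countP_le_length (p := fun y => !p y) (l := l)
    simp only [crossL, List.length_cons]
    split_ifs <;> nlinarith

theorem ofDigits_filter_lt {D g : ℕ} (hD : 0 < D) {l : List ℕ} (h : ∀ x ∈ l, x < D)
    (hl : l.length ≤ g) (p : ℕ → Bool) : Nat.ofDigits D (l.filter p) < D ^ g :=
  (ofDigits_lt fun x hx => h x (List.mem_of_mem_filter hx)).trans_le
    (Nat.pow_le_pow_right hD ((List.length_filter_le _ _).trans hl))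

-- The tables depend on the bit and are rebuilt at each level. Since g * g * D ^ g ≤ N in the
-- application, the at most g levels of a round pay O(N) for this altogether.
set_option maxHeartbeats 1000000 in
theorem table_spec {N g D b : ℕ} (hC : Ctx s N g D) (hb : s.reg .bp = b) (hD : 0 < D)
    (hg : g < M) (hgg : g * g < M) (hDM : D ^ g < M) (hDM' : D < M) :
    wp M table s (D ^ g * (8 * g + 8) + 1) fun s' => ∀ u < D ^ g, TableAt s' D b u (digs D g u) := by
  refine (wp.loop (n := D ^ g) (τ := 5 + (1 + g * (6 + 1) + 1)) (fun u s' => ∀ k < u,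
    TableAt s' D b k (digs D g k)) (by simp) (by simp [hC.regDG]) hDM
    (by simp) fun u hu s₁ f₁ hu₁ hI => ?_).mono
      ((add_comm _ _).trans_le (Nat.add_le_add_right (Nat.mul_le_mul_left _ (by omega)) 1)) fun _ _ h => h.2
  have hC₁ := hC.frame f₁ (by decide)
  have hb₁ := (f₁.reg .bp (by decide)).trans hb
  let l := fun i => seg (fun i => u / D ^ i % D) 0 i
  have hlD : ∀ i, ∀ x ∈ l i, x < D := fun i x hx => by
    obtain ⟨i, -, rfl⟩ := mem_seg.1 hx; exact Nat.mod_lt _ hD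
  -- Invariant of the inner loop: the counters and the entries at u describe the first i digits of
  -- u. The entry of TN is absent because it is written only after that loop.
  let J : ℕ → St → Prop := fun i s' =>
    s'.reg .zc = ((l i).filter fun x => !bit b x).length ∧
    s'.reg .oc = ((l i).filter (bit b)).length ∧
    s'.arr .TZ u = Nat.ofDigits D ((l i).filter fun x => !bit b x) ∧
    s'.arr .TO u = Nat.ofDigits D ((l i).filter (bit b)) ∧
    s'.arr .TI u = crossL (bit b) (l i) ∧
    ∀ k < u, TableAt s' D b k (digs D g k)
  refine wp.seq (wp.basic' (Q := fun s' => J 0 s') (by decide) ?_)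
    fun s₂ f₂ h₂ => wp.seq (wp.loop (n := g) J (by simp)
      (by simpa using (hC₁.frame f₂ (by decide)).regg) hg ?_
      fun i hi s₃ f₃ hi₃ h₃ => wp.basic' (by decide) ?_) fun s₃ f₃ h₃ => wp.basic' (by decide) ?_
  · simp only [J, l, vc, hu₁, Expr.ok_reg, Expr.ok_ofNat, Expr.eval_reg, Expr.eval_ofNat, true_and,
      St.reg_setReg, St.reg_setArr, St.arr_setReg, St.arr_setArr, reduceCtorEq, if_true, if_false,
      Function.update_self, seg_zero, List.filter_nil, List.length_nil, Nat.ofDigits_nil, crossL]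
    refine ⟨by omega, by omega, by omega, by omega, by omega, fun k hk => ?_⟩
    obtain ⟨h1, h2, h3, h4⟩ := hI k hk
    constructor <;> simp [hk.ne, *]
  · obtain ⟨h1, h2, h3, h4, h5, h6⟩ := h₂
    refine ⟨h1, h2, h3, h4, h5, fun k hk => ?_⟩
    obtain ⟨h1, h2, h3, h4⟩ := h6 k hk
    exact ⟨h1, h2, h3, h4⟩
  · have hC₃ := (hC₁.frame f₂ (by decide)).frame f₃ (by decide)
    have hu₃ : s₃.reg .u = u := by rw [f₃.reg .u (by decide), f₂.reg .u (by decide), hu₁]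
    have hb₃ : s₃.reg .bp = b := by rw [f₃.reg .bp (by decide), f₂.reg .bp (by decide), hb₁]
    obtain ⟨h1, h2, h3, h4, h5, h6⟩ := h₃
    have hl : l (i + 1) = l i ++ [u / D ^ i % D] := by simp only [l]; rw [seg_succ, zero_add]
    have hlen : (l (i + 1)).length = i + 1 := by simp [l]
    have hli : (l i).length = i := by simp [l]
    have b1 := crossL_le (bit b) (l (i + 1))
    have b2 := ofDigits_filter_lt hD (hlD (i + 1)) (g := g) (by omega) (bit b)
    have b3 := ofDigits_filter_lt hD (hlD (i + 1)) (g := g) (by omega) (fun x => !bit b x)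
    have c1 := List.length_filter_le (bit b) (l i)
    have c2 := List.length_filter_le (fun x => !bit b x) (l i)
    have hgi : (i + 1) * (i + 1) ≤ g * g := Nat.mul_le_mul hi hi
    rw [hlen] at b1
    rw [hl] at b1 b2 b3
    rw [crossL_append] at b1
    set x := u / D ^ i % D with hx
    have hxD : x < D := Nat.mod_lt _ hD
    have e1 := hC₃.arrPW _ (show ((l i).filter (bit b)).length ≤ g by omega)
    have e2 := hC₃.arrPW _ (show ((l i).filter fun x => !bit b x).length ≤ g by omega)
    -- A digit with the bit set ends no counted pair; a digit with the bit clear ends one with each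
    -- of the set digits before it, whose number is in `oc`.
    by_cases hbx : x / b % 2 = 1
    · have hbit : bit b x = true := by simp [bit, hbx]
      simp only [J, hl, List.filter_append, List.filter_cons, hbit, Bool.not_true, if_true,
        Bool.false_eq_true, if_false, List.filter_nil, List.append_nil, List.length_append,
        List.length_singleton, ofDigits_concat, crossL_append, crossL, List.countP_nil,
        List.countP_cons, add_zero, mul_zero] at b1 b2 b3 ⊢
      simp only [vc, hu₃, hi₃, hb₃, hC₃.regD, hC₃.arrPW i hi.le, ← hx, Expr.ok_reg, Expr.ok_ofNat,
        Expr.ok_arr, Expr.ok_add, Expr.ok_mul, Expr.ok_div, Expr.ok_mod, Expr.ok_bin,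
        Expr.eval_reg, Expr.eval_ofNat, Expr.eval_arr, Expr.eval_add, Expr.eval_mul, Expr.eval_div,
        Expr.eval_mod, Expr.eval_eq, true_and,
        St.reg_setReg, St.reg_setArr, St.arr_setReg, St.arr_setArr, reduceCtorEq, if_true, if_false,
        Function.update_self, h1, h2, h3, h4, h5, e1, e2, hbx, ne_eq, one_ne_zero, not_false_eq_true,
        forall_true_left, false_imp_iff, and_true]
      refine ⟨by omega, by rw [mul_comm x]; omega, by omega, by ring, fun k hk => ?_⟩
      obtain ⟨h1, h2, h3, h4⟩ := h6 k hk
      constructor <;> simp [hk.ne, *]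
    · have hbit : bit b x = false := by simp [bit, hbx]
      have hcp : List.countP (bit b) (l i) = ((l i).filter (bit b)).length := List.countP_eq_length_filter
      simp only [J, hl, List.filter_append, List.filter_cons, hbit, Bool.not_false, if_true,
        Bool.false_eq_true, if_false, List.filter_nil, List.append_nil, List.length_append,
        List.length_singleton, ofDigits_concat, crossL_append, crossL, List.countP_nil,
        List.countP_cons, add_zero, zero_add, mul_one, hcp] at b1 b2 b3 ⊢
      simp only [vc, hu₃, hi₃, hb₃, hC₃.regD, hC₃.arrPW i hi.le, ← hx, Expr.ok_reg, Expr.ok_ofNat,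
        Expr.ok_arr, Expr.ok_add, Expr.ok_mul, Expr.ok_div, Expr.ok_mod, Expr.ok_bin,
        Expr.eval_reg, Expr.eval_ofNat, Expr.eval_arr, Expr.eval_add, Expr.eval_mul, Expr.eval_div,
        Expr.eval_mod, Expr.eval_eq, true_and,
        St.reg_setReg, St.reg_setArr, St.arr_setReg, St.arr_setArr, reduceCtorEq, if_true, if_false,
        Function.update_self, h1, h2, h3, h4, h5, e1, e2, hbx, ne_eq, not_true,
        forall_true_left, false_imp_iff, and_true]
      refine ⟨by omega, by rw [mul_comm x]; omega, by omega, by omega, by ring, fun k hk => ?_⟩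
      obtain ⟨h1, h2, h3, h4⟩ := h6 k hk
      constructor <;> simp [hk.ne, *]
  · have hu₃ : s₃.reg .u = u := by rw [f₃.reg .u (by decide), f₂.reg .u (by decide), hu₁]
    obtain ⟨h1, h2, h3, h4, h5, h6⟩ := h₃.2
    have c2 := List.length_filter_le (fun x => !bit b x) (l g)
    have hli : (l g).length = g := by simp [l]
    simp only [vc, hu₃, h1, Expr.ok_reg, Expr.eval_reg, true_and]
    refine ⟨by omega, fun k hk => ?_⟩
    rcases Nat.lt_succ_iff_lt_or_eq.1 hk with hk | rfl
    · obtain ⟨h1, h2, h3, h4⟩ := h6 k hk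
      constructor <;> simp [hk.ne, *]
    · constructor <;> simp [digs, *, l]

end ArrayRam

/-! ### Splitting blocks by one bit, a word at a time -/

namespace ArrayRam

variable {M : ℕ} {s s' : St}

/-- `f` packs the stable sorting of `P` by the quotient by `S`, of which it keeps the digits of
weight `lo`. -/
def Packed (f : ℕ → ℕ) (P : List ℕ) (N g D lo S : ℕ) : Prop :=
  ∃ y : ℕ → ℕ, (∀ i, y i < D) ∧ (∀ j < N / g, f j = Nat.ofDigits D (seg y (j * g) g)) ∧
    ∀ c < N / S, seg y (c * S) S = (blk P S c).map fun x => x / lo % D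

/-- `n` digits of `y` have been appended to the output stream: the full words are in `PK2`, the
rest is in `acc`. -/
structure Stream (s : St) (g D : ℕ) (y : ℕ → ℕ) (n : ℕ) : Prop where
  q : s.reg .q = n / g
  cnt : s.reg .cnt = n % g
  acc : s.reg .acc = Nat.ofDigits D (seg y (n / g * g) (n % g))
  PK2 : ∀ j < n / g, s.arr .PK2 j = Nat.ofDigits D (seg y (j * g) g)

open Reg Arr in
/-- Append `len` digits, packed in `e`, to the output stream. -/
def append (e len : Expr) : Com :=
  acc ≔ acc + e * PW⟦cnt⟧ ;;
  cnt ≔ cnt + len ;;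
  .ite (cnt ≺ g) .skip
    (PK2⟦q⟧ ⇐ acc % DG ;; acc ≔ acc / DG ;; cnt ≔ cnt - g ;; q ≔ q + 1)

/-- The sequence y is fixed beforehand and the stream is always a prefix of it. Fewer than g pending
digits and at most g new ones make fewer than 2 * g, so D ^ g * D ^ g bounds the accumulator and at
most one full word has to be flushed. -/
theorem append_spec {N g D n k : ℕ} {y : ℕ → ℕ} {e len : Expr} (hC : Ctx s N g D) (hg : 0 < g)
    (hy : ∀ i, y i < D) (hM : D ^ g * D ^ g ≤ M) (h2g : 2 * g ≤ M) (hn : n / g + 1 < M)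
    (hs : Stream s g D y n) (he : e.Ok s)
    (hev : e.eval s = Nat.ofDigits D (seg y n k))
    (hlen : ∀ v, len.Ok (s.setReg .acc v) ∧ len.eval (s.setReg .acc v) = k) (hk : k ≤ g) :
    wp M (append e len) s 7 fun s' => Stream s' g D y (n + k) := by
  obtain ⟨hq, hcnt, hacc, hPK⟩ := hs
  have hD : 0 < D := (Nat.zero_le _).trans_lt (hy 0)
  have hr : n % g < g := Nat.mod_lt _ hg
  have hn' : n / g * g + n % g = n := by rw [mul_comm]; exact Nat.div_add_mod n g
  set Q := n / g
  set r := n % g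
  have hcat : ∀ m m' a, Nat.ofDigits D (seg y a m) + Nat.ofDigits D (seg y (a + m) m') * D ^ m =
      Nat.ofDigits D (seg y a (m + m')) := fun m m' a => by
    rw [seg_add, Nat.ofDigits_append, length_seg, mul_comm]
  have hsum := hcat r k (Q * g)
  rw [hn'] at hsum
  have hlt := ofDigits_seg_lt hy (Q * g) (r + k)
  have hple : D ^ (r + k) ≤ D ^ g * D ^ g := by
    rw [← pow_add]; exact Nat.pow_le_pow_right hD (by omega)
  refine wp.basic' (by simp [append, Com.ticks]) ?_
  simp only [append, vc, hq, hcnt, hacc, hev, hC.regg, hC.regDG, hC.arrPW r hr.le, he, hlen, hsum,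
    Expr.ok_reg, Expr.ok_ofNat,
    Expr.ok_arr, Expr.ok_add, Expr.ok_mul, Expr.ok_div, Expr.ok_mod, Expr.ok_bin, Expr.ok_sub,
    Expr.eval_reg, Expr.eval_ofNat, Expr.eval_arr, Expr.eval_add, Expr.eval_mul, Expr.eval_div,
    Expr.eval_mod, Expr.eval_lt, Expr.eval_sub, true_and,
    St.reg_setReg, St.reg_setArr, St.arr_setReg, St.arr_setArr, reduceCtorEq, if_true, if_false]
  refine ⟨by omega, by omega, fun h => ?_, fun h => ?_⟩
  · have h' : r + k < g := by by_contra hh; simp [hh] at h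
    have e1 : (n + k) / g = Q := by
      rw [← hn', add_assoc, Nat.mul_comm, Nat.mul_add_div hg, Nat.div_eq_of_lt h']; rfl
    have e2 : (n + k) % g = r + k := by
      rw [← hn', add_assoc, Nat.mul_comm, Nat.mul_add_mod, Nat.mod_eq_of_lt h']
    constructor <;> simp [e1, e2, hq] <;> assumption
  · have h' : g ≤ r + k := by by_contra hh; simp [not_le.1 hh] at h
    obtain ⟨r', hr'⟩ := Nat.exists_eq_add_of_le h'
    have e1 : (n + k) / g = Q + 1 := by
      rw [← hn', add_assoc, Nat.mul_comm, Nat.mul_add_div hg, hr', Nat.add_div_left _ hg,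
        Nat.div_eq_of_lt (by omega)]
    have e2 : (n + k) % g = r' := by
      rw [← hn', add_assoc, Nat.mul_comm, Nat.mul_add_mod, hr', Nat.add_mod_left,
        Nat.mod_eq_of_lt (by omega)]
    have hsp := hcat g r' (Q * g)
    have hlt' := ofDigits_seg_lt hy (Q * g) g
    have hp : 0 < D ^ g := Nat.pow_pos hD
    have e3 : Nat.ofDigits D (seg y (Q * g) (r + k)) % D ^ g = Nat.ofDigits D (seg y (Q * g) g) := by
      rw [hr', ← hsp, Nat.add_mul_mod_self_right, Nat.mod_eq_of_lt hlt']
    have e4 : Nat.ofDigits D (seg y (Q * g) (r + k)) / D ^ g =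
        Nat.ofDigits D (seg y (Q * g + g) r') := by
      rw [hr', ← hsp, Nat.add_mul_div_right _ _ hp, Nat.div_eq_of_lt hlt', zero_add]
    have hlt2 := ofDigits_seg_lt hy (Q * g + g) r'
    have hp2 : D ^ r' ≤ D ^ g := Nat.pow_le_pow_right hD (by omega)
    have hpp : D ^ g ≤ D ^ g * D ^ g := Nat.le_mul_of_pos_left _ hp
    rw [e3, e4]
    refine ⟨by omega, by omega, by omega, by omega, ?_⟩
    constructor
    · simp [e1]
    · simp [e2]; omega
    · simp [e1, e2, Nat.succ_mul]
    · simp only [e1, St.arr_setReg, St.arr_setArr, if_true]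
      intro j hj
      rw [Function.update_apply]
      split_ifs with hjQ
      · rw [hjQ]
      · exact hPK j (by omega)

open Reg Arr in
/-- Split all blocks of size `2 * S` of the packed list according to the bit of weight `bp`,
stably, and add the number of inversions between their two halves to `res`. -/
def pass : Com :=
  (acc ≔ 0 ;; cnt ≔ 0 ;; q ≔ 0) ;;
  .loop k nb (
    z ≔ 0 ;;
    .loop j wd (
      (u ≔ PK⟦k * wd + j⟧ ;;
      res ≔ res + TI⟦u⟧ + TN⟦u⟧ * (j * g - z) ;;
      z ≔ z + TN⟦u⟧) ;;
      append TZ⟦u⟧ TN⟦u⟧) ;;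
    .loop j wd (
      u ≔ PK⟦k * wd + j⟧ ;;
      append TO⟦u⟧ (g - TN⟦u⟧))) ;;
  .loop j (N / g) (PK⟦j⟧ ⇐ PK2⟦j⟧)

/-- The digits selected from word j stand in the target directly behind those selected from the
earlier words; so what is appended is indeed the next stretch of the target. -/
theorem seg_filter_target {y y' : ℕ → ℕ} {a b n j g : ℕ} {S : ℕ} {p : ℕ → Bool}
    (h : seg y' a S = (seg y b n).filter p) (hj : j * g + g ≤ n) :
    seg y' (a + ((seg y b (j * g)).filter p).length) ((seg y (b + j * g) g).filter p).length =
      (seg y (b + j * g) g).filter p := by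
  obtain ⟨k, rfl⟩ := Nat.exists_eq_add_of_le hj
  rw [seg_add, seg_add, List.filter_append, List.filter_append] at h
  exact seg_of_append h

theorem length_filter_not (p : ℕ → Bool) (l : List ℕ) :
    (l.filter fun x => !p x).length + (l.filter p).length = l.length := by
  have := List.length_eq_length_filter_add (l := l) p
  omega

/-- Truncation modulo D does not touch this bit, because 2 * b divides D. -/
theorem bit_digit {D lo b x : ℕ} (h : 2 * b ∣ D) : bit b (x / lo % D) = bit (lo * b) x := by
  obtain ⟨k, rfl⟩ := h
  simp only [bit, ← Nat.div_div_eq_div_mul]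
  congr 2
  rw [mul_comm 2 b, mul_assoc, Nat.mod_mul_right_div_self, Nat.mod_mul_right_mod]

-- Per block the words are read twice: the first reading streams out the digits with clear bit, the
-- second those with set bit, which puts the two halves in order. Crossings are counted in the first
-- reading: those inside a word are tabulated, and a clear digit also crosses every set digit of the
-- earlier words of its block. A word costs constant time.
set_option maxHeartbeats 1000000 in
theorem pass_spec {P : List ℕ} {N g D lo b S r₀ : ℕ} (hC : Ctx s N g D) (hg : 0 < g)
    (hD : 0 < D) (hM : D ^ g * D ^ g ≤ M) (hP : P.Perm (List.range N)) (hS : S = lo * b) (hS0 : 0 < S)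
    (hbD : 2 * b ∣ D) (hgS : g ∣ 2 * S) (hSN : 2 * S ∣ N) (hN0 : 0 < N)
    (hnb : s.reg .nb = N / (2 * S)) (hwd : s.reg .wd = 2 * S / g)
    (hT : ∀ u < D ^ g, TableAt s D b u (digs D g u))
    (hK : Packed (s.arr .PK) P N g D lo (2 * S)) (hr : s.reg .res = r₀)
    (hrM : r₀ + 2 * N * N < M) :
    wp M pass s (40 * (N / g) + 10 * (N / g) + 10) fun s' =>
      Packed (s'.arr .PK) P N g D lo S ∧ s'.reg .res = r₀ + crossInv P N S := by
  obtain ⟨y, hyD, hyK, hyB⟩ := hK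
  obtain ⟨W, hW⟩ := hgS
  obtain ⟨nb, hNb⟩ := hSN
  have hW0 : 0 < W := by
    rcases Nat.eq_zero_or_pos W with h | h
    · subst h; omega
    · exact h
  have hwd' : 2 * S / g = W := by rw [hW, Nat.mul_div_cancel_left _ hg]
  have hnb' : N / (2 * S) = nb := by rw [hNb, Nat.mul_div_cancel_left _ (by omega)]
  have hNS : N / S = 2 * nb := by
    rw [hNb, show 2 * S * nb = S * (2 * nb) by ring, Nat.mul_div_cancel_left _ hS0]
  have hNg : N / g = nb * W := by
    rw [hNb, hW, mul_assoc, Nat.mul_div_cancel_left _ hg, mul_comm]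
  have hNgN : N / g ≤ N := Nat.div_le_self _ _
  rw [hnb'] at hnb
  rw [hwd'] at hwd
  have hnb0 : 0 < nb := by
    rcases Nat.eq_zero_or_pos nb with h | h
    · subst h; omega
    · exact h
  have hgN : g ≤ N := (Nat.le_of_dvd hN0 (hNb ▸ hW ▸ (dvd_mul_right g W).mul_right nb))
  have hNN : N ≤ N * N := Nat.le_mul_of_pos_left _ hN0
  have hNN2 : 2 * N * N = N * N + N * N := by ring
  -- the target of the stream
  set φ : ℕ → ℕ := fun x => x / lo % D with hφ
  have hφD : ∀ x, φ x < D := fun x => Nat.mod_lt _ hD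
  -- The target is the concatenation of the blocks of size S. The default 0 is never read below N;
  -- it only keeps `y'` bounded by D everywhere.
  let y' : ℕ → ℕ := fun i => ((blk P S (i / S)).map φ).getD (i % S) 0
  have hy'D : ∀ i, y' i < D := by
    intro i
    simp only [y', List.getD_eq_getElem?_getD]
    cases h : ((blk P S (i / S)).map φ)[i % S]? with
    | none => simpa using hD
    | some v =>
      obtain ⟨x, -, rfl⟩ := List.mem_map.1 (List.mem_of_getElem? h)
      exact hφD x
  have hy'B : ∀ c < N / S, seg y' (c * S) S = (blk P S c).map φ := by
    intro c hc
    rw [seg_eq_iff (by rw [List.length_map, length_blk hP hS0 hc])]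
    intro i hi
    have hi' : i < S := by rwa [List.length_map, length_blk hP hS0 hc] at hi
    have h1 : (c * S + i) / S = c := by
      rw [mul_comm, Nat.mul_add_div hS0, Nat.div_eq_of_lt hi', add_zero]
    have h2 : (c * S + i) % S = i := by rw [mul_comm, Nat.mul_add_mod, Nat.mod_eq_of_lt hi']
    simp only [y', h1, h2]
    rw [List.getD_eq_getElem _ _ hi]
  have hbit : ∀ x, bit b (φ x) = bit S x := fun x => by rw [hS]; exact bit_digit hbD
  have hz : ∀ c < nb, seg y' (c * (2 * S)) S = (seg y (c * (2 * S)) (2 * S)).filter fun x => !bit b x := by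
    intro c hc
    rw [hyB c (by omega), List.filter_map, show c * (2 * S) = 2 * c * S by ring,
      hy'B _ (by omega), ← blk_two_mul]
    congr 1
    refine List.filter_congr fun x _ => ?_
    simp only [Function.comp, hbit]; rfl
  have ho : ∀ c < nb, seg y' (c * (2 * S) + S) S = (seg y (c * (2 * S)) (2 * S)).filter (bit b) := by
    intro c hc
    rw [hyB c (by omega), List.filter_map, show c * (2 * S) + S = (2 * c + 1) * S by ring,
      hy'B _ (by omega), ← blk_two_mul_add_one]
    congr 1
    refine List.filter_congr fun x _ => ?_
    simp only [Function.comp, hbit]; rfl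
  let cr : ℕ → ℕ := fun c => crossL (bit b) (seg y (c * (2 * S)) (2 * S))
  have hcr : ∑ c ∈ Finset.range nb, cr c = crossInv P N S := by
    simp only [crossInv, hnb']
    refine Finset.sum_congr rfl fun c hc => ?_
    simp only [cr]
    rw [hyB c (by rw [hnb']; exact Finset.mem_range.1 hc), crossL_map]
    exact crossL_congr fun x _ => hbit x
  have hcrle : ∀ c ≤ nb, ∀ c' ≤ c, ∑ c ∈ Finset.range c', cr c ≤ c * (2 * S * (2 * S)) := by
    intro c _ c' hc'
    refine (Finset.sum_le_card_nsmul _ _ (2 * S * (2 * S)) fun i _ => ?_).trans ?_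
    · simpa using crossL_le (bit b) (seg y (i * (2 * S)) (2 * S))
    · simpa using Nat.mul_le_mul_right _ hc'
  -- Crude bound on all crossings, using that the blocks have N elements in total; it keeps `res`
  -- below M.
  have htot : nb * (2 * S * (2 * S)) ≤ N * N := by
    rw [show nb * (2 * S * (2 * S)) = N * (2 * S) by rw [hNb]; ring]
    exact Nat.mul_le_mul_left _ (by rw [hNb]; exact Nat.le_mul_of_pos_right _ hnb0)
  -- reading a word
  have hword : ∀ c < nb, ∀ j < W, c * W + j < N / g ∧ (c * W + j) * g = c * (2 * S) + j * g := by
    intro c hc j hj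
    refine ⟨?_, by rw [hW]; ring⟩
    rw [hNg]; exact mul_add_lt_mul hc hj
  have hjg : ∀ j < W, j * g + g ≤ 2 * S := by
    intro j hj
    rw [hW, ← Nat.succ_mul, mul_comm g]; exact Nat.mul_le_mul_right _ hj
  have hpos : ∀ c < nb, ∀ n, n ≤ 2 * S → c * (2 * S) + n ≤ N := by
    intro c hc n hn
    rw [hNb, mul_comm (2 * S)]
    have := Nat.mul_le_mul_right (2 * S) (Nat.succ_le_of_lt hc)
    rw [Nat.succ_mul] at this; omega
  have hDg : 0 < D ^ g := Nat.pow_pos hD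
  have hwlt : ∀ a, Nat.ofDigits D (seg y a g) < D ^ g := fun a => ofDigits_seg_lt hyD a g
  have hDgM : D ^ g ≤ M := (Nat.le_mul_of_pos_left _ hDg).trans hM
  have htab : ∀ {t : St}, (t.arr .TZ = s.arr .TZ) → (t.arr .TO = s.arr .TO) →
      (t.arr .TN = s.arr .TN) → (t.arr .TI = s.arr .TI) → ∀ a,
      TableAt t D b (Nat.ofDigits D (seg y a g)) (seg y a g) := by
    intro t t1 t2 t3 t4 a
    obtain ⟨h1, h2, h3, h4⟩ := hT _ (hwlt a)
    rw [digs_ofDigits hyD] at h1 h2 h3 h4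
    exact ⟨by rw [t1, h1], by rw [t2, h2], by rw [t3, h3], by rw [t4, h4]⟩
  have hSfull : ∀ c < nb, ((seg y (c * (2 * S)) (2 * S)).filter fun x => !bit b x).length = S :=
    fun c hc => by rw [← hz c hc, length_seg]
  refine (wp.seq (wp.basic' (T := 3) (Q := fun s' => Stream s' g D y' 0 ∧ s'.reg .res = r₀)
    (by decide) ?_) fun s₁ f₁ h₁ => ?_).mono
    (T := 3 + ((1 + nb * ((1 + ((1 + W * (10 + 1)) + (1 + W * (8 + 1)))) + 1)) + (1 + N / g * (1 + 1))))
    ?_ (fun _ _ => id)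
  · simp [vc]
    refine ⟨by omega, by constructor <;> simp, hr⟩
  · refine wp.seq (wp.loop (n := nb) (fun c s' => Stream s' g D y' (c * (2 * S)) ∧
      s'.reg .res = r₀ + ∑ i ∈ Finset.range c, cr i) (by simp)
      (by simpa [hnb] using f₁.reg .nb (by decide))
      (by have : nb ≤ N := by rw [hNb]; exact Nat.le_mul_of_pos_left _ (by omega)
          omega) ?_ fun c hc s₂ f₂ hc₂ h₂ => ?_)
      fun s₂ f₂ h₂ => (wp.loop (n := N / g) (τ := 1) (fun i s' => ∀ j < i, s'.arr .PK j = s₂.arr .PK2 j)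
        (by simp) ?_ (by omega) (by simp) fun i hi s₃ f₃ hi₃ h₃ => wp.basic' (by decide) ?_).mono
        le_rfl fun s' f' h' => ?_
    · obtain ⟨⟨a1, a2, a3, a4⟩, a5⟩ := h₁
      exact ⟨⟨by simpa using a1, by simpa using a2, by simpa using a3, by simpa using a4⟩,
        by simpa using a5⟩
    · have hC₂ := (hC.frame f₁ (by decide)).frame f₂ (by decide)
      have hwd₂ : s₂.reg .wd = W := by rw [f₂.reg .wd (by decide), f₁.reg .wd (by decide), hwd]
      have hPK₂ : s₂.arr .PK = s.arr .PK := by rw [f₂.arr .PK (by decide), f₁.arr .PK (by decide)]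
      have t1 : s₂.arr .TZ = s.arr .TZ := by rw [f₂.arr .TZ (by decide), f₁.arr .TZ (by decide)]
      have t2 : s₂.arr .TO = s.arr .TO := by rw [f₂.arr .TO (by decide), f₁.arr .TO (by decide)]
      have t3 : s₂.arr .TN = s.arr .TN := by rw [f₂.arr .TN (by decide), f₁.arr .TN (by decide)]
      have t4 : s₂.arr .TI = s.arr .TI := by rw [f₂.arr .TI (by decide), f₁.arr .TI (by decide)]
      have hcsum := hcrle nb le_rfl c hc.le
      have hc' : ∑ i ∈ Finset.range (c + 1), cr i = ∑ i ∈ Finset.range c, cr i + cr c :=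
        Finset.sum_range_succ _ _
      have hcsum' := hcrle nb le_rfl (c + 1) hc
      set R := ∑ i ∈ Finset.range c, cr i with hR
      refine wp.seq (wp.basic' (T := 1) (Q := fun s' => Stream s' g D y' (c * (2 * S)) ∧
        s'.reg .res = r₀ + R ∧ s'.reg .z = 0) (by decide) ?_) fun s₃ f₃ h₃ => ?_
      · obtain ⟨⟨a1, a2, a3, a4⟩, a5⟩ := h₂
        simp only [vc, Expr.ok_ofNat, Expr.eval_ofNat, true_and]
        exact ⟨by omega, ⟨by simpa using a1, by simpa using a2, by simpa using a3,
          by simpa using a4⟩, by simpa using a5, by simp⟩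
      have hC₃ := hC₂.frame f₃ (by decide)
      have hwd₃ : s₃.reg .wd = W := by rw [f₃.reg .wd (by decide), hwd₂]
      have hWM : W < M := by
        have : W ≤ N / g := by rw [hNg]; exact Nat.le_mul_of_pos_left _ hnb0
        omega
      refine wp.seq (wp.loop (n := W) (τ := 10) (fun j s' =>
        let l := seg y (c * (2 * S)) (j * g)
        s'.reg .z = (l.filter fun x => !bit b x).length ∧
        s'.reg .res = r₀ + R + crossL (bit b) l ∧
        Stream s' g D y' (c * (2 * S) + (l.filter fun x => !bit b x).length)) (by simp)
        (by simpa using hwd₃) hWM ?_ fun j hj s₄ f₄ hj₄ h₄ => ?_) fun s₄ f₄ h₄ => ?_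
      · obtain ⟨⟨a1, a2, a3, a4⟩, a5, a6⟩ := h₃
        simp only [zero_mul, seg_zero, List.filter_nil, List.length_nil, add_zero, crossL]
        exact ⟨by simpa using a6, by simpa using a5, ⟨by simpa using a1, by simpa using a2,
          by simpa using a3, by simpa using a4⟩⟩
      · obtain ⟨k1, k2, k3⟩ := h₄
        have hC₄ := hC₃.frame f₄ (by decide)
        have hk₄ : s₄.reg .k = c := by rw [f₄.reg .k (by decide), f₃.reg .k (by decide), hc₂]
        have hwd₄ : s₄.reg .wd = W := by rw [f₄.reg .wd (by decide), hwd₃]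
        obtain ⟨w1, w2⟩ := hword c hc j hj
        have hPK₄ : s₄.arr .PK (c * W + j) = Nat.ofDigits D (seg y (c * (2 * S) + j * g) g) := by
          rw [f₄.arr .PK (by decide), f₃.arr .PK (by decide), hPK₂, hyK _ w1, w2]
        have ta : TableAt s₄ D b _ _ := htab (by rw [f₄.arr .TZ (by decide), f₃.arr .TZ (by decide), t1])
          (by rw [f₄.arr .TO (by decide), f₃.arr .TO (by decide), t2])
          (by rw [f₄.arr .TN (by decide), f₃.arr .TN (by decide), t3])
          (by rw [f₄.arr .TI (by decide), f₃.arr .TI (by decide), t4]) (c * (2 * S) + j * g)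
        have hU := hwlt (c * (2 * S) + j * g)
        set l := seg y (c * (2 * S)) (j * g) with hl
        set wv := seg y (c * (2 * S) + j * g) g with hwv
        set U := Nat.ofDigits D wv with hUd
        have hlw : seg y (c * (2 * S)) ((j + 1) * g) = l ++ wv := by rw [Nat.succ_mul j g, seg_add]
        have hll : l.length = j * g := length_seg
        have hwl : wv.length = g := length_seg
        have n1 := length_filter_not (bit b) l
        have n2 := length_filter_not (bit b) wv
        -- Of the j * g digits already read from the block, z have a clear bit, so j * g - z have it
        -- set, and each of these crosses every clear digit of the new word.
        have hcl : crossL (bit b) (l ++ wv) = crossL (bit b) l + crossL (bit b) wv +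
            (wv.filter fun x => !bit b x).length * (j * g - (l.filter fun x => !bit b x).length) := by
          rw [crossL_append, List.countP_eq_length_filter, List.countP_eq_length_filter, ← hll, ← n1,
            Nat.add_sub_cancel_left, mul_comm (List.length _)]
        have hclM : R + crossL (bit b) (l ++ wv) ≤ 2 * N * N := by
          have h1 := crossL_le (bit b) (l ++ wv)
          have h2 : (l ++ wv).length ≤ N := by
            rw [List.length_append, hll, hwl]
            have := hpos c hc _ (hjg j hj)
            omega
          have h3 := Nat.mul_le_mul h2 h2
          omega
        have hlN : j * g + g ≤ N := by have := hpos c hc _ (hjg j hj); omega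
        have hlq := hpos c hc (((l.filter fun x => !bit b x).length)) (by
          have := hjg j hj; omega)
        refine wp.seq (T₁ := 3) (T₂ := 7) (wp.basic' (Q := fun s' =>
          s'.reg .u = U ∧ s'.reg .z = ((l ++ wv).filter fun x => !bit b x).length ∧
          s'.reg .res = r₀ + R + crossL (bit b) (l ++ wv) ∧
          Stream s' g D y' (c * (2 * S) + (l.filter fun x => !bit b x).length))
          (by decide) ?_) fun s₅ f₅ h₅ => ?_
        · obtain ⟨a1, a2, a3, a4⟩ := k3
          simp only [vc, hk₄, hwd₄, hj₄, hPK₄, k1, k2, ta.TI, ta.TN, hC₄.regg, Expr.ok_reg,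
            Expr.ok_arr, Expr.ok_add, Expr.ok_mul, Expr.ok_sub,
            Expr.eval_reg, Expr.eval_arr, Expr.eval_add, Expr.eval_mul, Expr.eval_sub, true_and,
            St.reg_setReg, St.arr_setReg, reduceCtorEq, if_true, if_false, List.filter_append,
            List.length_append, hcl]
          refine ⟨by omega, by rw [hcl] at hclM; omega, by omega, ?_, ?_⟩
          · ring
          · exact ⟨by simpa using a1, by simpa using a2, by simpa using a3, by simpa using a4⟩
        · obtain ⟨b1, b2, b3, b4⟩ := h₅
          have ta5 : TableAt s₅ D b U wv := ⟨by rw [f₅.arr .TZ (by decide), ta.TZ],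
            by rw [f₅.arr .TO (by decide), ta.TO], by rw [f₅.arr .TN (by decide), ta.TN],
            by rw [f₅.arr .TI (by decide), ta.TI]⟩
          refine (append_spec (k := (wv.filter fun x => !bit b x).length)
            (hC₄.frame f₅ (by decide)) hg hy'D hM (by omega) ?_ b4 (by simp)
            (by rw [Expr.eval_arr, Expr.eval_reg, b1, ta5.TZ, seg_filter_target (hz c hc) (hjg j hj)])
            (fun v => ⟨by simp, by simp [b1, ta5.TN]⟩) (by omega)).mono le_rfl fun s₆ f₆ h₆ => ?_
          · have := Nat.div_le_self (c * (2 * S) + (l.filter fun x => !bit b x).length) g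
            omega
          · have r1 : s₆.reg .z = s₅.reg .z := f₆.reg .z (by simp [append, Com.regs])
            have r2 : s₆.reg .res = s₅.reg .res := f₆.reg .res (by simp [append, Com.regs])
            obtain ⟨a1, a2, a3, a4⟩ := h₆
            simp only [hlw, List.filter_append, List.length_append, ← add_assoc]
            rw [List.filter_append, List.length_append] at b2
            exact ⟨by simpa [r1] using b2, by simpa [r2] using b3, ⟨by simpa using a1,
              by simpa using a2, by simpa using a3, by simpa using a4⟩⟩
      · have hC₄ := hC₃.frame f₄ (by decide)
        obtain ⟨-, -, g2, g3⟩ := h₄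
        rw [mul_comm W g, ← hW] at g2 g3
        rw [hSfull c hc] at g3
        refine (wp.loop (n := W) (τ := 8) (fun j s' =>
          Stream s' g D y' (c * (2 * S) + S + ((seg y (c * (2 * S)) (j * g)).filter (bit b)).length))
          (by simp) (by simpa [hwd₃] using f₄.reg .wd (by decide)) hWM ?_
          fun j hj s₅ f₅ hj₅ h₅ => ?_).mono le_rfl fun s₅ f₅ h₅ => ?_
        · obtain ⟨a1, a2, a3, a4⟩ := g3
          simp only [zero_mul, seg_zero, List.filter_nil, List.length_nil, add_zero]
          exact ⟨by simpa using a1, by simpa using a2, by simpa using a3, by simpa using a4⟩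
        · have hC₅ := hC₄.frame f₅ (by decide)
          have hk₅ : s₅.reg .k = c := by
            rw [f₅.reg .k (by decide), f₄.reg .k (by decide), f₃.reg .k (by decide), hc₂]
          have hwd₅ : s₅.reg .wd = W := by rw [f₅.reg .wd (by decide), f₄.reg .wd (by decide), hwd₃]
          obtain ⟨w1, w2⟩ := hword c hc j hj
          have hPK₅ : s₅.arr .PK (c * W + j) = Nat.ofDigits D (seg y (c * (2 * S) + j * g) g) := by
            rw [f₅.arr .PK (by decide), f₄.arr .PK (by decide), f₃.arr .PK (by decide), hPK₂,
              hyK _ w1, w2]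
          have ta : TableAt s₅ D b _ _ := htab
            (by rw [f₅.arr .TZ (by decide), f₄.arr .TZ (by decide), f₃.arr .TZ (by decide), t1])
            (by rw [f₅.arr .TO (by decide), f₄.arr .TO (by decide), f₃.arr .TO (by decide), t2])
            (by rw [f₅.arr .TN (by decide), f₄.arr .TN (by decide), f₃.arr .TN (by decide), t3])
            (by rw [f₅.arr .TI (by decide), f₄.arr .TI (by decide), f₃.arr .TI (by decide), t4])
            (c * (2 * S) + j * g)
          have hU := hwlt (c * (2 * S) + j * g)
          set l := seg y (c * (2 * S)) (j * g) with hl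
          set wv := seg y (c * (2 * S) + j * g) g with hwv
          set U := Nat.ofDigits D wv with hUd
          have hlw : seg y (c * (2 * S)) ((j + 1) * g) = l ++ wv := by rw [Nat.succ_mul j g, seg_add]
          have hll : l.length = j * g := length_seg
          have hwl : wv.length = g := length_seg
          have n2 := length_filter_not (bit b) wv
          have nS : S + (l.filter (bit b)).length ≤ 2 * S := by
            have h1 := length_filter_not (bit b) (seg y (c * (2 * S)) (2 * S))
            rw [hSfull c hc, length_seg] at h1
            have h2 : (l.filter (bit b)).length ≤
                ((seg y (c * (2 * S)) (2 * S)).filter (bit b)).length := by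
              obtain ⟨k, hk⟩ := Nat.exists_eq_add_of_le (hjg j hj)
              rw [congrArg (seg y (c * (2 * S))) hk, seg_add, seg_add, ← hl, List.filter_append,
                List.filter_append, List.length_append, List.length_append]
              omega
            omega
          have hlq := hpos c hc _ nS
          refine wp.seq (T₁ := 1) (T₂ := 7) (wp.basic' (Q := fun s' => s'.reg .u = U ∧
            Stream s' g D y' (c * (2 * S) + S + (l.filter (bit b)).length))
            (by decide) ?_) fun s₆ f₆ h₆ => ?_
          · obtain ⟨a1, a2, a3, a4⟩ := h₅
            simp only [vc, hk₅, hwd₅, hj₅, hPK₅, Expr.ok_reg, Expr.ok_arr, Expr.ok_add, Expr.ok_mul,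
              Expr.eval_reg, Expr.eval_arr, Expr.eval_add, Expr.eval_mul, true_and,
              St.reg_setReg, if_true]
            exact ⟨by omega, by simpa using a1, by simpa using a2, by simpa using a3,
              by simpa using a4⟩
          · obtain ⟨b1, b4⟩ := h₆
            have ta6 : TableAt s₆ D b U wv := ⟨by rw [f₆.arr .TZ (by decide), ta.TZ],
              by rw [f₆.arr .TO (by decide), ta.TO], by rw [f₆.arr .TN (by decide), ta.TN],
              by rw [f₆.arr .TI (by decide), ta.TI]⟩
            have hC₆ := hC₅.frame f₆ (by decide)
            refine (append_spec (k := (wv.filter (bit b)).length)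
              hC₆ hg hy'D hM (by omega) ?_ b4 (by simp)
              (by rw [Expr.eval_arr, Expr.eval_reg, b1, ta6.TO, seg_filter_target (ho c hc) (hjg j hj)])
              (fun v => ⟨by simp, by simp [b1, ta6.TN, hC₆.regg]; omega⟩) (by omega)).mono le_rfl
              fun s₇ f₇ h₇ => ?_
            · have := Nat.div_le_self (c * (2 * S) + S + (l.filter (bit b)).length) g
              omega
            · obtain ⟨a1, a2, a3, a4⟩ := h₇
              simp only [hlw, List.filter_append, List.length_append, ← add_assoc]
              exact ⟨by simpa using a1, by simpa using a2, by simpa using a3, by simpa using a4⟩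
        · obtain ⟨-, a⟩ := h₅
          rw [mul_comm W g, ← hW] at a
          have h1 := length_filter_not (bit b) (seg y (c * (2 * S)) (2 * S))
          rw [hSfull c hc, length_seg] at h1
          have h2 : c * (2 * S) + S + ((seg y (c * (2 * S)) (2 * S)).filter (bit b)).length =
              (c + 1) * (2 * S) := by rw [Nat.succ_mul c]; omega
          rw [h2] at a
          obtain ⟨a1, a2, a3, a4⟩ := a
          refine ⟨⟨by simpa using a1, by simpa using a2, by simpa using a3, by simpa using a4⟩, ?_⟩
          rw [hc']
          simp only [St.reg_setReg, reduceCtorEq, if_false]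
          rw [f₅.reg .res (by simp [append, Com.regs]), g2]
          simp only [cr]; omega
    · simp only [Expr.eval_div, Expr.eval_reg]
      have hC₂ := (hC.frame f₁ (by decide)).frame f₂ (by decide)
      rw [hC₂.regN, hC₂.regg]
    · have hPK : s₃.arr .PK2 = s₂.arr .PK2 := f₃.arr .PK2 (by decide)
      obtain ⟨-, ⟨-, -, -, h4⟩, -⟩ := h₂
      -- After the last block N digits have been streamed, so all N / g words have been flushed to
      -- PK2.
      have hfull : nb * (2 * S) = N := by rw [hNb, mul_comm]
      rw [hfull] at h4
      simp only [vc, hi₃, hPK, Expr.ok_reg, Expr.ok_arr, Expr.eval_reg, Expr.eval_arr, true_and,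
        St.arr_setReg, St.arr_setArr, if_true]
      refine ⟨?_, fun j hj => ?_⟩
      · rw [h4 i hi]
        exact (ofDigits_seg_lt hy'D _ _).trans_le hDgM
      · rw [Function.update_apply]
        split_ifs with h
        · rw [h]
        · exact h₃ j (by omega)
    · obtain ⟨-, ⟨-, -, -, h4⟩, h5⟩ := h₂
      have hfull : nb * (2 * S) = N := by rw [hNb, mul_comm]
      rw [hfull] at h4
      refine ⟨⟨y', hy'D, fun j hj => by rw [h'.2 j hj, h4 j hj], hy'B⟩, ?_⟩
      rw [f'.reg .res (by decide), h5, hcr]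
  · rw [hNg]
    have : nb ≤ nb * W := Nat.le_mul_of_pos_right _ hW0
    have e : nb * (1 + (1 + W * (10 + 1) + (1 + W * (8 + 1))) + 1) = 20 * (nb * W) + 4 * nb := by ring
    rw [e]; omega

end ArrayRam

/-! ### Counting the inversions of a permutation -/

namespace ArrayRam

variable {M : ℕ} {s s' : St}

theorem invL_le (l : List ℕ) : invL l ≤ l.length * l.length := by
  induction l with
  | nil => simp [invL]
  | cons x l ih =>
    have := List.countP_le_length (p := fun y => decide (y < x)) (l := l)
    simp only [invL, List.length_cons]
    nlinarith

/-- There are N / S blocks with at most S * S pairs each. Used only to keep accumulated counts below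
M. -/
theorem innerInv_le {P : List ℕ} {N S : ℕ} (hP : P.Perm (List.range N)) (hS : 0 < S) (hd : S ∣ N) :
    innerInv P N S ≤ N * N := by
  rcases Nat.eq_zero_or_pos N with rfl | hN
  · simp [innerInv]
  have hSN := Nat.le_of_dvd hN hd
  refine (Finset.sum_le_card_nsmul _ _ (S * S) fun c hc => ?_).trans ?_
  · have := invL_le (blk P S c)
    rwa [length_blk hP hS (Finset.mem_range.1 hc)] at this
  · rw [Finset.card_range, smul_eq_mul, ← mul_assoc, Nat.div_mul_cancel hd]
    exact Nat.mul_le_mul_left _ hSN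

open Reg Arr in
/-- Add to `res` the number of inversions within the blocks of `g` entries of `T`. -/
def naive : Com :=
  .loop k (N / g) (.loop i g (.loop j i (
    .ite (T⟦k * g + i⟧ ≺ T⟦k * g + j⟧) (res ≔ res + 1) .skip)))

/-- Blocks of g values are so small that comparing all pairs costs only N / g times g², that is, O(N
* g). -/
theorem naive_spec {P : List ℕ} {N g r₀ : ℕ} (hN : s.reg .N = N) (hg : s.reg .g = g)
    (hP : P.Perm (List.range N)) (hd : g ∣ N)
    (hT : ∀ c < N / g, seg (s.arr .T) (c * g) g = blk P g c) (hr : s.reg .res = r₀)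
    (hM : r₀ + innerInv P N g + N < M) :
    wp M naive s (N / g * (g * (3 * g + 2) + 2) + 1) fun s' =>
      s'.reg .res = r₀ + innerInv P N g := by
  rcases Nat.eq_zero_or_pos N with rfl | hN0
  · refine (wp.loop (n := 0) (τ := 0) (fun _ s' => s'.reg .res = r₀) (by simp) (by simp [hN])
      (by omega) (by simp [hr]) fun i hi => by omega).mono (by simp) fun _ _ h => ?_
    simpa [innerInv] using h.2
  have hgN := Nat.le_of_dvd hN0 hd
  have hNg := Nat.div_le_self N g
  set f := s.arr .T with hf
  have htot : innerInv P N g = ∑ c ∈ Finset.range (N / g), invL (seg f (c * g) g) :=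
    Finset.sum_congr rfl fun c hc => by rw [hT c (Finset.mem_range.1 hc)]
  have hpart : ∀ c < N / g, ∑ c ∈ Finset.range c, invL (seg f (c * g) g) +
      invL (seg f (c * g) g) ≤ innerInv P N g := by
    intro c hc
    rw [htot, ← Finset.sum_range_succ]
    exact Finset.sum_le_sum_of_subset (Finset.range_subset_range.2 hc)
  refine (wp.loop (n := N / g) (τ := 1 + g * (1 + g * 3 + 1)) (fun c s' =>
    s'.reg .res = r₀ + ∑ c ∈ Finset.range c, invL (seg f (c * g) g)) (by simp) (by simp [hN, hg])
    (by omega) (by simp [hr]) fun c hc s₁ f₁ hc₁ h₁ => ?_).mono ?_ fun _ _ h => by rw [htot]; exact h.2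
  · set R := ∑ c ∈ Finset.range c, invL (seg f (c * g) g) with hR
    have hpc := hpart c hc
    rw [← hR] at hpc
    have hmono : ∀ i ≤ g, invL (seg f (c * g) i) ≤ invL (seg f (c * g) g) := by
      intro i hi
      have mono : Monotone fun i => invL (seg f (c * g) i) := monotone_nat_of_le_succ fun i => by
        rw [seg_succ, invL_concat]; omega
      exact mono hi
    have hg₁ : s₁.reg .g = g := (f₁.reg .g (by decide)).trans hg
    refine (wp.loop (n := g) (τ := 1 + g * 3) (fun i s' =>
      s'.reg .res = r₀ + R + invL (seg f (c * g) i)) (by simp) (by simpa using hg₁) (by omega)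
      (by simp [h₁, invL]) fun i hi s₂ f₂ hi₂ h₂ => ?_).mono (by omega) fun s₂ _ h₂ => ?_
    · have hg₂ : s₂.reg .g = g := (f₂.reg .g (by decide)).trans hg₁
      have hc₂ : s₂.reg .k = c := (f₂.reg .k (by decide)).trans hc₁
      have hT₂ : s₂.arr .T = f := by rw [f₂.arr .T (by decide), f₁.arr .T (by decide)]
      have hsucc : invL (seg f (c * g) (i + 1)) = invL (seg f (c * g) i) +
          (seg f (c * g) i).countP fun y => f (c * g + i) < y := by rw [seg_succ, invL_concat]
      have hmi := hmono (i + 1) hi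
      refine (wp.loop (n := i) (τ := 2) (fun j s' => s'.reg .res = r₀ + R + invL (seg f (c * g) i) +
        (seg f (c * g) j).countP fun y => f (c * g + i) < y) (by simp) (by simpa using hi₂) (by omega)
        (by simp [h₂]) fun j hj s₃ f₃ hj₃ h₃ => wp.basic' (by decide) ?_).mono
        (by have := Nat.mul_le_mul_right 3 hi.le; omega) fun s₃ _ h₃ => ?_
      · have hg₃ : s₃.reg .g = g := (f₃.reg .g (by decide)).trans hg₂
        have hc₃ : s₃.reg .k = c := (f₃.reg .k (by decide)).trans hc₂
        have hi₃ : s₃.reg .i = i := (f₃.reg .i (by decide)).trans hi₂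
        have hT₃ : s₃.arr .T = f := by rw [f₃.arr .T (by decide), hT₂]
        have hcj : (seg f (c * g) (j + 1)).countP (fun y => decide (f (c * g + i) < y)) =
            (seg f (c * g) j).countP (fun y => decide (f (c * g + i) < y)) +
              if f (c * g + i) < f (c * g + j) then 1 else 0 := by
          rw [seg_succ, List.countP_append]; simp [List.countP_cons]
        have hcle : (seg f (c * g) (j + 1)).countP (fun y => decide (f (c * g + i) < y)) ≤
            (seg f (c * g) i).countP fun y => decide (f (c * g + i) < y) := by
          obtain ⟨k, rfl⟩ := Nat.exists_eq_add_of_le hj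
          rw [seg_add (n := j.succ) (k := k), List.countP_append]; simp
        rw [hcj] at hcle ⊢
        simp only [vc, hg₃, hc₃, hi₃, hT₃, hj₃, h₃, Expr.ok_reg, Expr.ok_arr, Expr.ok_bin,
          Expr.ok_add, Expr.ok_mul, Expr.ok_ofNat, Expr.eval_reg, Expr.eval_arr, Expr.eval_lt,
          Expr.eval_add, Expr.eval_mul, Expr.eval_ofNat, true_and, St.reg_setReg, reduceCtorEq,
          if_true, if_false]
        split_ifs at hcle ⊢ <;> simp <;> omega
      · simp only [St.reg_setReg, reduceCtorEq, if_false]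
        rw [h₃.2, hsucc]; omega
    · simp only [St.reg_setReg, reduceCtorEq, if_false]
      rw [h₂.2, Finset.sum_range_succ]; omega
  · rw [add_comm]
    refine Nat.add_le_add_right (Nat.mul_le_mul_left _ ?_) 1
    have : g * (1 + g * 3 + 1) = g * (3 * g + 2) := by ring
    omega

/-- Admissible parameters of the inversion counting algorithm. -/
structure Fits (M L N gm g D : ℕ) : Prop where
  eqN : N = 2 ^ L
  eqg : g = 2 ^ gm
  eqD : D = 2 ^ g
  gm_le : gm ≤ L
  sq : g * g * D ^ g ≤ N
  word : D ^ g * D ^ g ≤ N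
  L_lt : L < 8 * (g * g)
  M_lt : 5 * N * N < M

open Reg Arr in
/-- One level of a round. -/
def level : Com :=
  (bp ≔ bp / 2 ;; S ≔ LO * bp ;; nb ≔ N / (2 * S) ;; wd ≔ 2 * S / g) ;; table ;; pass

open Reg Arr in
/-- One round of the algorithm: count the inversions due to bits `lo, …, lo + h - 1`. -/
def round : Com :=
  (h ≔ L - lo ;; .ite (g ≺ h) (h ≔ g) .skip ;; bp ≔ 1) ;;
  .loop lv h (bp ≔ bp * 2) ;;
  (HI ≔ LO * bp ;; S ≔ HI) ;; distribute ;; pack ;;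
  .loop lv h level ;;
  (lo ≔ lo + h ;; LO ≔ HI)

open Reg Arr in
/-- Count the inversions of the permutation in `X`. -/
def inversions : Com :=
  (res ≔ 0 ;; LO ≔ g ;; lo ≔ gm) ;;
  .loop rd ((L - gm + g - 1) / g) round ;;
  S ≔ g ;; distribute ;; naive

section
variable {P : List ℕ} {L N gm g D e : ℕ}

theorem Fits.pos (hF : Fits M L N gm g D) : 0 < g ∧ 0 < N ∧ 0 < D := by
  refine ⟨?_, ?_, ?_⟩
  · rw [hF.eqg]; positivity
  · rw [hF.eqN]; positivity
  · rw [hF.eqD]; positivity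

theorem Fits.lt (hF : Fits M L N gm g D) :
    g ≤ N ∧ N < M ∧ D ^ g ≤ N ∧ D ≤ N ∧ g * g ≤ N ∧ N ≤ N * N := by
  obtain ⟨hg, hN, hD⟩ := hF.pos
  have hDg : 0 < D ^ g := Nat.pow_pos hD
  have h1 : N ≤ N * N := Nat.le_mul_of_pos_left _ hN
  have h2 := hF.M_lt
  rw [mul_assoc] at h2
  have h3 := hF.word
  have h4 : D ^ g ≤ D ^ g * D ^ g := Nat.le_mul_of_pos_left _ hDg
  have h5 : D ≤ D ^ g := Nat.le_self_pow hg.ne' D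
  have h6 : g ≤ g * g := Nat.le_mul_of_pos_left _ hg
  have h7 : g * g ≤ g * g * D ^ g := Nat.le_mul_of_pos_right _ hDg
  have h8 := hF.sq
  omega

/-- The increase of `res` is the drop of `innerInv` under halving of the blocks; it is stated as a
sum to avoid subtraction. The condition h + 1 ≤ g ensures that the bit in question lies within the
digits that were kept. -/
theorem level_spec {r₀ h : ℕ} (hC : Ctx s N g D) (hF : Fits M L N gm g D)
    (hP : P.Perm (List.range N)) (hLO : s.reg .LO = 2 ^ e) (he : gm ≤ e) (hL : e + (h + 1) ≤ L)
    (hh : h + 1 ≤ g) (hb : s.reg .bp = 2 ^ (h + 1))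
    (hK : Packed (s.arr .PK) P N g D (2 ^ e) (2 ^ (e + (h + 1)))) (hr : s.reg .res = r₀)
    (hr' : r₀ ≤ 2 * N * N) :
    wp M level s (4 + (D ^ g * (8 * g + 8) + 1) + (40 * (N / g) + 10 * (N / g) + 10)) fun s' =>
      s'.reg .bp = 2 ^ h ∧ Packed (s'.arr .PK) P N g D (2 ^ e) (2 ^ (e + h)) ∧
      s'.reg .res + innerInv P N (2 ^ (e + h)) = r₀ + innerInv P N (2 ^ (e + (h + 1))) := by
  obtain ⟨hg, hN, hD⟩ := hF.pos
  obtain ⟨l1, l2, l3, l4, l5, l6⟩ := hF.lt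
  have hM := hF.M_lt
  rw [mul_assoc] at hM hr'
  set S := 2 ^ (e + h) with hS
  have h2S : 2 ^ (e + (h + 1)) = 2 * S := by rw [hS, ← add_assoc, pow_succ, mul_comm]
  have hS' : S = 2 ^ e * 2 ^ h := by rw [hS, pow_add]
  have hS0 : 0 < S := by positivity
  have hSN : 2 * S ∣ N := by rw [← h2S, hF.eqN]; exact pow_dvd_pow 2 hL
  have hgS : g ∣ 2 * S := by rw [← h2S, hF.eqg]; exact pow_dvd_pow 2 (by omega)
  have hbD : 2 * 2 ^ h ∣ D := by rw [← pow_succ', hF.eqD]; exact pow_dvd_pow 2 hh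
  have h2SN := Nat.le_of_dvd hN hSN
  have hbS : 2 ^ h ≤ S := by rw [hS']; exact Nat.le_mul_of_pos_left _ (by positivity)
  rw [h2S] at hK ⊢
  have hcr := innerInv_two_mul (P := P) hS0 hSN
  rw [level, add_assoc]
  refine (wp.seq (wp.basic' (Q := fun s' => s'.reg .bp = 2 ^ h ∧ s'.reg .nb = N / (2 * S) ∧
    s'.reg .wd = 2 * S / g) (by decide) ?_) fun s₁ f₁ h₁ =>
    wp.seq (table_spec (hC.frame f₁ (by decide)) h₁.1 hD (by omega) (by omega) (by omega) (by omega))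
    fun s₂ f₂ h₂ => (pass_spec ((hC.frame f₁ (by decide)).frame f₂ (by decide)) hg hD ?_ hP hS' hS0
      hbD hgS hSN hN ?_ ?_ h₂ ?_ (r₀ := r₀) ?_ ?_).mono le_rfl fun s₃ f₃ h₃ => ?_)
  · have e1 : 2 ^ (h + 1) / 2 = 2 ^ h := by rw [pow_succ, Nat.mul_div_cancel _ (by omega)]
    simp only [vc, hb, hLO, hC.regN, hC.regg, e1, ← hS', Expr.ok_reg, Expr.ok_ofNat, Expr.ok_div,
      Expr.ok_mul, Expr.eval_reg, Expr.eval_ofNat, Expr.eval_div, Expr.eval_mul, true_and,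
      St.reg_setReg, reduceCtorEq, if_true, if_false]
    have := Nat.div_le_self N (2 * S)
    have := Nat.div_le_self (2 * S) g
    refine ⟨by omega, by omega, by omega, by omega, trivial⟩
  · have := hF.word; omega
  · rw [f₂.reg .nb (by decide), h₁.2.1]
  · rw [f₂.reg .wd (by decide), h₁.2.2]
  · rw [f₂.arr .PK (by decide), f₁.arr .PK (by decide)]; exact hK
  · rw [f₂.reg .res (by decide), f₁.reg .res (by decide), hr]
  · rw [mul_assoc]; omega
  · refine ⟨?_, h₃.1, ?_⟩
    · rw [f₃.reg .bp (by decide), f₂.reg .bp (by decide), h₁.1]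
    · rw [h₃.2, hcr]; ring

/-- The place where the parameters pay off: at most g levels with N / g words each are N steps up to
a constant, and g tabulations are bounded by g * g * D ^ g ≤ N. -/
theorem round_cost {T U : ℕ} (hF : Fits M L N gm g D) {h : ℕ} (hh : h ≤ g)
    (hT : T = 4 + (D ^ g * (8 * g + 8) + 1) + (40 * (N / g) + 10 * (N / g) + 10))
    (hU : U = N / g * (2 * g + 4) + 1) :
    5 + ((1 + h * (1 + 1)) + (2 + ((10 * N + 2) + (U + ((1 + h * (T + 1)) + 2))))) ≤ 150 * N := by
  obtain ⟨hg, hN, hD⟩ := hF.pos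
  obtain ⟨l1, l2, l3, l4, l5, l6⟩ := hF.lt
  have hsq := hF.sq
  have e1 : N / g * g ≤ N := Nat.div_mul_le_self N g
  have e2 : N / g ≤ N := Nat.div_le_self N g
  have e3 : h * (T + 1) ≤ g * (T + 1) := Nat.mul_le_mul_right _ hh
  have e4 : g * D ^ g ≤ g * g * D ^ g :=
    Nat.mul_le_mul_right _ (Nat.le_mul_of_pos_left _ hg)
  have e5 : g * (T + 1) = 8 * (g * g * D ^ g) + 8 * (g * D ^ g) + 50 * (N / g * g) + 16 * g := by
    rw [hT]; ring
  have e6 : U = 2 * (N / g * g) + 4 * (N / g) + 1 := by rw [hU]; ring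
  omega

/-- A round works downward from blocks of size 2 ^ (e + h) to blocks of size 2 ^ e, while successive
rounds move upward through the bits. The last round may find fewer than g bits left, hence the
minimum. -/
theorem round_spec (hC : Ctx s N g D) (hF : Fits M L N gm g D) (hP : P.Perm (List.range N))
    (hX : seg (s.arr .X) 0 N = P) (hL : s.reg .L = L)
    (hlo : s.reg .lo = e) (hLO : s.reg .LO = 2 ^ e) (he : gm ≤ e) (heL : e ≤ L)
    (hr : s.reg .res + innerInv P N g = innerInv P N (2 ^ e)) :
    wp M round s (150 * N) fun s' => s'.reg .lo = e + min g (L - e) ∧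
      s'.reg .LO = 2 ^ (e + min g (L - e)) ∧
      s'.reg .res + innerInv P N g = innerInv P N (2 ^ (e + min g (L - e))) := by
  obtain ⟨hg, hN, hD⟩ := hF.pos
  obtain ⟨l1, l2, l3, l4, l5, l6⟩ := hF.lt
  have hM := hF.M_lt
  rw [mul_assoc] at hM
  set h := min g (L - e) with hh
  have hhg : h ≤ g := min_le_left _ _
  have hehL : e + h ≤ L := by omega
  have hLN : L < N := by rw [hF.eqN]; exact Nat.lt_two_pow_self
  have hpN : ∀ i ≤ L, 2 ^ i ∣ N := fun i hi => by rw [hF.eqN]; exact pow_dvd_pow 2 hi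
  have hpN' : ∀ i ≤ L, 2 ^ i ≤ N := fun i hi => Nat.le_of_dvd hN (hpN i hi)
  have hin : ∀ i ≤ L, innerInv P N (2 ^ i) ≤ N * N := fun i hi =>
    innerInv_le hP (by positivity) (hpN i hi)
  refine (wp.seq (wp.basic' (T := 5) (Q := fun s' => s'.reg .h = h ∧ s'.reg .bp = 1) (by decide) ?_)
    fun s₁ f₁ h₁ => wp.seq (wp.loop (n := h) (τ := 1) (fun i s' => s'.reg .bp = 2 ^ i) (by simp)
      (by simpa using h₁.1) (by omega) (by simpa using h₁.2)
      fun i hi s₂ f₂ hi₂ h₂ => wp.basic' (by decide) ?_)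
    fun s₂ f₂ h₂ => wp.seq (wp.basic' (T := 2)
      (Q := fun s' => s'.reg .HI = 2 ^ (e + h) ∧ s'.reg .S = 2 ^ (e + h)) (by decide) ?_)
    fun s₃ f₃ h₃ => wp.seq (distribute_spec (P := P) ?_ h₃.2 ?_ hP (hpN _ hehL) (by positivity) l2)
    fun s₄ f₄ h₄ => wp.seq (pack_spec (lo := 2 ^ e) ((((hC.frame f₁ (by decide)).frame f₂
      (by decide)).frame f₃ (by decide)).frame f₄ (by decide)) ?_ hD l2 (by omega) (by omega))
    fun s₅ f₅ h₅ => wp.seq (wp.loop (n := h)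
      (τ := 4 + (D ^ g * (8 * g + 8) + 1) + (40 * (N / g) + 10 * (N / g) + 10)) (fun i s' =>
      s'.reg .bp = 2 ^ (h - i) ∧ Packed (s'.arr .PK) P N g D (2 ^ e) (2 ^ (e + (h - i))) ∧
      s'.reg .res + innerInv P N (2 ^ (e + (h - i))) + innerInv P N g =
        innerInv P N (2 ^ e) + innerInv P N (2 ^ (e + h))) (by simp) ?_ (by omega) ?_
      fun i hi s₆ f₆ hi₆ h₆ => ?_)
    fun s₆ f₆ h₆ => wp.basic' (T := 2) (by decide) ?_).mono (round_cost hF hhg rfl rfl) fun _ _ => id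
  · simp only [vc, hL, hlo, hC.regg, Expr.ok_reg, Expr.ok_ofNat, Expr.ok_sub, Expr.ok_bin,
      Expr.eval_reg, Expr.eval_ofNat, Expr.eval_sub, Expr.eval_lt, true_and,
      St.reg_setReg, reduceCtorEq, if_true, if_false]
    refine ⟨by omega, fun hgt => ⟨by omega, by omega, ?_, trivial⟩, fun hgt => ⟨by omega, ?_, trivial⟩⟩
    · by_contra hne
      have : ¬ g < L - e := by omega
      simp [this] at hgt
    · by_contra hne
      have : g < L - e := by omega
      simp [this] at hgt
  · have : 2 ^ (i + 1) ≤ N := hpN' _ (by omega)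
    simp only [vc, h₂, Expr.ok_reg, Expr.ok_ofNat, Expr.ok_mul,
      Expr.eval_reg, Expr.eval_ofNat, Expr.eval_mul, true_and,
      St.reg_setReg, reduceCtorEq, if_true, if_false, ← pow_succ, and_true]
    omega
  · have : 2 ^ (e + h) ≤ N := hpN' _ (by omega)
    have hLO₂ : s₂.reg .LO = 2 ^ e := by rw [f₂.reg .LO (by decide), f₁.reg .LO (by decide), hLO]
    simp only [vc, h₂.2, hLO₂, Expr.ok_reg, Expr.ok_ofNat, Expr.ok_mul,
      Expr.eval_reg, Expr.eval_ofNat, Expr.eval_mul, true_and,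
      St.reg_setReg, reduceCtorEq, if_true, if_false, ← pow_add, and_true]
    omega
  · rw [f₃.reg .N (by decide), f₂.reg .N (by decide), f₁.reg .N (by decide), hC.regN]
  · rw [f₃.arr .X (by decide), f₂.arr .X (by decide), f₁.arr .X (by decide), hX]
  · rw [f₄.reg .LO (by decide), f₃.reg .LO (by decide), f₂.reg .LO (by decide),
      f₁.reg .LO (by decide), hLO]
  · simp only [Expr.eval_reg]
    rw [f₅.reg .h (by decide), f₄.reg .h (by decide), f₃.reg .h (by decide), f₂.reg .h (by decide),
      h₁.1]
  · simp only [Nat.sub_zero, St.reg_setReg, reduceCtorEq, if_false, St.arr_setReg]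
    refine ⟨?_, ⟨_, fun i => Nat.mod_lt _ hD, h₅, fun c hc => ?_⟩, ?_⟩
    · rw [f₅.reg .bp (by decide), f₄.reg .bp (by decide), f₃.reg .bp (by decide), h₂.2]
    · rw [← h₄ c hc, map_seg fun x => x / 2 ^ e % D]
    · rw [f₅.reg .res (by decide), f₄.reg .res (by decide), f₃.reg .res (by decide),
        f₂.reg .res (by decide), f₁.reg .res (by decide)]
      omega
  · obtain ⟨k1, k2, k3⟩ := h₆
    have hC₅ := (((((hC.frame f₁ (by decide)).frame f₂ (by decide)).frame f₃ (by decide)).frame f₄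
      (by decide)).frame f₅ (by decide)).frame f₆ (by decide)
    have hLO₆ : s₆.reg .LO = 2 ^ e := by
      rw [f₆.reg .LO (by decide), f₅.reg .LO (by decide), f₄.reg .LO (by decide),
        f₃.reg .LO (by decide), f₂.reg .LO (by decide), f₁.reg .LO (by decide), hLO]
    obtain ⟨h', hh'⟩ : ∃ h', h - i = h' + 1 := ⟨h - i - 1, by omega⟩
    have hh'' : h - (i + 1) = h' := by omega
    rw [hh'] at k1 k2 k3
    have b1 := hin e heL
    have b2 := hin (e + h) hehL
    refine (level_spec hC₅ hF hP hLO₆ he (h := h') (by omega) (by omega) k1 k2 rfl ?_).mono le_rfl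
      fun s₇ f₇ h₇ => ?_
    · rw [mul_assoc]; omega
    · obtain ⟨m1, m2, m3⟩ := h₇
      simp only [St.reg_setReg, reduceCtorEq, if_false, St.arr_setReg, hh'']
      exact ⟨m1, m2, by omega⟩
  · have hh₆ : s₆.reg .h = h := by
      rw [f₆.reg .h (by decide), f₅.reg .h (by decide), f₄.reg .h (by decide),
        f₃.reg .h (by decide), f₂.reg .h (by decide), h₁.1]
    have hlo₆ : s₆.reg .lo = e := by
      rw [f₆.reg .lo (by decide), f₅.reg .lo (by decide), f₄.reg .lo (by decide),
        f₃.reg .lo (by decide), f₂.reg .lo (by decide), f₁.reg .lo (by decide), hlo]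
    have hHI₆ : s₆.reg .HI = 2 ^ (e + h) := by
      rw [f₆.reg .HI (by decide), f₅.reg .HI (by decide), f₄.reg .HI (by decide), h₃.1]
    have := hpN' _ hehL
    obtain ⟨-, -, -, k3⟩ := h₆
    simp only [Nat.sub_self, add_zero] at k3
    simp only [vc, hh₆, hlo₆, hHI₆, Expr.ok_reg, Expr.ok_add, Expr.eval_reg, Expr.eval_add, true_and,
      St.reg_setReg, reduceCtorEq, if_true, if_false]
    exact ⟨by omega, by omega, by omega⟩

/-- The rounds start at exponent `gm`, that is, at block size g, and raise `res` to the number of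
inversions outside the blocks of size g; the direct count supplies those inside. Both parts cost O(N
* g). -/
theorem inversions_spec (hC : Ctx s N g D) (hF : Fits M L N gm g D) (hP : P.Perm (List.range N))
    (hX : seg (s.arr .X) 0 N = P) (hL : s.reg .L = L) (hgm : s.reg .gm = gm) :
    wp M inversions s (1500 * (N * g)) fun s' => s'.reg .res = invL P := by
  obtain ⟨hg, hN, hD⟩ := hF.pos
  obtain ⟨l1, l2, l3, l4, l5, l6⟩ := hF.lt
  have hM := hF.M_lt
  rw [mul_assoc] at hM
  have hLN : L < N := by rw [hF.eqN]; exact Nat.lt_two_pow_self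
  have hpN : ∀ i ≤ L, 2 ^ i ∣ N := fun i hi => by rw [hF.eqN]; exact pow_dvd_pow 2 hi
  have hgN : g ∣ N := by rw [hF.eqg]; exact hpN _ hF.gm_le
  have hgmL := hF.gm_le
  set n := (L - gm + g - 1) / g with hn
  have hng : n * g ≤ L - gm + g - 1 := Nat.div_mul_le_self _ _
  have hng' : L - gm ≤ n * g := by
    have := Nat.lt_div_mul_add (a := L - gm + g - 1) hg
    rw [← hn] at this; omega
  -- From n * g ≤ L + g and L < 8 * g²: the number of rounds is of the order of g.
  have hn9 : n ≤ 9 * g := by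
    have h1 := hF.L_lt
    have : n * g ≤ 9 * g * g := by
      rw [mul_assoc]; have : g ≤ g * g := Nat.le_mul_of_pos_left _ hg
      omega
    exact Nat.le_of_mul_le_mul_right this hg
  have hg8 : 9 * g ≤ 9 * N := by omega
  have hin := innerInv_le hP hg hgN
  refine (wp.seq (wp.basic' (T := 3) (Q := fun s' => s'.reg .res = 0 ∧ s'.reg .LO = 2 ^ gm ∧
      s'.reg .lo = gm) (by decide) ?_)
    fun s₁ f₁ h₁ => wp.seq (wp.loop (n := n) (τ := 150 * N) (fun i s' =>
      s'.reg .lo = min L (gm + i * g) ∧ s'.reg .LO = 2 ^ min L (gm + i * g) ∧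
      s'.reg .res + innerInv P N g = innerInv P N (2 ^ min L (gm + i * g)))
      (by simp) ?_ ?_ ?_ fun i hi s₂ f₂ hi₂ h₂ => ?_)
    fun s₂ f₂ h₂ => wp.seq (wp.basic' (T := 1) (Q := fun s' => s'.reg .S = g) (by decide) ?_)
    fun s₃ f₃ h₃ => wp.seq (distribute_spec (P := P) ?_ h₃ ?_ hP hgN hg l2)
    -- By telescoping, the rounds have produced all inversions except those within blocks of size g.
    fun s₄ f₄ h₄ => (naive_spec (P := P) (r₀ := innerInv P N N - innerInv P N g) ?_ ?_ hP hgN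
      h₄ ?_ ?_).mono le_rfl fun s₅ f₅ h₅ => ?_).mono ?_ fun _ _ => id
  · simp only [vc, hC.regg, hgm, Expr.ok_reg, Expr.ok_ofNat, Expr.eval_reg, Expr.eval_ofNat, true_and,
      St.reg_setReg, reduceCtorEq, if_true, if_false]
    exact ⟨by omega, by omega, by omega, hF.eqg, trivial⟩
  · simp only [Expr.eval_div, Expr.eval_sub, Expr.eval_add, Expr.eval_reg, Expr.eval_ofNat]
    rw [f₁.reg .L (by decide), f₁.reg .gm (by decide), (hC.frame f₁ (by decide)).regg, hL, hgm]
  · have : n ≤ n * g := Nat.le_mul_of_pos_right _ hg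
    omega
  · obtain ⟨k1, k2, k3⟩ := h₁
    rw [zero_mul, add_zero, min_eq_right hgmL, ← hF.eqg]
    simp [k1, k2, k3, hF.eqg]
  · obtain ⟨k1, k2, k3⟩ := h₂
    refine (round_spec ((hC.frame f₁ (by decide)).frame f₂ (by decide)) hF hP ?_ ?_ k1 k2
      (by omega) (by omega) k3).mono le_rfl fun s₃ f₃ h₃ => ?_
    · rw [f₂.arr .X (by decide), f₁.arr .X (by decide), hX]
    · rw [f₂.reg .L (by decide), f₁.reg .L (by decide), hL]
    · have : min L (gm + i * g) + min g (L - min L (gm + i * g)) = min L (gm + (i + 1) * g) := by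
        rw [Nat.succ_mul]; omega
      rw [this] at h₃
      simpa using h₃
  · simp only [vc, ((hC.frame f₁ (by decide)).frame f₂ (by decide)).regg, Expr.ok_reg, Expr.eval_reg,
      true_and, St.reg_setReg, if_true]
    exact ⟨by omega, trivial⟩
  · rw [f₃.reg .N (by decide), f₂.reg .N (by decide), f₁.reg .N (by decide), hC.regN]
  · rw [f₃.arr .X (by decide), f₂.arr .X (by decide), f₁.arr .X (by decide), hX]
  · rw [f₄.reg .N (by decide), f₃.reg .N (by decide), f₂.reg .N (by decide), f₁.reg .N (by decide),
      hC.regN]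
  · rw [f₄.reg .g (by decide), f₃.reg .g (by decide), f₂.reg .g (by decide), f₁.reg .g (by decide),
      hC.regg]
  · obtain ⟨-, -, -, k3⟩ := h₂
    rw [min_eq_left (by omega), ← hF.eqN] at k3
    rw [f₄.reg .res (by decide), f₃.reg .res (by decide)]
    omega
  · have := innerInv_le hP hN dvd_rfl
    omega
  · obtain ⟨-, -, -, k3⟩ := h₂
    rw [min_eq_left (by omega), ← hF.eqN] at k3
    rw [h₅, ← innerInv_self hP hN]
    omega
  · have e1 : n * (150 * N + 1) ≤ 9 * g * (151 * N) := Nat.mul_le_mul hn9 (by omega)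
    have e2 : N / g * (g * (3 * g + 2) + 2) = 3 * (N / g * g * g) + 2 * (N / g * g) + 2 * (N / g) := by
      ring
    have e3 : N / g * g = N := Nat.div_mul_cancel hgN
    have e4 : N / g ≤ N := Nat.div_le_self _ _
    have e5 : N ≤ N * g := Nat.le_mul_of_pos_right _ hg
    have e6 : 9 * g * (151 * N) = 1359 * (N * g) := by ring
    rw [e2, e3]
    omega

end

end ArrayRam

namespace ArrayRam

variable {M : ℕ} {s s' : St}

/-! ### Sorting -/

open Reg Arr in
/-- Append to `KY2` the keys whose bit of weight `p2` is `e`. -/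
def collect (e : Expr) : Com :=
  .loop i m (x ≔ KEY⟦i⟧ ;; .ite (x / p2 % 2 ≐ e) (KY2⟦q⟧ ⇐ x ;; q ≔ q + 1) .skip)

open Reg Arr in
/-- Sort the `m` keys, of at most `NB` bits. -/
def sort : Com :=
  p2 ≔ 1 ;;
  .loop b NB (
    q ≔ 0 ;; collect 0 ;; collect 1 ;;
    .loop i m (KEY⟦i⟧ ⇐ KY2⟦i⟧) ;;
    p2 ≔ p2 * 2)

theorem collect_spec {m p v : ℕ} {l : List ℕ} {e : Expr} (he : ∀ t : St, e.Ok t ∧ e.eval t = v)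
    (hm : s.reg .m = m) (hp : s.reg .p2 = p) (hq : s.reg .q = l.length)
    (hl : seg (s.arr .KY2) 0 l.length = l) (hM : l.length + m + 1 < M)
    (hK : ∀ i < m, s.arr .KEY i < M) :
    wp M (collect e) s (1 + m * 5) fun s' =>
      let l' := l ++ (seg (s.arr .KEY) 0 m).filter fun x => x / p % 2 = v
      s'.reg .q = l'.length ∧ seg (s'.arr .KY2) 0 l'.length = l' := by
  refine (wp.loop (n := m) (τ := 4) (fun i s' =>
      let l' := l ++ (seg (s.arr .KEY) 0 i).filter fun x => x / p % 2 = v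
      s'.reg .q = l'.length ∧ seg (s'.arr .KY2) 0 l'.length = l') (by simp) (by simpa using hm)
      (by omega) (by simpa [hq] using hl) fun i hi s₁ f₁ hi₁ h₁ =>
      wp.basic' (by simp [Com.ticks]) ?_).mono le_rfl fun _ _ h => h.2
  obtain ⟨h1, h2⟩ := h₁
  have hK₁ : s₁.arr .KEY = s.arr .KEY := f₁.arr .KEY (by simp [Com.arrs])
  have hp₁ : s₁.reg .p2 = p := (f₁.reg .p2 (by simp [Com.regs])).trans hp
  set l' := l ++ (seg (s.arr .KEY) 0 i).filter fun x => decide (x / p % 2 = v) with hl'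
  have hlen : l'.length ≤ l.length + i := by
    simpa [hl'] using (List.length_filter_le _ (seg (s.arr .KEY) 0 i))
  simp only [seg_succ, List.filter_append, ← List.append_assoc, ← hl', zero_add, List.filter_cons,
    List.filter_nil, decide_eq_true_eq]
  simp only [vc, hi₁, hK₁, hp₁, h1, he, Expr.ok_reg, Expr.ok_arr, Expr.ok_bin, Expr.ok_div,
    Expr.ok_mod, Expr.ok_add, Expr.ok_ofNat, Expr.eval_reg, Expr.eval_arr, Expr.eval_div,
    Expr.eval_mod, Expr.eval_add, Expr.eval_ofNat, Expr.eval_eq, true_and, St.reg_setReg,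
    St.reg_setArr, St.arr_setReg, St.arr_setArr, reduceCtorEq, if_true, if_false]
  refine ⟨hK i hi, fun hc => ?_, fun hc => ?_⟩
  · have hc' : s.arr .KEY i / p % 2 = v := by by_contra h; simp [h] at hc
    refine ⟨hK i hi, by omega, ?_⟩
    simp only [hc', if_true, List.length_append, List.length_singleton, true_and]
    have := seg_update_succ (f := s₁.arr .KY2) (a := 0) (n := l'.length) (v := s.arr .KEY i)
    rwa [zero_add, h2] at this
  · have hc' : ¬ s.arr .KEY i / p % 2 = v := by intro h; simp [h] at hc
    simp [hc', h2]

/-- Bit b decides, and ties are left to the lower bits; this is the induction step of radix sort. -/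
theorem mod_two_pow_succ_le {b x y : ℕ} (h : x / 2 ^ b % 2 ≤ y / 2 ^ b % 2)
    (h' : x / 2 ^ b % 2 = y / 2 ^ b % 2 → x % 2 ^ b ≤ y % 2 ^ b) :
    x % 2 ^ (b + 1) ≤ y % 2 ^ (b + 1) := by
  have hx := Nat.mod_lt x (Nat.two_pow_pos b)
  rw [pow_succ, Nat.mod_mul, Nat.mod_mul]
  rcases h.lt_or_eq with h | h
  · have := Nat.mul_le_mul_left (2 ^ b) (Nat.succ_le_of_lt h)
    rw [Nat.mul_succ] at this; omega
  · rw [h]; have := h' h; omega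

/-- Radix sort from the lowest bit. Collecting first the clear and then the set bits is stable, so
the order by lower bits survives inside each half. The cost is linear in m per bit. -/
theorem sort_spec {m NB : ℕ} (hm : s.reg .m = m) (hNB : s.reg .NB = NB)
    (hK : ∀ i < m, s.arr .KEY i < 2 ^ NB) (hM : 2 ^ NB < M) (hmM : 2 * m + 1 < M) :
    wp M sort s (NB * (12 * m + 8) + 2) fun s' =>
      (seg (s'.arr .KEY) 0 m).Perm (seg (s.arr .KEY) 0 m) ∧
      (seg (s'.arr .KEY) 0 m).Pairwise (· ≤ ·) := by
  have hNBM : NB < M := Nat.lt_two_pow_self.trans hM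
  set l₀ := seg (s.arr .KEY) 0 m with hl₀
  have hlt₀ : ∀ x ∈ l₀, x < 2 ^ NB := fun x hx => by
    obtain ⟨i, hi, rfl⟩ := mem_seg.1 hx; simpa using hK i hi
  refine (wp.seq (wp.basic' (T := 1) (Q := fun s' => s'.reg .p2 = 1) (by decide)
    (by simp [vc]; omega)) fun s₁ f₁ h₁ => wp.loop (n := NB)
    (τ := 1 + ((1 + m * 5) + ((1 + m * 5) + ((1 + m * (1 + 1)) + 1)))) (fun b s' =>
      (seg (s'.arr .KEY) 0 m).Perm l₀ ∧ s'.reg .p2 = 2 ^ b ∧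
      (seg (s'.arr .KEY) 0 m).Pairwise fun x y => x % 2 ^ b ≤ y % 2 ^ b)
    (by simp) (by simpa [hNB] using f₁.reg .NB (by decide)) hNBM ?_
    fun b hb s₂ f₂ hb₂ h₂ => ?_).mono ?_ fun s₂ f₂ h₂ => ?_
  · refine ⟨?_, by simpa using h₁, ?_⟩
    · simp [f₁.arr .KEY (by decide), hl₀]
    · simp [Nat.mod_one, List.pairwise_iff_getElem]
  · obtain ⟨k1, k2, k3⟩ := h₂
    have hm₂ : s₂.reg .m = m := by rw [f₂.reg .m (by decide), f₁.reg .m (by decide), hm]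
    set l := seg (s₂.arr .KEY) 0 m with hl
    have hbM : 2 ^ (b + 1) < M := (Nat.pow_le_pow_right (by omega) hb).trans_lt hM
    have hKM : ∀ i < m, s₂.arr .KEY i < M := fun i hi =>
      (hlt₀ _ (k1.subset (mem_seg.2 ⟨i, hi, by rw [zero_add]⟩))).trans hM
    set A := l.filter fun x => x / 2 ^ b % 2 = 0 with hA
    set B := l.filter fun x => x / 2 ^ b % 2 = 1 with hB
    -- A remainder modulo 2 that is not 0 is 1, so the two collections partition the list.
    have hAB : (A ++ B).Perm l := by
      have : B = l.filter fun x => !decide (x / 2 ^ b % 2 = 0) :=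
        List.filter_congr fun x _ => by
          rw [Bool.eq_iff_iff]; simp
      rw [this]; exact List.filter_append_perm _ _
    have hlen : (A ++ B).length = m := by rw [hAB.length_eq, hl, length_seg]
    have hlenA : A.length ≤ m := by rw [← hlen]; simp
    refine wp.seq (wp.basic' (Q := fun s' => s'.reg .q = 0) (by decide)
      (by simp [vc]; omega)) fun s₃ f₃ h₃ => ?_
    refine wp.seq (collect_spec (l := []) (v := 0) (m := m) (p := 2 ^ b) (by simp) ?_ ?_
      (by simpa using h₃) (by simp) (by simp only [List.length_nil]; omega) ?_) fun s₄ f₄ h₄ => ?_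
    · rw [f₃.reg .m (by decide), hm₂]
    · rw [f₃.reg .p2 (by decide), k2]
    · rw [f₃.arr .KEY (by decide)]; exact hKM
    rw [f₃.arr .KEY (by decide), List.nil_append, ← hl, ← hA] at h₄
    refine wp.seq (collect_spec (l := A) (v := 1) (m := m) (p := 2 ^ b) (by simp) ?_ ?_
      h₄.1 h₄.2 ?_ ?_) fun s₅ f₅ h₅ => ?_
    · rw [f₄.reg .m (by decide), f₃.reg .m (by decide), hm₂]
    · rw [f₄.reg .p2 (by decide), f₃.reg .p2 (by decide), k2]
    · omega
    · rw [f₄.arr .KEY (by decide), f₃.arr .KEY (by decide)]; exact hKM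
    rw [f₄.arr .KEY (by decide), f₃.arr .KEY (by decide), ← hl, ← hB] at h₅
    have hseg : seg (s₅.arr .KY2) 0 m = A ++ B := by
      have := h₅.2; rwa [hlen] at this
    have hABM : ∀ i < m, s₅.arr .KY2 i < M := fun i hi => by
      have : s₅.arr .KY2 i ∈ A ++ B := by rw [← hseg]; exact mem_seg.2 ⟨i, hi, by rw [zero_add]⟩
      exact (hlt₀ _ (k1.subset (hAB.subset this))).trans hM
    refine wp.seq (wp.loop (n := m) (fun i s' => seg (s'.arr .KEY) 0 i = seg (s₅.arr .KY2) 0 i)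
      (by simp) ?_ (by omega) (by simp) fun i hi s₆ f₆ hi₆ h₆ => wp.basic' (by decide) ?_)
      fun s₆ f₆ h₆ => wp.basic' (by decide) ?_
    · simp only [Expr.eval_reg]
      rw [f₅.reg .m (by decide), f₄.reg .m (by decide), f₃.reg .m (by decide), hm₂]
    · simp only [vc, hi₆, f₆.arr .KY2 (by decide), Expr.ok_reg, Expr.ok_arr, Expr.eval_reg,
        Expr.eval_arr, true_and, St.arr_setReg, St.arr_setArr, if_true]
      refine ⟨hABM i hi, ?_⟩
      have := seg_update_succ (f := s₆.arr .KEY) (a := 0) (n := i) (v := s₅.arr .KY2 i)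
      rw [zero_add] at this
      rw [this, h₆, seg_succ, zero_add]
    · have hp₆ : s₆.reg .p2 = 2 ^ b := by
        rw [f₆.reg .p2 (by decide), f₅.reg .p2 (by decide), f₄.reg .p2 (by decide),
          f₃.reg .p2 (by decide), k2]
      simp only [vc, hp₆, Expr.ok_reg, Expr.ok_mul, Expr.ok_ofNat, Expr.eval_reg, Expr.eval_mul,
        Expr.eval_ofNat, true_and, St.arr_setReg, St.reg_setReg, reduceCtorEq, if_true, if_false,
        ← pow_succ]
      rw [h₆.2, hseg]
      refine ⟨hbM, hAB.trans k1, ?_⟩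
      rw [List.pairwise_append]
      refine ⟨?_, ?_, ?_⟩
      · rw [hA, List.pairwise_filter]
        refine k3.imp fun h hx hy => mod_two_pow_succ_le ?_ fun _ => h
        simp only [decide_eq_true_eq] at hx hy; omega
      · rw [hB, List.pairwise_filter]
        refine k3.imp fun h hx hy => mod_two_pow_succ_le ?_ fun _ => h
        simp only [decide_eq_true_eq] at hx hy; omega
      · intro x hx y hy
        rw [hA, List.mem_filter, decide_eq_true_eq] at hx
        rw [hB, List.mem_filter, decide_eq_true_eq] at hy
        exact mod_two_pow_succ_le (by omega) (by omega)
  · have : NB * (1 + (1 + m * 5 + (1 + m * 5 + (1 + m * (1 + 1) + 1))) + 1) = NB * (12 * m + 6) := by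
      ring
    have h2 : NB * (12 * m + 6) ≤ NB * (12 * m + 8) := Nat.mul_le_mul_left _ (by omega)
    omega
  · obtain ⟨-, k1, -, k3⟩ := h₂
    refine ⟨k1, k3.imp_of_mem fun {x y} hx hy h => ?_⟩
    rwa [Nat.mod_eq_of_lt (hlt₀ _ (k1.subset hx)), Nat.mod_eq_of_lt (hlt₀ _ (k1.subset hy))] at h

open Reg Arr in
/-- Compute the number of bits of the keys. -/
def keyBits : Com :=
  (NB ≔ 0 ;; p2 ≔ 1) ;;
  .loop i (m + 2 * K) (.ite (p2 ≺ m * K * K) (p2 ≔ p2 * 2 ;; NB ≔ NB + 1) .skip)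

/-- Every key will be below m * K * K, and the attempts suffice because each factor is at most two
to its own power. The upper bound on 2 ^ NB makes the number of bits logarithmic in m * K. -/
theorem keyBits_spec {m K : ℕ} (hm : s.reg .m = m) (hK : s.reg .K = K) (hm0 : 0 < m) (hK0 : 0 < K)
    (hM : 2 * (m * K * K) < M) (hM' : m + 2 * K < M) :
    wp M keyBits s (4 * m + 8 * K + 3) fun s' =>
      m * K * K ≤ 2 ^ s'.reg .NB ∧ 2 ^ s'.reg .NB ≤ 2 * (m * K * K) := by
  have hpos : 0 < m * K * K := by positivity
  have hbig : m * K * K ≤ 2 ^ (m + 2 * K) := by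
    rw [two_mul, ← add_assoc, pow_add, pow_add]
    exact Nat.mul_le_mul (Nat.mul_le_mul Nat.lt_two_pow_self.le Nat.lt_two_pow_self.le)
      Nat.lt_two_pow_self.le
  refine (wp.seq (wp.basic' (T := 2) (Q := fun s' => s'.reg .NB = 0 ∧ s'.reg .p2 = 1) (by decide)
    (by simp [vc]; omega)) fun s₁ f₁ h₁ => wp.loop (n := m + 2 * K) (τ := 3) (fun i s' =>
      s'.reg .p2 = 2 ^ s'.reg .NB ∧ 2 ^ s'.reg .NB ≤ 2 * (m * K * K) ∧
      (m * K * K ≤ 2 ^ s'.reg .NB ∨ s'.reg .NB = i))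
    (by simp) ?_ hM' ?_
    fun i hi s₂ f₂ hi₂ h₂ => wp.basic' (by decide) ?_).mono (by omega) fun s₂ f₂ h₂ => ?_
  · simp [f₁.reg .m (by decide), f₁.reg .K (by decide), hm, hK]
  · simp [h₁.1, h₁.2]; omega
  · have hm₂ : s₂.reg .m = m := by rw [f₂.reg .m (by decide), f₁.reg .m (by decide), hm]
    have hK₂ : s₂.reg .K = K := by rw [f₂.reg .K (by decide), f₁.reg .K (by decide), hK]
    obtain ⟨k1, k2, k3⟩ := h₂
    have := Nat.lt_two_pow_self (n := s₂.reg .NB)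
    simp only [vc, hm₂, hK₂, k1, Expr.ok_reg, Expr.ok_mul, Expr.ok_add, Expr.ok_bin, Expr.ok_ofNat,
      Expr.eval_reg, Expr.eval_mul, Expr.eval_add, Expr.eval_lt, Expr.eval_ofNat, true_and,
      St.reg_setReg, reduceCtorEq, if_true, if_false, pow_succ]
    refine ⟨fun hc => ?_, fun hc => ?_⟩
    · have hc' : 2 ^ s₂.reg .NB < m * K * K := by by_contra h; simp [h] at hc
      omega
    · have hc' : ¬ 2 ^ s₂.reg .NB < m * K * K := by intro h; simp [h] at hc
      omega
  · obtain ⟨-, -, k2, k3⟩ := h₂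
    refine ⟨k3.elim id fun h => h ▸ hbig, k2⟩

/-! ### Ranks of the frequencies -/

open Reg Arr in
/-- The rank of a frequency is the number of larger ones; `FR` maps ranks back to frequencies. -/
def ranks : Com :=
  .loop i m (
    x ≔ 0 ;;
    .loop j m (.ite (F⟦i⟧ ≺ F⟦j⟧) (x ≔ x + 1) .skip) ;;
    RK⟦i⟧ ⇐ x ;; FR⟦x⟧ ⇐ F⟦i⟧)

/-- The number of elements of `l` larger than `x`. -/
def rankIn (l : List ℕ) (x : ℕ) : ℕ := l.countP fun y => x < y

theorem rankIn_lt {l : List ℕ} {x y : ℕ} (hy : y ∈ l) (h : x < y) : rankIn l y < rankIn l x := by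
  induction l with
  | nil => simp at hy
  | cons z l ih =>
    have hmono : rankIn l y ≤ rankIn l x := List.countP_mono_left fun a _ ha => by
      simp only [decide_eq_true_eq] at ha ⊢; omega
    simp only [rankIn, List.countP_cons, decide_eq_true_eq] at *
    rcases List.mem_cons.1 hy with rfl | hy
    · simp [h]; omega
    · have := ih hy; split_ifs <;> omega

theorem rankIn_lt_iff {l : List ℕ} {x y : ℕ} (hx : x ∈ l) (hy : y ∈ l) :
    rankIn l y < rankIn l x ↔ x < y := by
  refine ⟨fun h => ?_, rankIn_lt hy⟩
  by_contra hxy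
  rcases (not_lt.1 hxy).eq_or_lt with rfl | h'
  · omega
  · have := rankIn_lt hx h'; omega

/-- Ranks are below m whatever the number of voters, so sort keys built from them have O(log (m *
K)) bits and the time for sorting does not depend on the size of the frequencies. -/
theorem ranks_spec {m : ℕ} (hm : s.reg .m = m) (hM : m + 1 < M) (hF : ∀ i < m, s.arr .F i < M) :
    wp M ranks s (m * (3 * m + 5) + 1) fun s' => ∀ i < m,
      s'.arr .RK i = rankIn (seg (s.arr .F) 0 m) (s.arr .F i) ∧
      s'.arr .FR (rankIn (seg (s.arr .F) 0 m) (s.arr .F i)) = s.arr .F i := by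
  set f := s.arr .F with hf
  have hmem : ∀ i < m, f i ∈ seg f 0 m := fun i hi => mem_seg.2 ⟨i, hi, by rw [zero_add]⟩
  refine (wp.loop (n := m) (τ := 1 + ((1 + m * (2 + 1)) + 2)) (fun i s' => ∀ k < i,
      s'.arr .RK k = rankIn (seg f 0 m) (f k) ∧
      s'.arr .FR (rankIn (seg f 0 m) (f k)) = f k) (by simp) (by simpa using hm)
      (by omega) (by simp) fun i hi s₁ f₁ hi₁ h₁ => ?_).mono ?_ fun _ _ h => h.2
  · have hF₁ : s₁.arr .F = f := f₁.arr .F (by decide)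
    have hm₁ : s₁.reg .m = m := (f₁.reg .m (by decide)).trans hm
    refine wp.seq (wp.basic' (Q := fun s' => s'.reg .x = 0) (by decide) (by simp [vc]; omega))
      fun s₂ f₂ h₂ => wp.seq (wp.loop (n := m) (fun j s' => s'.reg .x = rankIn (seg f 0 j) (f i))
        (by simp) ?_ (by omega) (by simpa [rankIn] using h₂)
        fun j hj s₃ f₃ hj₃ h₃ => wp.basic' (by decide) ?_) fun s₃ f₃ h₃ => wp.basic' (by decide) ?_
    · simp [f₂.reg .m (by decide), hm₁]
    · have hF₃ : s₃.arr .F = f := by rw [f₃.arr .F (by decide), f₂.arr .F (by decide), hF₁]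
      have hi₃ : s₃.reg .i = i := by rw [f₃.reg .i (by decide), f₂.reg .i (by decide), hi₁]
      have hle : rankIn (seg f 0 j) (f i) ≤ j := by
        simpa [rankIn] using List.countP_le_length (l := seg f 0 j) (p := fun y => f i < y)
      have hs : rankIn (seg f 0 (j + 1)) (f i) = rankIn (seg f 0 j) (f i) +
          if f i < f j then 1 else 0 := by
        simp only [rankIn]; rw [seg_succ, List.countP_append]; simp [List.countP_cons]
      rw [hs]
      simp only [vc, hi₃, hj₃, hF₃, h₃, Expr.ok_reg, Expr.ok_arr, Expr.ok_bin, Expr.ok_add,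
        Expr.ok_ofNat, Expr.eval_reg, Expr.eval_arr, Expr.eval_lt, Expr.eval_add, Expr.eval_ofNat,
        true_and, St.reg_setReg, reduceCtorEq, if_true, if_false]
      split_ifs <;> simp; omega
    · have hF₃ : s₃.arr .F = f := by rw [f₃.arr .F (by decide), f₂.arr .F (by decide), hF₁]
      have hi₃ : s₃.reg .i = i := by rw [f₃.reg .i (by decide), f₂.reg .i (by decide), hi₁]
      have hRK : s₃.arr .RK = s₁.arr .RK := by rw [f₃.arr .RK (by decide), f₂.arr .RK (by decide)]
      have hFR : s₃.arr .FR = s₁.arr .FR := by rw [f₃.arr .FR (by decide), f₂.arr .FR (by decide)]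
      have hle : rankIn (seg f 0 m) (f i) ≤ m := by
        simpa [rankIn] using List.countP_le_length (l := seg f 0 m) (p := fun y => f i < y)
      simp only [vc, hi₃, hF₃, hRK, hFR, h₃.2, Expr.ok_reg, Expr.ok_arr, Expr.eval_reg,
        Expr.eval_arr, true_and, St.reg_setArr, St.arr_setReg, St.arr_setArr, reduceCtorEq,
        if_true, if_false]
      refine ⟨by omega, hF i hi, fun k hk => ⟨?_, ?_⟩⟩
      · rw [Function.update_apply]
        split_ifs with h
        · rw [h]
        · exact (h₁ k (by omega)).1
      · rw [Function.update_apply]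
        split_ifs with h
        -- Preferences of equal rank have equal frequency, so overwriting the entry of FR changes
        -- nothing.
        · rcases lt_trichotomy (f i) (f k) with h' | h' | h'
          · have := rankIn_lt (hmem k (by omega)) h'; omega
          · exact h'
          · have := rankIn_lt (hmem i hi) h'; omega
        · refine (h₁ k ?_).2
          rcases Nat.lt_succ_iff_lt_or_eq.1 hk with hk | rfl
          · exact hk
          · exact absurd rfl h
  · have : m * (1 + (1 + m * (2 + 1) + 2) + 1) = m * (3 * m + 5) := by ring
    omega

open Reg Arr in
/-- Set `ne` if the frequencies are not all equal. -/
def unequal : Com := ne ≔ 0 ;; .loop i m (.ite RK⟦i⟧ (ne ≔ 1) .skip)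

/-- The frequencies agree exactly when no one of them is exceeded by another, that is, when all
ranks vanish. -/
theorem unequal_spec {m : ℕ} (hm : s.reg .m = m) (hM : m + 1 < M) :
    wp M unequal s (3 * m + 2) fun s' => s'.reg .ne = 0 ↔ ∀ i < m, s.arr .RK i = 0 := by
  refine (wp.seq (wp.basic' (T := 1) (Q := fun s' => s'.reg .ne = 0) (by decide)
    (by simp [vc]; omega)) fun s₁ f₁ h₁ => wp.loop (n := m) (τ := 2)
    (fun i s' => s'.reg .ne = 0 ↔ ∀ k < i, s.arr .RK k = 0)
    (by simp) (by simp [f₁.reg .m (by decide), hm]) (by omega) (by simpa using h₁)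
    fun i hi s₂ f₂ hi₂ h₂ => wp.basic' (by decide) ?_).mono (by omega) fun s₂ f₂ h₂ => h₂.2
  have hR : s₂.arr .RK = s.arr .RK := by rw [f₂.arr .RK (by decide), f₁.arr .RK (by decide)]
  simp only [vc, hi₂, hR, Expr.ok_reg, Expr.ok_arr, Expr.ok_ofNat, Expr.eval_reg, Expr.eval_arr,
    Expr.eval_ofNat, true_and, St.reg_setReg, reduceCtorEq, if_true, if_false, Nat.lt_succ_iff_lt_or_eq]
  refine ⟨fun h => ⟨by omega, ?_⟩, fun h => ?_⟩
  · simp only [one_ne_zero, false_iff]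
    exact fun h' => h (h' i (Or.inr rfl))
  · rw [h₂]
    constructor
    · rintro h' k (hk | rfl)
      exacts [h' k hk, h]
    · exact fun h' k hk => h' k (Or.inl hk)

open Reg Arr in
/-- Compute `K!`, but stop at a number larger than `m`. -/
def factorial : Com := fc ≔ 1 ;; .loop i K (.ite (m ≺ fc) .skip (fc ≔ fc * (i + 1)))

/-- Factorials are monotone: once past m, the product never returns to m, and stopping there keeps
the register within m * K. -/
theorem factorial_spec {m K : ℕ} (hm : s.reg .m = m) (hK : s.reg .K = K)
    (hM : m * K + 1 < M) (hKM : K < M) :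
    wp M factorial s (3 * K + 2) fun s' => s'.reg .fc = m ↔ K.factorial = m := by
  refine (wp.seq (wp.basic' (T := 1) (Q := fun s' => s'.reg .fc = 1) (by decide)
    (by simp [vc]; omega)) fun s₁ f₁ h₁ => wp.loop (n := K) (τ := 2)
    (fun i s' => s'.reg .fc = i.factorial ∨ m < s'.reg .fc ∧ m < i.factorial)
    (by simp) (by simp [f₁.reg .K (by decide), hK]) hKM (by simp [h₁])
    fun i hi s₂ f₂ hi₂ h₂ => wp.basic' (by decide) ?_).mono (by omega) fun s₂ f₂ h₂ => ?_
  · have hm₂ : s₂.reg .m = m := by rw [f₂.reg .m (by decide), f₁.reg .m (by decide), hm]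
    have hle : i.factorial ≤ (i + 1).factorial := Nat.factorial_le (by omega)
    simp only [vc, hi₂, hm₂, Expr.ok_reg, Expr.ok_bin, Expr.ok_mul, Expr.ok_add, Expr.ok_ofNat,
      Expr.eval_reg, Expr.eval_lt, Expr.eval_mul, Expr.eval_add, Expr.eval_ofNat, true_and,
      St.reg_setReg, reduceCtorEq, if_true, if_false]
    refine ⟨fun h => ?_, fun h => ?_⟩
    · have h' : m < s₂.reg .fc := by by_contra hh; simp [hh] at h
      right; omega
    · have h' : s₂.reg .fc ≤ m := by by_contra hh; simp [not_le.1 hh] at h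
      have h2 : s₂.reg .fc = i.factorial := by omega
      refine ⟨?_, Or.inl ?_⟩
      · have := Nat.mul_le_mul h' (show i + 1 ≤ K by omega)
        omega
      · rw [h2, Nat.factorial_succ, mul_comm]
  · have := h₂.2; omega

/-! ### Sizes of balls -/

/-- The number of permutations of `k` elements with at most `d` inversions, by recursion. -/
def ball : ℕ → ℕ → ℕ
  | 0, _ => 1
  | k + 1, d => ∑ j ∈ Finset.Ico (d - k) (d + 1), ball k j

/-- Truncated summands give the correct truncated sum, so ball sizes may be stored cut off at m + 1,
which still decides whether they equal m. -/
theorem min_sum_min {ι : Type*} (t : Finset ι) (f : ι → ℕ) (c : ℕ) :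
    min c (∑ j ∈ t, min c (f j)) = min c (∑ j ∈ t, f j) := by
  classical
  induction t using Finset.induction with
  | empty => simp
  | insert a t ha ih => rw [Finset.sum_insert ha, Finset.sum_insert ha]; omega

open Reg Arr in
/-- Tabulate `ball K d` for `d < m`, cut off at `m + 1`. -/
def balls : Com :=
  .loop d m (BA⟦d⟧ ⇐ 1) ;;
  .loop k K (
    W ≔ 0 ;;
    .loop d m (
      W ≔ W + BA⟦d⟧ ;;
      .ite (k ≺ d) (W ≔ W - BA⟦d - k - 1⟧) .skip ;;
      .ite (m ≺ W) (BB⟦d⟧ ⇐ m + 1) (BB⟦d⟧ ⇐ W)) ;;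
    .loop d m (BA⟦d⟧ ⇐ BB⟦d⟧))

/-- Each row is a row of window sums of the previous one. A sliding window computes it in O(m)
steps, whatever the window length. -/
theorem balls_spec {m K : ℕ} (hm : s.reg .m = m) (hK : s.reg .K = K)
    (hM : (m + 1) * (m + 1) < M) (hKM : K < M) :
    wp M balls s ((1 + m * 2) + (1 + K * (8 * m + 4))) fun s' => ∀ d < m,
      s'.arr .BA d = min (m + 1) (ball K d) := by
  have hmM : m + 1 < M := by nlinarith
  refine (wp.seq (wp.loop (n := m) (τ := 1) (fun i s' => ∀ d < i, s'.arr .BA d = 1) (by simp)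
    (by simp [hm]) (by omega) (by simp) fun i hi s₁ f₁ hi₁ h₁ => wp.basic' (by decide) ?_)
    fun s₁ f₁ h₁ => wp.loop (n := K) (τ := 1 + ((1 + m * (5 + 1)) + (1 + m * (1 + 1)))) (fun k s' =>
      ∀ d < m, s'.arr .BA d = min (m + 1) (ball k d)) (by simp) ?_ hKM ?_
      fun k hk s₂ f₂ hk₂ h₂ => ?_).mono ?_ fun _ _ h => h.2
  · simp only [vc, hi₁, Expr.ok_reg, Expr.ok_ofNat, Expr.eval_reg, Expr.eval_ofNat, true_and,
      St.arr_setReg, St.arr_setArr, if_true]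
    refine ⟨by omega, fun d hd => ?_⟩
    rw [Function.update_apply]; split_ifs
    exacts [rfl, h₁ d (by omega)]
  · simp [f₁.reg .K (by decide), hK]
  · intro d hd
    simp [h₁.2 d hd, ball]
  · set a := s₂.arr .BA with ha
    have hm₂ : s₂.reg .m = m := by rw [f₂.reg .m (by decide), f₁.reg .m (by decide), hm]
    have hale : ∀ d < m, a d ≤ m + 1 := fun d hd => by rw [h₂ d hd]; exact min_le_left _ _
    have hwin : ∀ d < m, ∑ j ∈ Finset.Ico (d - k) (d + 1), a j =
        ∑ j ∈ Finset.Ico (d - k) (d + 1), min (m + 1) (ball k j) := fun d hd =>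
      Finset.sum_congr rfl fun j hj => h₂ j (by rw [Finset.mem_Ico] at hj; omega)
    have hwle : ∀ c d, d ≤ m → ∑ j ∈ Finset.Ico c d, a j ≤ d * (m + 1) := by
      intro c d hd
      refine (Finset.sum_le_card_nsmul _ _ (m + 1) fun j hj => hale j ?_).trans ?_
      · rw [Finset.mem_Ico] at hj; omega
      · simpa using Nat.mul_le_mul_right (m + 1) (Nat.sub_le d c)
    refine wp.seq (wp.basic' (Q := fun s' => s'.reg .W = 0) (by decide) (by simp [vc]; omega))
      fun s₃ f₃ h₃ => wp.seq (wp.loop (n := m) (fun d s' =>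
        s'.reg .W = ∑ j ∈ Finset.Ico (d - (k + 1)) d, a j ∧
        ∀ j < d, s'.arr .BB j = min (m + 1) (ball (k + 1) j)) (by simp) ?_ (by omega)
        (by simpa using h₃) fun d hd s₄ f₄ hd₄ h₄ => wp.basic' (by decide) ?_)
      fun s₄ f₄ h₄ => (wp.loop (n := m) (τ := 1) (fun d s' => ∀ j < d, s'.arr .BA j =
        min (m + 1) (ball (k + 1) j)) (by simp) ?_ (by omega) (by simp)
        fun d hd s₅ f₅ hd₅ h₅ => wp.basic' (by decide) ?_).mono le_rfl fun s₅ _ h₅ => ?_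
    · simp [f₃.reg .m (by decide), hm₂]
    · obtain ⟨k1, k2⟩ := h₄
      have hm₄ : s₄.reg .m = m := by rw [f₄.reg .m (by decide), f₃.reg .m (by decide), hm₂]
      have hk₄ : s₄.reg .k = k := by rw [f₄.reg .k (by decide), f₃.reg .k (by decide), hk₂]
      have hBA₄ : s₄.arr .BA = a := by rw [f₄.arr .BA (by decide), f₃.arr .BA (by decide), ha]
      have hbd := hwle (d - (k + 1)) d hd.le
      have hbd' := hwle (d - k) (d + 1) hd
      have had := hale d hd
      have hdm : (d + 1) * (m + 1) ≤ (m + 1) * (m + 1) := Nat.mul_le_mul_right _ (by omega)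
      have hdm' : (d + 1) * (m + 1) = d * (m + 1) + (m + 1) := by ring
      have hball : min (m + 1) (ball (k + 1) d) =
          min (m + 1) (∑ j ∈ Finset.Ico (d - k) (d + 1), a j) := by
        rw [hwin d hd, min_sum_min, ball]
      have hBBs : ∀ v, v = min (m + 1) (ball (k + 1) d) → ∀ j < d + 1,
          Function.update (s₄.arr .BB) d v j = min (m + 1) (ball (k + 1) j) := by
        rintro v rfl j hj
        rw [Function.update_apply]
        split_ifs with h
        · rw [h]
        · exact k2 j (by omega)
      have hstep : ∀ w, w = ∑ j ∈ Finset.Ico (d - k) (d + 1), a j →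
          ((if m < w then 1 else 0) ≠ 0 → (m + 1 < M ∧ (w = ∑ j ∈ Finset.Ico (d - k) (d + 1), a j ∧
            ∀ j < d + 1, Function.update (s₄.arr .BB) d (m + 1) j = min (m + 1) (ball (k + 1) j)))) ∧
          ((if m < w then 1 else 0) = 0 → (w < M ∧ (w = ∑ j ∈ Finset.Ico (d - k) (d + 1), a j ∧
            ∀ j < d + 1, Function.update (s₄.arr .BB) d w j = min (m + 1) (ball (k + 1) j)))) := by
        rintro w rfl
        constructor
        · intro h
          have h' : m < ∑ j ∈ Finset.Ico (d - k) (d + 1), a j := by by_contra hh; simp [hh] at h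
          exact ⟨hmM, rfl, hBBs _ (by rw [hball]; omega)⟩
        · intro h
          have h' : ¬ m < ∑ j ∈ Finset.Ico (d - k) (d + 1), a j := by intro hh; simp [hh] at h
          exact ⟨by omega, rfl, hBBs _ (by rw [hball]; omega)⟩
      have hsucc : d + 1 - (k + 1) = d - k := by omega
      simp only [vc, hd₄, hk₄, hm₄, hBA₄, k1, Expr.ok_reg, Expr.ok_arr, Expr.ok_bin, Expr.ok_add,
        Expr.ok_sub, Expr.ok_ofNat, Expr.eval_reg, Expr.eval_arr, Expr.eval_lt, Expr.eval_add,
        Expr.eval_sub, Expr.eval_ofNat, true_and, St.reg_setReg, St.reg_setArr, St.arr_setReg,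
        St.arr_setArr, reduceCtorEq, if_true, if_false, hsucc]
      -- While d ≤ k the window still begins at 0 and nothing leaves it; afterwards the entry at d -
      -- k - 1 drops out.
      refine ⟨by omega, fun hc => ?_, fun hc => ?_⟩
      · have hc' : k < d := by by_contra hh; simp [hh] at hc
        have e1 : ∑ j ∈ Finset.Ico (d - (k + 1)) d, a j + a d - a (d - k - 1) =
            ∑ j ∈ Finset.Ico (d - k) (d + 1), a j := by
          rw [← Finset.sum_Ico_succ_top (by omega), Finset.sum_eq_sum_Ico_succ_bot (by omega),
            show d - (k + 1) + 1 = d - k by omega, show d - (k + 1) = d - k - 1 by omega,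
            Nat.add_sub_cancel_left]
        exact ⟨by omega, hstep _ e1⟩
      · have hc' : ¬ k < d := by intro hh; simp [hh] at hc
        refine hstep _ ?_
        rw [← Finset.sum_Ico_succ_top (by omega)]
        congr 2; omega
    · simp [f₄.reg .m (by decide), f₃.reg .m (by decide), hm₂]
    · have hBB₅ : s₅.arr .BB = s₄.arr .BB := f₅.arr .BB (by decide)
      have := h₄.2.2 d hd
      simp only [vc, hd₅, hBB₅, this, Expr.ok_reg, Expr.ok_arr, Expr.eval_reg, Expr.eval_arr, true_and,
        St.arr_setReg, St.arr_setArr, if_true]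
      refine ⟨by omega, fun j hj => ?_⟩
      rw [Function.update_apply]
      split_ifs with h
      · rw [h]
      · exact h₅ j (by omega)
    · simpa using h₅.2
  · have : K * (1 + (1 + m * (5 + 1) + (1 + m * (1 + 1))) + 1) = K * (8 * m + 4) := by ring
    omega

end ArrayRam

namespace ArrayRam

variable {M : ℕ} {s s' : St}

/-! ### Parameters of the packed representation -/

open Reg Arr in
/-- The least power of two that is at least `K`. -/
def powerOfTwo : Com :=
  (L ≔ 0 ;; N ≔ 1) ;; .loop i K (.ite (N ≺ K) (N ≔ N * 2 ;; L ≔ L + 1) .skip)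

theorem powerOfTwo_spec {K : ℕ} (hK : s.reg .K = K) (hK0 : 0 < K) (hM : 2 * K < M) :
    wp M powerOfTwo s (4 * K + 3) fun s' =>
      s'.reg .N = 2 ^ s'.reg .L ∧ K ≤ s'.reg .N ∧ s'.reg .N < 2 * K := by
  refine (wp.seq (wp.basic' (T := 2) (Q := fun s' => s'.reg .L = 0 ∧ s'.reg .N = 1) (by decide)
    (by simp [vc]; omega)) fun s₁ f₁ h₁ => wp.loop (n := K) (τ := 3) (fun i s' =>
      s'.reg .N = 2 ^ s'.reg .L ∧ s'.reg .N < 2 * K ∧ (K ≤ s'.reg .N ∨ s'.reg .L = i))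
    (by simp) (by simp [f₁.reg .K (by decide), hK]) (by omega) (by simp [h₁.1, h₁.2]; omega)
    fun i hi s₂ f₂ hi₂ h₂ => wp.basic' (by decide) ?_).mono (by omega) fun s₂ f₂ h₂ => ?_
  · have hK₂ : s₂.reg .K = K := by rw [f₂.reg .K (by decide), f₁.reg .K (by decide), hK]
    obtain ⟨k1, k2, k3⟩ := h₂
    have := Nat.lt_two_pow_self (n := s₂.reg .L)
    simp only [vc, hK₂, Expr.ok_reg, Expr.ok_mul, Expr.ok_add, Expr.ok_bin, Expr.ok_ofNat,
      Expr.eval_reg, Expr.eval_mul, Expr.eval_add, Expr.eval_lt, Expr.eval_ofNat, true_and,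
      St.reg_setReg, reduceCtorEq, if_true, if_false, pow_succ, k1] at *
    refine ⟨fun hc => ?_, fun hc => ?_⟩
    · have hc' : 2 ^ s₂.reg .L < K := by by_contra h; simp [h] at hc
      omega
    · have hc' : ¬ 2 ^ s₂.reg .L < K := by intro h; simp [h] at hc
      omega
  · obtain ⟨-, k1, k2, k3⟩ := h₂
    refine ⟨k1, k3.elim id fun h => ?_, k2⟩
    rw [k1, h]; exact Nat.lt_two_pow_self.le

open Reg Arr in
/-- The largest power of two whose square is at most `L / 2`. -/
def rootOfLog : Com :=
  (gm ≔ 0 ;; g ≔ 1) ;; .loop i L (.ite (8 * g * g ≺ L + 1) (g ≔ g * 2 ;; gm ≔ gm + 1) .skip)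

/-- Doubling g turns 8g² ≤ L into 2(2g)² ≤ L, and stopping means L < 8g². The start g = 1 needs L ≥
2. -/
theorem rootOfLog_spec {L : ℕ} (hL : s.reg .L = L) (hL0 : 2 ≤ L) (hM : 2 * L < M) :
    wp M rootOfLog s (4 * L + 3) fun s' =>
      s'.reg .g = 2 ^ s'.reg .gm ∧ s'.reg .gm ≤ L ∧ 2 * (s'.reg .g * s'.reg .g) ≤ L ∧
        L < 8 * (s'.reg .g * s'.reg .g) := by
  refine (wp.seq (wp.basic' (T := 2) (Q := fun s' => s'.reg .gm = 0 ∧ s'.reg .g = 1) (by decide)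
    (by simp [vc]; omega)) fun s₁ f₁ h₁ => wp.loop (n := L) (τ := 3) (fun i s' =>
      s'.reg .g = 2 ^ s'.reg .gm ∧ s'.reg .gm ≤ i ∧ 2 * (s'.reg .g * s'.reg .g) ≤ L ∧
      (L < 8 * (s'.reg .g * s'.reg .g) ∨ s'.reg .gm = i))
    (by simp) (by simp [f₁.reg .L (by decide), hL]) (by omega) (by simp [h₁.1, h₁.2]; omega)
    fun i hi s₂ f₂ hi₂ h₂ => wp.basic' (by decide) ?_).mono (by omega) fun s₂ f₂ h₂ => ?_
  · have hL₂ : s₂.reg .L = L := by rw [f₂.reg .L (by decide), f₁.reg .L (by decide), hL]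
    obtain ⟨k1, k2, k3, k4⟩ := h₂
    simp only [vc, hL₂, Expr.ok_reg, Expr.ok_mul, Expr.ok_add, Expr.ok_bin, Expr.ok_ofNat,
      Expr.eval_reg, Expr.eval_mul, Expr.eval_add, Expr.eval_lt, Expr.eval_ofNat, true_and,
      St.reg_setReg, reduceCtorEq, if_true, if_false, pow_succ]
    set g := s₂.reg .g
    have e1 : 8 * g * g = 8 * (g * g) := by ring
    have e2 : g * 2 * (g * 2) = 4 * (g * g) := by ring
    have hgg : g ≤ g * g := Nat.le_mul_self g
    rw [e1, e2]
    refine ⟨fun hc => ?_, fun hc => ?_⟩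
    · have hc' : 8 * (g * g) < L + 1 := by by_contra h; simp [h] at hc
      exact ⟨by omega, by omega, by rw [k1], by omega, by omega, by omega⟩
    · have hc' : ¬ 8 * (g * g) < L + 1 := by intro h; simp [h] at hc
      exact ⟨k1, by omega, k3, by omega⟩
  · obtain ⟨-, k1, k2, k3, k4⟩ := h₂
    refine ⟨k1, k2, k3, k4.elim id fun h => ?_⟩
    have := Nat.lt_two_pow_self (n := L)
    have h2 := Nat.le_mul_self (2 ^ L)
    rw [k1, h]; omega

open Reg Arr in
/-- Tabulate the powers of the base. -/
def powers : Com :=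
  D ≔ 1 ;;
  .loop i g (D ≔ D * 2) ;;
  PW⟦0⟧ ⇐ 1 ;;
  .loop i g (PW⟦i + 1⟧ ⇐ PW⟦i⟧ * D) ;;
  DG ≔ PW⟦g⟧

theorem powers_spec {N g : ℕ} (hN : s.reg .N = N) (hg : s.reg .g = g) (hg0 : 0 < g)
    (hM : (2 ^ g) ^ g < M) :
    wp M powers s (4 * g + 5) fun s' => Ctx s' N g (2 ^ g) := by
  have hle : ∀ i ≤ g, (2 ^ g) ^ i < M := fun i hi =>
    (Nat.pow_le_pow_right (Nat.two_pow_pos g) hi).trans_lt hM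
  have hDM : 2 ^ g < M := by simpa using hle 1 hg0
  have hgM : g < M := Nat.lt_two_pow_self.trans hDM
  refine (wp.seq (wp.basic' (T := 1) (Q := fun s' => s'.reg .D = 1) (by decide)
    (by simp [vc]; omega)) fun s₁ f₁ h₁ => wp.seq (wp.loop (n := g) (τ := 1) (fun i s' =>
      s'.reg .D = 2 ^ i) (by simp) (by simp [f₁.reg .g (by decide), hg]) hgM (by simpa using h₁)
    fun i hi s₂ f₂ hi₂ h₂ => wp.basic' (by decide) ?_) fun s₂ f₂ h₂ =>
    wp.seq (wp.basic' (T := 1) (Q := fun s' => s'.arr .PW 0 = 1) (by decide)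
      (by simp [vc]; omega)) fun s₃ f₃ h₃ => wp.seq (wp.loop (n := g) (τ := 1) (fun i s' =>
      ∀ j ≤ i, s'.arr .PW j = (2 ^ g) ^ j) (by simp) ?_ hgM (by simpa using h₃)
      fun i hi s₄ f₄ hi₄ h₄ => wp.basic' (by decide) ?_) fun s₄ f₄ h₄ =>
      wp.basic' (T := 1) (by decide) ?_).mono (by omega) fun _ _ h => h
  · have : 2 ^ (i + 1) ≤ 2 ^ g := Nat.pow_le_pow_right (by omega) hi
    simp [vc, h₂, ← pow_succ]; omega
  · simp [f₃.reg .g (by decide), f₂.reg .g (by decide), f₁.reg .g (by decide), hg]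
  · have hD : s₄.reg .D = 2 ^ g := by rw [f₄.reg .D (by decide), f₃.reg .D (by decide), h₂.2]
    simp only [vc, hi₄, hD, h₄ i le_rfl, Expr.ok_reg, Expr.ok_arr, Expr.ok_mul, Expr.ok_add,
      Expr.ok_ofNat, Expr.eval_reg, Expr.eval_arr, Expr.eval_mul, Expr.eval_add, Expr.eval_ofNat,
      true_and, St.arr_setReg, St.arr_setArr, if_true, ← pow_succ]
    refine ⟨hle _ hi, fun j hj => ?_⟩
    rw [Function.update_apply]
    split_ifs with h
    · rw [h]
    · exact h₄ j (by omega)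
  · have hg₄ : s₄.reg .g = g := by
      rw [f₄.reg .g (by decide), f₃.reg .g (by decide), f₂.reg .g (by decide),
        f₁.reg .g (by decide), hg]
    have hN₄ : s₄.reg .N = N := by
      rw [f₄.reg .N (by decide), f₃.reg .N (by decide), f₂.reg .N (by decide),
        f₁.reg .N (by decide), hN]
    have hD : s₄.reg .D = 2 ^ g := by rw [f₄.reg .D (by decide), f₃.reg .D (by decide), h₂.2]
    simp only [vc, hg₄, h₄.2 g le_rfl, Expr.ok_reg, Expr.ok_arr, Expr.eval_reg, Expr.eval_arr,
      true_and]
    refine ⟨hM, ?_, ?_, ?_, ?_, ?_⟩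
    · simpa using hN₄
    · simpa using hg₄
    · simpa using hD
    · simp
    · simpa using h₄.2

open Reg Arr in
/-- Set all parameters. -/
def params : Com := powerOfTwo ;; rootOfLog ;; powers ;; KK ≔ K * K

/-- With D = 2 ^ g a word takes D ^ g = 2 ^ (g * g) values. Hence 2g² ≤ L gives D ^ g * D ^ g ≤ N,
and g * g ≤ 2 ^ (g * g) gives the bound for the tables. -/
theorem params_spec {K : ℕ} (hK : s.reg .K = K) (hK3 : 3 ≤ K) (hM : 20 * (K * K) < M) :
    wp M params s (40 * K) fun s' => ∃ L N gm g D, Ctx s' N g D ∧ Fits M L N gm g D ∧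
      s'.reg .L = L ∧ s'.reg .gm = gm ∧ s'.reg .KK = K * K ∧ K ≤ N ∧ N < 2 * K ∧
      2 * (g * g) ≤ L := by
  have hKK : 3 * K ≤ K * K := Nat.mul_le_mul_right K hK3
  refine (wp.seq (powerOfTwo_spec hK (by omega) (by omega)) fun s₁ f₁ h₁ => ?_ :
    wp M params s ((4 * K + 3) + (4 * (2 * K) + 3 + (4 * K + 5 + 1))) _).mono (by omega)
    fun _ _ h => h
  obtain ⟨k1, k2, k3⟩ := h₁
  set L := s₁.reg .L with hL
  have hLN : L < s₁.reg .N := by rw [k1]; exact Nat.lt_two_pow_self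
  -- The only use of K ≥ 3 for the parameters beyond arithmetic: a power of two that is at least 3
  -- is at least 4.
  have hL2 : 2 ≤ L := by
    by_contra h
    have : 2 ^ L ≤ 2 ^ 1 := Nat.pow_le_pow_right (by omega) (by omega)
    omega
  refine wp.seq ((rootOfLog_spec hL.symm hL2 (by omega)).mono (by omega) fun _ _ h => h)
    fun s₂ f₂ h₂ => ?_
  obtain ⟨l1, l2, l3, l4⟩ := h₂
  set g := s₂.reg .g with hg
  have hg0 : 0 < g := by rw [l1]; exact Nat.two_pow_pos _
  have hgg : g ≤ g * g := Nat.le_mul_self g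
  have hw : (2 ^ g) ^ g * (2 ^ g) ^ g ≤ s₁.reg .N := by
    rw [k1, ← pow_mul, ← pow_add]; exact Nat.pow_le_pow_right (by omega) (by omega)
  have hsq : g * g * (2 ^ g) ^ g ≤ s₁.reg .N := by
    refine (Nat.mul_le_mul_right _ ?_).trans hw
    rw [← pow_mul]; exact Nat.lt_two_pow_self.le
  have hpos : 0 < (2 ^ g) ^ g := by positivity
  have hwM : (2 ^ g) ^ g < M := by
    have := Nat.le_mul_of_pos_right ((2 ^ g) ^ g) hpos; omega
  have hgK : g ≤ K := by omega
  refine wp.seq ((powers_spec (N := s₁.reg .N) (f₂.reg .N (by decide)) hg.symm hg0 hwM).mono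
    (T' := 4 * K + 5) (by omega) fun _ _ h => h) fun s₃ f₃ h₃ => wp.basic' (by decide) ?_
  have hK₃ : s₃.reg .K = K := by
    rw [f₃.reg .K (by decide), f₂.reg .K (by decide), f₁.reg .K (by decide), hK]
  have hM5 : 5 * s₁.reg .N * s₁.reg .N < M := by
    have := Nat.mul_le_mul k3.le k3.le
    have e1 : 2 * K * (2 * K) = 4 * (K * K) := by ring
    have e2 : 5 * s₁.reg .N * s₁.reg .N = 5 * (s₁.reg .N * s₁.reg .N) := by ring
    omega
  simp only [vc, hK₃, Expr.ok_reg, Expr.ok_mul, Expr.eval_reg, Expr.eval_mul, true_and]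
  refine ⟨by omega, L, _, _, g, _, ?_, ⟨k1, l1, rfl, l2, hsq, hw, l4, hM5⟩, ?_, ?_, ?_, k2, k3, l3⟩
  · obtain ⟨a, b, c, d, e⟩ := h₃
    exact ⟨by simpa using a, by simpa using b, by simpa using c, by simpa using d, by simpa using e⟩
  · simp [f₃.reg .L (by decide), f₂.reg .L (by decide), ← hL]
  · simp [f₃.reg .gm (by decide)]
  · simp

end ArrayRam

namespace ArrayRam

variable {M : ℕ} {s s' : St}

/-! ### Distinct rows -/

section rows
variable (X : ℕ → ℕ → ℕ)

open Classical in
/-- The first row that agrees with row `r` in the columns before `c`. -/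
def rep (c r : ℕ) : ℕ :=
  Nat.find (p := fun t => ∀ e < c, X t e = X r e) ⟨r, fun _ _ => rfl⟩

open Classical in
theorem rep_spec (c r : ℕ) : ∀ e < c, X (rep X c r) e = X r e :=
  Nat.find_spec (p := fun t => ∀ e < c, X t e = X r e) _

open Classical in
theorem rep_le {c r t : ℕ} (h : ∀ e < c, X t e = X r e) : rep X c r ≤ t :=
  Nat.find_min' _ h

theorem rep_le_self (c r : ℕ) : rep X c r ≤ r := rep_le X fun _ _ => rfl

theorem rep_eq_iff {c r t : ℕ} : rep X c r = rep X c t ↔ ∀ e < c, X r e = X t e := by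
  constructor
  · intro h e he
    rw [← rep_spec X c r e he, h, rep_spec X c t e he]
  · intro h
    refine le_antisymm (rep_le X fun e he => ?_) (rep_le X fun e he => ?_)
    · rw [rep_spec X c t e he, h e he]
    · rw [rep_spec X c r e he, h e he]

theorem rep_zero (r : ℕ) : rep X 0 r = 0 := Nat.le_zero.1 (rep_le X (by simp))

theorem rep_rep (c r : ℕ) : rep X c (rep X c r) = rep X c r :=
  (rep_eq_iff X).2 (rep_spec X c r)

/-- The trie edge: a node of depth c + 1 is determined by its parent and the next entry. -/
theorem rep_succ_eq_iff {c r t : ℕ} :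
    rep X (c + 1) r = rep X (c + 1) t ↔ rep X c r = rep X c t ∧ X r c = X t c := by
  rw [rep_eq_iff, rep_eq_iff]
  refine ⟨fun h => ⟨fun e he => h e (by omega), h c (by omega)⟩, fun h e he => ?_⟩
  rcases Nat.lt_succ_iff_lt_or_eq.1 he with he | rfl
  exacts [h.1 e he, h.2]

variable (K : ℕ)

/-- The rows before row `r` that differ from all earlier rows. -/
def firsts (r : ℕ) : List ℕ := (List.range r).filter fun t => rep X K t = t

theorem firsts_succ (r : ℕ) :
    firsts X K (r + 1) = firsts X K r ++ if rep X K r = r then [r] else [] := by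
  simp only [firsts, List.range_succ, List.filter_append, List.filter_cons, List.filter_nil,
    decide_eq_true_eq]

theorem length_firsts_le (r : ℕ) : (firsts X K r).length ≤ r := by
  simpa [firsts] using List.length_filter_le (fun t => decide (rep X K t = t)) (List.range r)

theorem length_firsts_lt {r t : ℕ} (h : r < t) (hr : rep X K r = r) :
    (firsts X K r).length < (firsts X K t).length := by
  induction t, h using Nat.le_induction with
  | base => simp [firsts_succ, hr]
  | succ t _ ih => rw [firsts_succ, List.length_append]; omega

theorem mem_firsts {r t : ℕ} : t ∈ firsts X K r ↔ t < r ∧ rep X K t = t := by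
  simp [firsts]

theorem nodup_firsts (r : ℕ) : (firsts X K r).Nodup := List.nodup_range.filter _

/-- A row that is new receives as its index the number of new rows before it. -/
theorem getElem_firsts {r t : ℕ} (h : r < t) (hr : rep X K r = r) :
    (firsts X K t)[(firsts X K r).length]'(length_firsts_lt X K h hr) = r := by
  induction t, h using Nat.le_induction with
  | base => simp [firsts_succ, hr]
  | succ t h ih =>
    simp only [firsts_succ X K t]
    rw [List.getElem_append_left (length_firsts_lt X K h hr), ih]

theorem length_firsts_getElem {j t : ℕ} (h : j < (firsts X K t).length) :
    (firsts X K ((firsts X K t)[j])).length = j := by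
  have h1 := (mem_firsts X K).1 (List.getElem_mem h)
  exact (List.Nodup.getElem_inj_iff (nodup_firsts X K t)).1 (getElem_firsts X K h1.1 h1.2)

end rows

open Reg Arr in
/-- Walk down the trie along row `i`; the nodes are named by the rows that introduced them. -/
def walk : Com :=
  nm ≔ 0 ;;
  .loop d K (
    x ≔ .inp (2 + i * (K + 1) + d) ;;
    ad ≔ (d * R + nm) * K + x ;;
    .ite (TR⟦ad⟧ ≐ 0) (TR⟦ad⟧ ⇐ i + 1) .skip ;;
    nm ≔ TR⟦ad⟧ - 1)

open Reg Arr in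
/-- List the distinct rows in order of first appearance, and add up their multiplicities. -/
def dedup : Com :=
  (K ≔ .inp 0 ;; R ≔ .inp 1 ;; m ≔ 0) ;;
  .loop i R (
    walk ;;
    .ite (nm ≐ i)
      (.loop d K (COD⟦m * K + d⟧ ⇐ .inp (2 + i * (K + 1) + d)) ;; IDX⟦i⟧ ⇐ m ;; m ≔ m + 1) .skip ;;
    F⟦IDX⟦nm⟧⟧ ⇐ F⟦IDX⟦nm⟧⟧ + .inp (2 + i * (K + 1) + K))

/-- The input consists of the rows `X`, with multiplicities `μ`. -/
structure Rows (inp : List ℕ) (K R : ℕ) (X : ℕ → ℕ → ℕ) (μ : ℕ → ℕ) : Prop where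
  length : inp.length = 2 + R * (K + 1)
  zero : inp.getD 0 0 = K
  one : inp.getD 1 0 = R
  row : ∀ i < R, ∀ c < K, inp.getD (2 + i * (K + 1) + c) 0 = X i c
  mult : ∀ i < R, inp.getD (2 + i * (K + 1) + K) 0 = μ i
  lt : ∀ i < R, ∀ c < K, X i c < K

/-- The trie contains the columns `c` of the rows before `i c`. -/
def Trie (X : ℕ → ℕ → ℕ) (K R : ℕ) (t : ℕ → ℕ) (i : ℕ → ℕ) : Prop :=
  ∀ c < K, ∀ a < R, ∀ d < K,
    (∀ r < i c, rep X c r = a → X r c = d → t ((c * R + a) * K + d) = rep X (c + 1) r + 1) ∧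
    ((∀ r < i c, rep X c r = a → X r c ≠ d) → t ((c * R + a) * K + d) = 0)

theorem mul_add_inj {K a a' d d' : ℕ} (hd : d < K) (hd' : d' < K) (h : a * K + d = a' * K + d') :
    a = a' ∧ d = d' := by
  have h1 : d = d' := by
    have := congrArg (· % K) h
    simpa [Nat.mul_add_mod', Nat.mod_eq_of_lt hd, Nat.mod_eq_of_lt hd'] using this
  subst h1
  exact ⟨Nat.eq_of_mul_eq_mul_right (by omega : 0 < K) (by omega), rfl⟩

theorem Rows.index {inp : List ℕ} {K R : ℕ} {X : ℕ → ℕ → ℕ} {μ : ℕ → ℕ} (h : Rows inp K R X μ)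
    {i c : ℕ} (hi : i < R) (hc : c ≤ K) : 2 + i * (K + 1) + c < inp.length := by
  have := mul_add_lt_mul hi (Nat.lt_succ_of_le hc)
  rw [h.length]; simp only [Nat.succ_eq_add_one] at this; omega

/-- The value 0 marks a missing edge, which is why names of nodes are stored shifted by one. In the
middle of a walk the columns already passed know row i and the others do not; for this `Trie` has a
row bound for each column. -/
theorem walk_spec {K R i : ℕ} {X : ℕ → ℕ → ℕ} {μ : ℕ → ℕ} (hI : Rows s.inp K R X μ)
    (hK : s.reg .K = K) (hR : s.reg .R = R) (hi : s.reg .i = i) (hiR : i < R)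
    (hT : Trie X K R (s.arr .TR) fun _ => i) (hM : (K * R + 1) * K + 1 < M) (hRM : R + 1 < M) :
    wp M walk s (6 * K + 2) fun s' =>
      s'.reg .nm = rep X K i ∧ Trie X K R (s'.arr .TR) fun _ => i + 1 := by
  have hKM : K < M := by
    have := Nat.le_mul_of_pos_left K (Nat.succ_pos (K * R)); simp only [Nat.succ_eq_add_one] at this
    omega
  refine (wp.seq (wp.basic' (T := 1) (Q := fun s' => s'.reg .nm = 0) (by decide)
    (by simp [vc]; omega)) fun s₁ f₁ h₁ => wp.loop (n := K) (τ := 5) (fun c s' =>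
      s'.reg .nm = rep X c i ∧ Trie X K R (s'.arr .TR) fun e => if e < c then i + 1 else i)
    (by simp) (by simp [f₁.reg .K (by decide), hK]) hKM ?_
    fun c hc s₂ f₂ hc₂ h₂ => wp.basic' (by decide) ?_).mono (by omega) fun s₂ f₂ h₂ => ?_
  · refine ⟨by simpa [rep_zero] using h₁, ?_⟩
    simpa [f₁.arr .TR (by decide)] using hT
  · obtain ⟨h1, h2⟩ := h₂
    have hK₂ : s₂.reg .K = K := by rw [f₂.reg .K (by decide), f₁.reg .K (by decide), hK]
    have hR₂ : s₂.reg .R = R := by rw [f₂.reg .R (by decide), f₁.reg .R (by decide), hR]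
    have hi₂ : s₂.reg .i = i := by rw [f₂.reg .i (by decide), f₁.reg .i (by decide), hi]
    have hI₂ : s₂.inp = s.inp := by rw [f₂.inp, f₁.inp]
    have hnm : rep X c i < R := (rep_le_self X c i).trans_lt hiR
    have hx := hI.lt i hiR c hc
    have hb1 : c * R + rep X c i < K * R := mul_add_lt_mul hc hnm
    have hb2 := mul_add_lt_mul hb1 hx
    have hb3 : (K * R + 1) * K = K * R * K + K := by ring
    set T := s₂.arr .TR with hTd
    set A := (c * R + rep X c i) * K + X i c with hA
    have hne : ∀ c' a d, a < R → d < K → (c' * R + a) * K + d = A →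
        c' = c ∧ a = rep X c i ∧ d = X i c := by
      intro c' a d ha hd h
      obtain ⟨h1, h2⟩ := mul_add_inj hd hx h
      obtain ⟨h3, h4⟩ := mul_add_inj ha hnm h1
      exact ⟨h3, h4, h2⟩
    have hcell := h2 c hc _ hnm _ hx
    simp only [lt_irrefl, if_false, ← hA] at hcell
    -- Only the cell A depends on row i in column c, so a correct value there carries the invariant
    -- from column c to c + 1.
    have hupd : ∀ T' : ℕ → ℕ, T' A = rep X (c + 1) i + 1 → (∀ k, k ≠ A → T' k = T k) →
        Trie X K R T' fun e => if e < c + 1 then i + 1 else i := by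
      intro T' e1 e2 c' hc' a ha d hd
      have hold := h2 c' hc' a ha d hd
      rcases lt_trichotomy c' c with hcc | rfl | hcc
      · have hk : (c' * R + a) * K + d ≠ A := fun h => by have := (hne _ _ _ ha hd h).1; omega
        rw [e2 _ hk]
        simpa [hcc, show c' < c + 1 by omega] using hold
      · simp only [lt_irrefl, if_false, Nat.lt_succ_self, if_true] at hold ⊢
        by_cases hk : (c' * R + a) * K + d = A
        · obtain ⟨-, rfl, rfl⟩ := hne _ _ _ ha hd hk
          rw [hk, e1]
          refine ⟨fun r _ h3 h4 => ?_, fun h => absurd rfl (h i (by omega) rfl)⟩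
          rw [(rep_succ_eq_iff X).2 ⟨h3, h4⟩]
        · rw [e2 _ hk]
          have hi' : rep X c' i = a → X i c' ≠ d := fun h3 h4 => hk (by rw [hA, h3, h4])
          refine ⟨fun r hr h3 h4 => hold.1 r ?_ h3 h4, fun h => hold.2 fun r hr => h r (by omega)⟩
          rcases Nat.lt_succ_iff_lt_or_eq.1 hr with hr | rfl
          exacts [hr, absurd h4 (hi' h3)]
      · have hk : (c' * R + a) * K + d ≠ A := fun h => by have := (hne _ _ _ ha hd h).1; omega
        rw [e2 _ hk]
        simpa [show ¬ c' < c by omega, show ¬ c' < c + 1 by omega] using hold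
    have hinp : (s.inp.getD (2 + i * (K + 1) + c) 0) = X i c := hI.row i hiR c hc
    have hlen := hI.index hiR hc.le
    simp only [vc, hc₂, hK₂, hR₂, hi₂, hI₂, h1, hinp, hlen, ← hA, ← hTd, Expr.ok_reg, Expr.ok_arr,
      Expr.ok_inp, Expr.ok_bin, Expr.ok_add, Expr.ok_mul, Expr.ok_sub, Expr.ok_ofNat,
      Expr.eval_reg, Expr.eval_arr, Expr.eval_inp, Expr.eval_add, Expr.eval_mul, Expr.eval_sub,
      Expr.eval_eq, Expr.eval_ofNat, true_and, and_true, St.reg_setReg, St.reg_setArr,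
      St.arr_setReg, St.arr_setArr, St.inp_setReg, reduceCtorEq, if_true, if_false,
      Function.update_self]
    refine ⟨by omega, by omega, fun h => ?_, fun h => ?_⟩
    · have h0 : T A = 0 := by by_contra hh; simp [hh] at h
      -- An earlier row with the same entries would have made the cell nonzero, so row i introduces
      -- this node.
      have hnew : rep X (c + 1) i = i := by
        by_contra hne'
        have hlt : rep X (c + 1) i < i := lt_of_le_of_ne (rep_le_self X _ i) hne'
        have hrr := (rep_succ_eq_iff X).1 (rep_rep X (c + 1) i)
        have := hcell.1 _ hlt hrr.1 hrr.2
        omega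
      refine ⟨by omega, by omega, by omega, hupd _ ?_ fun k hk => ?_⟩
      · simp [hnew]
      · simp [hk]
    · have h0 : T A ≠ 0 := by intro hh; simp [hh] at h
      have hval : T A = rep X (c + 1) i + 1 := by
        by_contra hh
        refine h0 (hcell.2 fun r hr h3 h4 => hh ?_)
        rw [← (rep_succ_eq_iff X).2 ⟨h3, h4⟩]
        exact hcell.1 r hr h3 h4
      have := rep_le_self X (c + 1) i
      exact ⟨by omega, by omega, hupd _ hval fun k _ => rfl⟩
  · obtain ⟨-, h1, h2⟩ := h₂
    refine ⟨h1, fun c hc a ha d hd => ?_⟩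
    have := h2 c hc a ha d hd
    simpa only [hc, if_true] using this

/-- The arrays TR and F must start out zero: clearing the K * R * K cells of the trie would exceed
the linear time bound. -/
theorem dedup_spec {K R : ℕ} {X : ℕ → ℕ → ℕ} {μ : ℕ → ℕ} (hI : Rows s.inp K R X μ)
    (hT : ∀ k, s.arr .TR k = 0) (hF : ∀ k, s.arr .F k = 0)
    (hM : (K * R + 1) * K + 1 < M) (hRM : R + 1 < M) (hK0 : 0 < K)
    (hμ : ∑ t ∈ Finset.range R, μ t < M) :
    wp M dedup s (R * (8 * K + 8) + 4) fun s' =>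
      s'.reg .K = K ∧ s'.reg .R = R ∧ s'.reg .m = (firsts X K R).length ∧
      ∀ (j : ℕ) (hj : j < (firsts X K R).length),
        (∀ c < K, s'.arr .COD (j * K + c) = X ((firsts X K R)[j]) c) ∧
        s'.arr .F j = ∑ t ∈ Finset.range R with rep X K t = (firsts X K R)[j], μ t := by
  have hKM : K < M := by
    have := Nat.le_mul_of_pos_left K (Nat.succ_pos (K * R)); simp only [Nat.succ_eq_add_one] at this
    omega
  have hl2 : 0 < s.inp.length ∧ 1 < s.inp.length := by rw [hI.length]; omega
  refine (wp.seq (wp.basic' (T := 3) (Q := fun s' => s'.reg .K = K ∧ s'.reg .R = R ∧ s'.reg .m = 0)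
    (by decide) ?_) fun s₁ f₁ h₁ => (wp.loop (n := R) (τ := (6 * K + 2) + ((((1 + K * (1 + 1)) + 2) + 1)
      + 1)) (fun i s' => Trie X K R (s'.arr .TR) (fun _ => i) ∧
      s'.reg .m = (firsts X K i).length ∧ (∀ j, (firsts X K i).length ≤ j → s'.arr .F j = 0) ∧
      ∀ r < i, rep X K r = r → s'.arr .IDX r = (firsts X K r).length ∧
        (∀ c < K, s'.arr .COD ((firsts X K r).length * K + c) = X r c) ∧
        s'.arr .F (firsts X K r).length = ∑ t ∈ Finset.range i with rep X K t = r, μ t)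
    (by simp) (by simp [h₁]) (by omega) ?_
    fun i hi s₂ f₂ hi₂ h₂ => ?_).mono le_rfl fun s₂ f₂ h₂ => ?_ :
    wp M dedup s (3 + (1 + R * ((6 * K + 2) + ((((1 + K * (1 + 1)) + 2) + 1) + 1) + 1))) _).mono ?_
    fun _ _ h => h
  · have h0 := hI.zero
    have h1 := hI.one
    simp only [vc, h0, h1, hl2, Expr.ok_inp, Expr.ok_ofNat, Expr.eval_inp, Expr.eval_ofNat, true_and,
      and_true, St.reg_setReg, St.inp_setReg, reduceCtorEq, if_true, if_false]
    omega
  · refine ⟨fun c _ a _ d _ => ?_, ?_, fun j _ => ?_, by simp⟩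
    · simp [f₁.arr .TR (by decide), hT]
    · simp [firsts, h₁]
    · simp [f₁.arr .F (by decide), hF]
  · obtain ⟨k1, k2, k3, k4⟩ := h₂
    have hK₂ : s₂.reg .K = K := by rw [f₂.reg .K (by decide), h₁.1]
    have hR₂ : s₂.reg .R = R := by rw [f₂.reg .R (by decide), h₁.2.1]
    have hI₂ : s₂.inp = s.inp := by rw [f₂.inp, f₁.inp]
    have hmi := length_firsts_le X K i
    have hrep := rep_le_self X K i
    refine wp.seq (walk_spec (hI₂ ▸ hI) hK₂ hR₂ hi₂ hi k1 hM hRM) fun s₃ f₃ h₃ => ?_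
    obtain ⟨l1, l2⟩ := h₃
    have hK₃ : s₃.reg .K = K := by rw [f₃.reg .K (by decide), hK₂]
    have hi₃ : s₃.reg .i = i := by rw [f₃.reg .i (by decide), hi₂]
    have hm₃ : s₃.reg .m = (firsts X K i).length := by rw [f₃.reg .m (by decide), k2]
    have hI₃ : s₃.inp = s.inp := by rw [f₃.inp, hI₂]
    have hC₃ : s₃.arr .COD = s₂.arr .COD := f₃.arr .COD (by decide)
    have hD₃ : s₃.arr .IDX = s₂.arr .IDX := f₃.arr .IDX (by decide)
    have hF₃ : s₃.arr .F = s₂.arr .F := f₃.arr .F (by decide)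
    refine wp.seq (P := fun s' => s'.reg .m = (firsts X K (i + 1)).length ∧
      (∀ r < i + 1, rep X K r = r → s'.arr .IDX r = (firsts X K r).length ∧
        ∀ c < K, s'.arr .COD ((firsts X K r).length * K + c) = X r c))
      (wp.ite (by simp) (fun hc => ?_) fun hc => wp.basic'
        (le_trans (by decide : _ ≤ 1) (by omega)) ?_) fun s₄ f₄ h₄ =>
      wp.basic' (by decide) ?_
    · have hii : rep X K i = i := by
        by_contra h; simp [l1, hi₃, h] at hc
      refine wp.seq (wp.loop (n := K) (fun e s' =>
        (∀ k < (firsts X K i).length * K, s'.arr .COD k = s₂.arr .COD k) ∧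
        ∀ c < e, s'.arr .COD ((firsts X K i).length * K + c) = X i c)
        (by simp) (by simpa using hK₃) hKM ?_
        fun e he s₄ f₄ he₄ h₄ => wp.basic' (by decide) ?_) fun s₄ f₄ h₄ => wp.basic' (by decide) ?_
      · simp [hC₃]
      · have hm₄ : s₄.reg .m = (firsts X K i).length := by rw [f₄.reg .m (by decide), hm₃]
        have hK₄ : s₄.reg .K = K := by rw [f₄.reg .K (by decide), hK₃]
        have hi₄ : s₄.reg .i = i := by rw [f₄.reg .i (by decide), hi₃]
        have hI₄ : s₄.inp = s.inp := by rw [f₄.inp, hI₃]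
        have hinp := hI.row i hi e he
        have hlen := hI.index hi he.le
        have hx := hI.lt i hi e he
        simp only [vc, he₄, hm₄, hK₄, hi₄, hI₄, hinp, hlen, Expr.ok_reg, Expr.ok_inp, Expr.ok_add,
          Expr.ok_mul, Expr.ok_ofNat, Expr.eval_reg, Expr.eval_inp, Expr.eval_add, Expr.eval_mul,
          Expr.eval_ofNat, true_and, and_true, St.arr_setReg, St.arr_setArr, if_true]
        refine ⟨by omega, fun k hk => ?_, fun c hc => ?_⟩
        · rw [Function.update_of_ne (by omega), h₄.1 k hk]
        · rw [Function.update_apply]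
          split_ifs with h
          · congr 1; omega
          · exact h₄.2 c (by omega)
      · have hm₄ : s₄.reg .m = (firsts X K i).length := by rw [f₄.reg .m (by decide), hm₃]
        have hi₄ : s₄.reg .i = i := by rw [f₄.reg .i (by decide), hi₃]
        have hD₄ : s₄.arr .IDX = s₂.arr .IDX := by rw [f₄.arr .IDX (by decide), hD₃]
        simp only [vc, hm₄, hi₄, hD₄, Expr.ok_reg, Expr.ok_add, Expr.ok_ofNat, Expr.eval_reg,
          Expr.eval_add, Expr.eval_ofNat, true_and, St.arr_setReg, St.arr_setArr, St.reg_setReg,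
          St.reg_setArr, if_true, reduceCtorEq, if_false]
        refine ⟨by omega, by omega, by simp [firsts_succ, hii], fun r hr hrr => ?_⟩
        rcases Nat.lt_succ_iff_lt_or_eq.1 hr with hr | rfl
        · refine ⟨by rw [Function.update_of_ne (by omega), (k4 r hr hrr).1], fun c hc => ?_⟩
          rw [h₄.2.1 _ (mul_add_lt_mul (length_firsts_lt X K hr hrr) hc), (k4 r hr hrr).2.1 c hc]
        · exact ⟨by simp, h₄.2.2⟩
    · have hii : rep X K i ≠ i := by
        intro h; simp [l1, hi₃, h] at hc
      simp only [vc, hm₃, hD₃, hC₃]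
      refine ⟨by simp [firsts_succ, hii], fun r hr hrr => ?_⟩
      rcases Nat.lt_succ_iff_lt_or_eq.1 hr with hr | rfl
      · exact ⟨(k4 r hr hrr).1, (k4 r hr hrr).2.1⟩
      · exact absurd hrr hii
    · obtain ⟨j1, j2⟩ := h₄
      have hK₄ : s₄.reg .K = K := by rw [f₄.reg .K (by decide), hK₃]
      have hi₄ : s₄.reg .i = i := by rw [f₄.reg .i (by decide), hi₃]
      have hn₄ : s₄.reg .nm = rep X K i := by rw [f₄.reg .nm (by decide), l1]
      have hI₄ : s₄.inp = s.inp := by rw [f₄.inp, hI₃]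
      have hF₄ : s₄.arr .F = s₂.arr .F := by rw [f₄.arr .F (by decide), hF₃]
      have hT₄ : s₄.arr .TR = s₃.arr .TR := f₄.arr .TR (by decide)
      have hinp := hI.mult i hi
      have hlen := hI.index hi le_rfl
      have hidx := (j2 _ (Nat.lt_succ_of_le hrep) (rep_rep X K i)).1
      have hsum : ∀ r, ∑ t ∈ Finset.range (i + 1) with rep X K t = r, μ t =
          ∑ t ∈ Finset.range i with rep X K t = r, μ t + if rep X K i = r then μ i else 0 := by
        intro r
        rw [Finset.sum_filter, Finset.sum_range_succ, Finset.sum_filter]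
      have hold : ∀ r < i + 1, rep X K r = r → s₂.arr .F (firsts X K r).length =
          ∑ t ∈ Finset.range i with rep X K t = r, μ t := by
        intro r hr hrr
        rcases Nat.lt_succ_iff_lt_or_eq.1 hr with hr | rfl
        · exact (k4 r hr hrr).2.2
        -- For a row that appears for the first time both sides are 0: its cell is untouched, and no
        -- earlier row has this representative.
        · rw [k3 _ le_rfl, Finset.sum_eq_zero]
          intro t ht
          rw [Finset.mem_filter, Finset.mem_range] at ht
          have := rep_le_self X K t; omega
      have hnewF : s₂.arr .F (firsts X K (rep X K i)).length + μ i =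
          ∑ t ∈ Finset.range (i + 1) with rep X K t = rep X K i, μ t := by
        rw [hsum, hold _ (by omega) (rep_rep X K i), if_pos rfl]
      have hlt : (firsts X K (rep X K i)).length < (firsts X K (i + 1)).length :=
        length_firsts_lt X K (by omega) (rep_rep X K i)
      have hbd : ∑ t ∈ Finset.range (i + 1) with rep X K t = rep X K i, μ t < M := by
        refine lt_of_le_of_lt ?_ hμ
        refine Finset.sum_le_sum_of_subset_of_nonneg (fun t ht => ?_) fun _ _ _ => Nat.zero_le _
        rw [Finset.mem_filter, Finset.mem_range] at ht
        rw [Finset.mem_range]; omega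
      simp only [vc, hK₄, hi₄, hn₄, hI₄, hF₄, hT₄, hidx, hinp, hlen, hnewF, Expr.ok_reg, Expr.ok_arr,
        Expr.ok_inp, Expr.ok_add, Expr.ok_mul, Expr.ok_ofNat, Expr.eval_reg, Expr.eval_arr,
        Expr.eval_inp, Expr.eval_add, Expr.eval_mul, Expr.eval_ofNat, true_and, and_true,
        St.arr_setReg, St.arr_setArr, St.reg_setReg, St.reg_setArr, if_true, reduceCtorEq, if_false]
      refine ⟨hbd, l2, j1, fun j hj => ?_, fun r hr hrr => ⟨(j2 r hr hrr).1, (j2 r hr hrr).2, ?_⟩⟩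
      · rw [Function.update_of_ne (by omega), k3]
        rw [firsts_succ, List.length_append] at hj; omega
      · by_cases h : rep X K i = r
        · subst h; rw [Function.update_self]
        · rw [Function.update_of_ne, hold r hr hrr, hsum, if_neg h, add_zero]
          intro hh
          rcases lt_trichotomy r (rep X K i) with h' | h' | h'
          · have := length_firsts_lt X K h' hrr; omega
          · exact h h'.symm
          · have := length_firsts_lt X K h' (rep_rep X K i); omega
  · obtain ⟨-, -, k2, -, k4⟩ := h₂
    refine ⟨by rw [f₂.reg .K (by decide), h₁.1], by rw [f₂.reg .R (by decide), h₁.2.1], k2, fun j hj => ?_⟩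
    have h1 := (mem_firsts X K).1 (List.getElem_mem hj)
    have h2 := length_firsts_getElem X K hj
    have h3 := k4 _ h1.1 h1.2
    rw [h2] at h3
    exact h3.2
  · have : R * (6 * K + 2 + (1 + K * (1 + 1) + 2 + 1 + 1) + 1) = R * (8 * K + 8) := by ring
    omega

end ArrayRam

/-! ### Preferences as permutations -/

namespace Preference

variable {K : ℕ} (p q : Preference K)

theorem rank_lt_rank {a b : Fin K} (h : p.prefers a b) : p.rank a < p.rank b := by
  refine Finset.card_lt_card (Finset.ssubset_iff_of_subset (fun c hc => ?_) |>.2 ⟨a, ?_, ?_⟩)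
  · simp only [Finset.mem_filter, Finset.mem_univ, true_and] at hc ⊢
    exact p.trans _ _ _ hc h
  · simpa using h
  · simpa using p.irrefl a

theorem prefers_iff {a b : Fin K} : p.prefers a b ↔ p.rank a < p.rank b := by
  refine ⟨p.rank_lt_rank, fun h => ?_⟩
  have hab : a ≠ b := by rintro rfl; omega
  refine (p.total a b hab).resolve_right fun h' => ?_
  have := p.rank_lt_rank h'; omega

theorem rank_lt (a : Fin K) : p.rank a < K := by
  classical
  have : p.rank a < (Finset.univ : Finset (Fin K)).card := by
    refine Finset.card_lt_card (Finset.ssubset_iff_of_subset (Finset.subset_univ _) |>.2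
      ⟨a, Finset.mem_univ _, ?_⟩)
    simpa using p.irrefl a
  simpa using this

theorem rank_injective : Function.Injective p.rank := by
  intro a b h
  by_contra hab
  rcases p.total a b hab with h' | h' <;> have := p.rank_lt_rank h' <;> omega

/-- The permutation that maps alternatives to ranks. -/
noncomputable def perm : Equiv.Perm (Fin K) :=
  Equiv.ofBijective (fun a => ⟨p.rank a, p.rank_lt a⟩) <| Finite.injective_iff_bijective.1
    fun _ _ h => p.rank_injective (Fin.mk.inj_iff.1 h)

theorem val_perm (a : Fin K) : (p.perm a : ℕ) = p.rank a := rfl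

/-- The preference with given ranks. -/
def ofPerm (σ : Equiv.Perm (Fin K)) : Preference K where
  prefers a b := σ a < σ b
  irrefl _ := lt_irrefl _
  trans _ _ _ := lt_trans
  total _ _ h := lt_or_gt_of_ne (σ.injective.ne h)

theorem rank_ofPerm (σ : Equiv.Perm (Fin K)) (a : Fin K) : (ofPerm σ).rank a = σ a := by
  classical
  have : (Finset.univ.filter fun b => σ b < σ a).map σ.toEmbedding = Finset.Iio (σ a) := by
    ext b
    simp only [Finset.mem_map_equiv, Finset.mem_filter, Finset.mem_univ, true_and, Finset.mem_Iio,
      Equiv.apply_symm_apply]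
  rw [← Fin.card_Iio, ← this, Finset.card_map, rank]
  refine congrArg Finset.card ?_
  ext b
  rw [Finset.mem_filter, Finset.mem_filter]
  rfl

/-- Preferences correspond to permutations. -/
noncomputable def equivPerm : Preference K ≃ Equiv.Perm (Fin K) where
  toFun := perm
  invFun := ofPerm
  left_inv p := by
    ext a b
    exact p.prefers_iff.symm
  right_inv σ := by
    ext a
    exact rank_ofPerm σ a

noncomputable instance : Fintype (Preference K) := Fintype.ofEquiv _ equivPerm.symm

theorem card : Fintype.card (Preference K) = K.factorial := by
  rw [Fintype.card_congr equivPerm, Fintype.card_perm, Fintype.card_fin]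

theorem perm_injective : Function.Injective (perm (K := K)) := equivPerm.injective

end Preference

/-! ### Inversions -/

/-- The number of inversions. -/
def inversionCount {k n : ℕ} (f : Fin k → Fin n) : ℕ :=
  (Finset.univ.filter fun x : Fin k × Fin k => x.1 < x.2 ∧ f x.2 < f x.1).card

theorem inversionCount_eq_sum {k n : ℕ} (f : Fin k → Fin n) :
    inversionCount f = ∑ i, ∑ j, if i < j ∧ f j < f i then 1 else 0 := by
  rw [inversionCount, Finset.card_filter, Fintype.sum_prod_type]

theorem inversionCount_succ {k n : ℕ} (f : Fin (k + 1) → Fin n) :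
    inversionCount f = (Finset.univ.filter fun j : Fin k => f j.succ < f 0).card +
      inversionCount fun j => f j.succ := by
  rw [inversionCount_eq_sum, inversionCount_eq_sum, Fin.sum_univ_succ, Finset.card_filter,
    Fin.sum_univ_succ]
  refine congrArg₂ _ ?_ (Finset.sum_congr rfl fun i _ => ?_)
  · rw [if_neg (by simp), zero_add]
    simp
  · rw [Fin.sum_univ_succ, if_neg (by simp), zero_add]
    simp

/-- Naming the alternatives by their ranks in p makes the order of p the natural one; the pairs
reversed by q become inversions. -/
theorem invDist_eq {K : ℕ} (p q : Preference K) :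
    invDist p q = inversionCount fun i => q.perm (p.perm.symm i) := by
  classical
  rw [inversionCount, invDist]
  refine Finset.card_equiv (p.perm.prodCongr p.perm) fun x => ?_
  simp [Preference.prefers_iff, ← Preference.val_perm]

theorem invDist_self {K : ℕ} (p : Preference K) : invDist p p = 0 := by
  classical
  simp only [invDist, Finset.card_eq_zero, Finset.filter_eq_empty_iff]
  exact fun x _ h => p.irrefl _ (p.trans _ _ _ h.1 h.2)

/-- Preferences correspond to permutations relative to a given preference. -/
noncomputable def relativeEquiv {K : ℕ} (q : Preference K) : Preference K ≃ Equiv.Perm (Fin K) :=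
  Preference.equivPerm.trans ((Equiv.inv _).trans (Equiv.mulLeft q.perm))

theorem relativeEquiv_apply {K : ℕ} (p q : Preference K) :
    invDist p q = inversionCount (relativeEquiv q p) := invDist_eq p q

theorem sum_mahonian (K d : ℕ) : ∑ j ∈ Finset.range (d + 1), mahonian K j =
    (Finset.univ.filter fun σ : Equiv.Perm (Fin K) => inversionCount σ ≤ d).card := by
  rw [Finset.card_eq_sum_card_fiberwise (f := fun σ : Equiv.Perm (Fin K) => inversionCount σ)
    (t := Finset.range (d + 1))]
  · refine Finset.sum_congr rfl fun j hj => ?_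
    rw [Finset.filter_filter]
    refine congrArg Finset.card (Finset.filter_congr fun σ _ => ?_)
    rw [Finset.mem_range] at hj
    simp only [inversionCount]
    omega
  · intro σ hσ
    simp only [Finset.coe_filter, Finset.mem_univ, true_and, Set.mem_ofPred_eq] at hσ
    simpa using Nat.lt_succ_of_le hσ

-- Balls of equal radius have equal size whatever their centre: mapping p to q.perm * p.perm⁻¹ is a
-- bijection that turns the distance from q into the number of inversions.
open Classical in
theorem sum_mahonian_eq_card {K : ℕ} (q : Preference K) (d : ℕ) :
    ∑ j ∈ Finset.range (d + 1), mahonian K j =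
      (Finset.univ.filter fun p : Preference K => invDist p q ≤ d).card := by
  rw [sum_mahonian]
  refine (Finset.card_equiv (relativeEquiv q) fun p => ?_).symm
  simp [relativeEquiv_apply]

/-- The permutation with first value `v` and the remaining values in the order of `τ`. -/
def consPerm {k : ℕ} (x : Fin (k + 1) × Equiv.Perm (Fin k)) : Equiv.Perm (Fin (k + 1)) :=
  (finSuccEquiv' 0).trans ((Equiv.optionCongr x.2).trans (finSuccEquiv' x.1).symm)

theorem consPerm_zero {k : ℕ} (x : Fin (k + 1) × Equiv.Perm (Fin k)) : consPerm x 0 = x.1 := by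
  simp [consPerm]

theorem consPerm_succ {k : ℕ} (x : Fin (k + 1) × Equiv.Perm (Fin k)) (i : Fin k) :
    consPerm x i.succ = x.1.succAbove (x.2 i) := by
  have : (finSuccEquiv' (0 : Fin (k + 1))) i.succ = some i := by
    rw [← Fin.succAbove_zero_apply]; exact finSuccEquiv'_succAbove 0 i
  simp [consPerm, this]

theorem consPerm_bijective (k : ℕ) : Function.Bijective (consPerm (k := k)) := by
  rw [Fintype.bijective_iff_injective_and_card]
  constructor
  · rintro ⟨v, τ⟩ ⟨v', τ'⟩ h
    have h0 : v = v' := by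
      have := congrArg (· 0) h; simpa [consPerm_zero] using this
    subst h0
    refine Prod.ext rfl (Equiv.ext fun i => ?_)
    have := congrArg (· i.succ) h
    simpa [consPerm_succ] using this
  · simp [Fintype.card_perm, Nat.factorial_succ]

/-- The first value is inverted with exactly the smaller values, all of which come later, and
`succAbove` preserves the order of the remaining ones. -/
theorem inversionCount_consPerm {k : ℕ} (x : Fin (k + 1) × Equiv.Perm (Fin k)) :
    inversionCount (consPerm x) = x.1 + inversionCount x.2 := by
  rw [inversionCount_succ, consPerm_zero]
  simp only [consPerm_succ]
  congr 1
  · have : (Finset.univ.filter fun j => x.1.succAbove (x.2 j) < x.1).map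
        (x.2.toEmbedding.trans x.1.succAboveEmb) = Finset.Iio x.1 := by
      ext b
      simp only [Finset.mem_map, Finset.mem_filter, Finset.mem_univ, true_and, Finset.mem_Iio,
        Function.Embedding.trans_apply, Equiv.coe_toEmbedding]
      constructor
      · rintro ⟨a, h, rfl⟩; exact h
      · intro h
        obtain ⟨c, rfl⟩ := Fin.exists_succAbove_eq h.ne
        exact ⟨x.2.symm c, by simpa using h, by simp⟩
    rw [← Fin.card_Iio, ← this, Finset.card_map]
  · simp only [inversionCount, Fin.succAbove_lt_succAbove_iff]

/-- Inversion numbers have no gaps: either the tail alone can supply j inversions, behind first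
value 0, or the tail is kept and the first value is lowered. -/
theorem exists_inversionCount {k : ℕ} (σ : Equiv.Perm (Fin k)) {j : ℕ} (hj : j ≤ inversionCount σ) :
    ∃ τ : Equiv.Perm (Fin k), inversionCount τ = j := by
  induction k generalizing j with
  | zero =>
    have : inversionCount σ = 0 := by simp [inversionCount]
    exact ⟨σ, by omega⟩
  | succ k ih =>
    obtain ⟨⟨v, τ⟩, rfl⟩ := (consPerm_bijective k).2 σ
    rw [inversionCount_consPerm] at hj
    by_cases h : j ≤ inversionCount τ
    · obtain ⟨τ', h'⟩ := ih τ h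
      exact ⟨consPerm (0, τ'), by simp [inversionCount_consPerm, h']⟩
    · refine ⟨consPerm (⟨j - inversionCount τ, ?_⟩, τ), ?_⟩
      · simp only at hj; omega
      · rw [inversionCount_consPerm]; simp only; omega

/-- All inversion numbers up to d occur, so a ball of radius d has more than d elements. Hence the
counting test fails for every distance d ≥ m, and ball sizes are needed for d < m only. -/
theorem lt_sum_mahonian {K : ℕ} (p q : Preference K) :
    invDist p q < ∑ j ∈ Finset.range (invDist p q + 1), mahonian K j := by
  rw [sum_mahonian, relativeEquiv_apply]
  have h : Finset.range (inversionCount (relativeEquiv q p) + 1) ⊆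
      (Finset.univ.filter fun σ : Equiv.Perm (Fin K) => inversionCount σ ≤
        inversionCount (relativeEquiv q p)).image fun σ : Equiv.Perm (Fin K) => inversionCount σ := by
    intro j hj
    rw [Finset.mem_range, Nat.lt_succ_iff] at hj
    obtain ⟨τ, rfl⟩ := exists_inversionCount _ hj
    exact Finset.mem_image.2 ⟨τ, by simpa using hj, rfl⟩
  have := (Finset.card_le_card h).trans Finset.card_image_le
  rw [Finset.card_range] at this
  omega

/-- Sort the permutations by their first value v, which accounts for v inversions and leaves d - v
for the rest. -/
theorem ball_eq_card (k d : ℕ) : ArrayRam.ball k d =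
    (Finset.univ.filter fun σ : Equiv.Perm (Fin k) => inversionCount σ ≤ d).card := by
  induction k generalizing d with
  | zero => simp [ArrayRam.ball, inversionCount]
  | succ k ih =>
    rw [← Finset.card_equiv (Equiv.ofBijective _ (consPerm_bijective k))
      (s := Finset.univ.filter fun x => (x.1 : ℕ) + inversionCount x.2 ≤ d)
      (fun x => by simp [inversionCount_consPerm])]
    rw [Finset.card_filter, Fintype.sum_prod_type, Fin.sum_univ_eq_sum_range (fun v =>
      ∑ τ : Equiv.Perm (Fin k), if v + inversionCount τ ≤ d then 1 else 0)]
    simp only [ArrayRam.ball, ih, ← Finset.card_filter]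
    have hz : ∀ v ∈ Finset.range (k + 1), v ∉ Finset.range (min k d + 1) →
        (Finset.univ.filter fun τ : Equiv.Perm (Fin k) => v + inversionCount τ ≤ d).card = 0 := by
      intro v h1 h2
      rw [Finset.mem_range] at h1 h2
      rw [Finset.card_eq_zero, Finset.filter_eq_empty_iff]
      intro τ _; omega
    rw [← Finset.sum_subset (Finset.range_subset_range.2 (by omega)) hz]
    symm
    refine Finset.sum_bij' (fun v _ => d - v) (fun j _ => d - j) ?_ ?_ ?_ ?_ ?_
    · intro v hv; rw [Finset.mem_range] at hv; rw [Finset.mem_Ico]; omega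
    · intro v hv; rw [Finset.mem_Ico] at hv; rw [Finset.mem_range]; omega
    · intro v hv; rw [Finset.mem_range] at hv; omega
    · intro v hv; rw [Finset.mem_Ico] at hv; omega
    · intro v hv
      rw [Finset.mem_range] at hv
      refine congrArg Finset.card (Finset.filter_congr fun τ _ => ?_)
      omega

theorem sum_mahonian_eq_ball (K d : ℕ) :
    ∑ j ∈ Finset.range (d + 1), mahonian K j = ArrayRam.ball K d := by
  rw [sum_mahonian, ball_eq_card]

/-! ### Correctness of the algorithm -/

section correctness

variable {K n : ℕ} {π : Profile K n} {c : Preference K} {l : List (Preference K)}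

theorem freq_pos_iff {p : Preference K} : 0 < freq π p ↔ ∃ i, π i = p := by
  classical
  rw [freq, Finset.card_pos]
  simp [Finset.Nonempty]

theorem IsLexOrder.mem_iff (h : IsLexOrder π c l) {p : Preference K} : p ∈ l ↔ 0 < freq π p :=
  (h.2.1 p).trans freq_pos_iff.symm

theorem IsFreqOrder.mem_iff (h : IsFreqOrder π l) {p : Preference K} : p ∈ l ↔ 0 < freq π p :=
  (h.2.1 p).trans freq_pos_iff.symm

theorem IsLexOrder.perm (h : IsLexOrder π c l) {l' : List (Preference K)} (h' : IsFreqOrder π l') :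
    l.Perm l' :=
  (List.perm_ext_iff_of_nodup h.1 h'.1).2 fun p => by rw [h.mem_iff, h'.mem_iff]

/-- Two preferences in lexicographic order. -/
def LexLE (π : Profile K n) (c p q : Preference K) : Prop :=
  freq π q < freq π p ∨ (freq π p = freq π q ∧ invDist p c ≤ invDist q c)

/-- The lexicographic order is needed only to pass from adjacent pairs to all pairs; the converse
specializes the condition to adjacent pairs. -/
theorem scan_iff (h : l.Pairwise (LexLE π c)) :
    scan π c l ↔ ∀ p ∈ l, ∀ q ∈ l, freq π q < freq π p → invDist p c < invDist q c := by
  constructor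
  · intro hs
    -- The conjunction is transitive, whereas its second part alone is not: a later preference of
    -- equal frequency might be closer again. Within equal frequencies the third part comes from the
    -- lexicographic order.
    have : l.Pairwise fun p q => freq π q ≤ freq π p ∧
        (freq π q < freq π p → invDist p c < invDist q c) ∧ invDist p c ≤ invDist q c := by
      induction l with
      | nil => exact List.Pairwise.nil
      | cons p l ih =>
        have ih' := fun hs => ih (List.pairwise_cons.1 h).2 hs
        cases l with
        | nil => simp
        | cons q l =>
          simp only [scan, not_and, not_le] at hs
          have ih' := ih' hs.2
          have hpq := (List.pairwise_cons.1 h).1 q (by simp)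
          have hpq' : freq π q ≤ freq π p ∧
            (freq π q < freq π p → invDist p c < invDist q c) ∧ invDist p c ≤ invDist q c := by
            rcases hpq with hpq | hpq
            · have := hs.1 hpq; omega
            · omega
          refine List.pairwise_cons.2 ⟨fun r hr => ?_, ih'⟩
          rcases List.mem_cons.1 hr with rfl | hr
          · exact hpq'
          · have := (List.pairwise_cons.1 ih').1 r hr
            omega
    intro p hp q hq hlt
    rw [List.pairwise_iff_getElem] at this
    obtain ⟨i, hi, rfl⟩ := List.getElem_of_mem hp
    obtain ⟨j, hj, rfl⟩ := List.getElem_of_mem hq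
    rcases lt_trichotomy i j with hij | rfl | hij
    · exact (this i j hi hj hij).2.1 hlt
    · omega
    · have := this j i hj hi hij; omega
  · intro hd
    clear h
    induction l with
    | nil => trivial
    | cons p l ih =>
      have ih' := ih fun p hp q hq => hd p (by simp [hp]) q (by simp [hq])
      cases l with
      | nil => trivial
      | cons q l =>
        refine ⟨fun h => ?_, ih'⟩
        have := hd p (by simp) q (by simp) h.1; omega

theorem getLast_max (h : l.Pairwise (LexLE π c)) {p : Preference K} (hp : p ∈ l.getLast?)
    {q : Preference K} (hq : q ∈ l) : q = p ∨ LexLE π c q p := by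
  obtain ⟨l', rfl⟩ : ∃ l', l = l' ++ [p] := by
    rw [Option.mem_def, List.getLast?_eq_some_iff] at hp
    obtain ⟨l', h⟩ := hp; exact ⟨l', h⟩
  rw [List.pairwise_append] at h
  rcases List.mem_append.1 hq with hq | hq
  · exact Or.inr (h.2.2 q hq p (by simp))
  · exact Or.inl (by simpa using hq)

theorem levelOneConsensus_of_subroutine (h : IsLexOrder π c l) (hs : subroutine π c l)
    (hne : ¬ ((∀ p ∈ l, ∀ q ∈ l, freq π p = freq π q) ∧ l.length = K.factorial)) :
    LevelOneConsensus π c := by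
  classical
  obtain ⟨hscan, p, hp, hcount⟩ := hs
  have hpw : l.Pairwise (LexLE π c) := h.2.2
  rw [scan_iff hpw] at hscan
  have hpl : p ∈ l := List.mem_of_getLast? hp
  have hmax : ∀ q ∈ l, invDist q c ≤ invDist p c := by
    intro q hq
    rcases getLast_max hpw hp hq with rfl | hlt | ⟨-, hle⟩
    · exact le_rfl
    · exact (hscan q hq p hpl hlt).le
    · exact hle
  -- The listed preferences lie in the ball and, by the counting test, are as many as its elements.
  have hball : l.toFinset = Finset.univ.filter fun q : Preference K => invDist q c ≤ invDist p c := by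
    refine Finset.eq_of_subset_of_card_le (fun q hq => ?_) ?_
    · simpa using hmax q (List.mem_toFinset.1 hq)
    · rw [← sum_mahonian_eq_card, hcount, List.toFinset_card_of_nodup h.1]
  have hmem : ∀ q, q ∈ l ↔ invDist q c ≤ invDist p c := fun q => by
    rw [← List.mem_toFinset, hball]; simp
  have hzero : ∀ q, invDist p c < invDist q c → freq π q = 0 := fun q hq => by
    by_contra h0
    have := (hmem q).1 (h.mem_iff.2 (Nat.pos_of_ne_zero h0)); omega
  refine ⟨fun a b hab => ?_, ?_⟩
  · by_contra hlt
    rw [not_le] at hlt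
    have hb : b ∈ l := h.mem_iff.2 (by omega)
    have ha : a ∈ l := (hmem a).2 (hab.trans ((hmem b).1 hb))
    have := hscan b hb a ha hlt; omega
  -- A preference outside the ball has frequency 0 and proves condition (2) together with p. If
  -- there is none, all K! preferences occur, and the excluded initial case supplies two different
  -- frequencies.
  · by_cases hall : ∃ q, invDist p c < invDist q c
    · obtain ⟨q, hq⟩ := hall
      exact ⟨p, q, hq, by rw [hzero q hq]; exact h.mem_iff.1 hpl⟩
    · push Not at hall
      have hlen : l.length = K.factorial := by
        rw [← List.toFinset_card_of_nodup h.1, hball, Finset.filter_true_of_mem fun q _ => hall q,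
          Finset.card_univ, Preference.card]
      have : ¬ ∀ p ∈ l, ∀ q ∈ l, freq π p = freq π q := fun h' => hne ⟨h', hlen⟩
      push Not at this
      obtain ⟨a, ha, b, hb, hab⟩ := this
      rcases lt_or_gt_of_ne hab with hab | hab
      · exact ⟨b, a, hscan b hb a ha hab, hab⟩
      · exact ⟨a, b, hscan a ha b hb hab, hab⟩

theorem subroutine_of_levelOneConsensus (h : IsLexOrder π c l) (hc : LevelOneConsensus π c) :
    subroutine π c l := by
  classical
  obtain ⟨h1, p₀, q₀, -, hlt₀⟩ := hc
  have hpw : l.Pairwise (LexLE π c) := h.2.2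
  -- The contrapositive of condition (1). It gives the scan, and condition (1) itself gives that the
  -- occurring preferences are closed under decreasing distance, hence form a ball.
  have hd : ∀ p q, freq π q < freq π p → invDist p c < invDist q c := fun p q hlt => by
    by_contra hh
    have := h1 q p (not_lt.1 hh); omega
  refine ⟨(scan_iff hpw).2 fun p _ q _ => hd p q, ?_⟩
  have hl : l ≠ [] := by
    rintro rfl
    have := h.mem_iff (p := p₀); simp at this; omega
  set p := l.getLast hl with hp
  have hpm : p ∈ l.getLast? := by simp [hp, List.getLast?_eq_some_getLast hl]
  have hpl : p ∈ l := List.getLast_mem hl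
  refine ⟨p, hpm, ?_⟩
  rw [sum_mahonian_eq_card c, ← List.toFinset_card_of_nodup h.1]
  congr 1
  ext q
  simp only [Finset.mem_filter, Finset.mem_univ, true_and, List.mem_toFinset]
  constructor
  · intro hq
    have := h1 q p hq
    exact h.mem_iff.2 ((h.mem_iff.1 hpl).trans_le this)
  · intro hq
    rcases getLast_max hpw hpm hq with rfl | hlt | ⟨-, hle⟩
    · exact le_rfl
    · exact (hd _ _ hlt).le
    · exact hle

theorem tryCandidates_some {lex : Preference K → List (Preference K)} {cs : List (Preference K)}
    {p : Preference K} (h : (tryCandidates π lex cs).1 = some p) :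
    p ∈ cs ∧ subroutine π p (lex p) := by
  induction cs with
  | nil => simp [tryCandidates] at h
  | cons c cs ih =>
    rw [tryCandidates] at h
    split_ifs at h with hc
    · simp only [Option.some.injEq] at h
      subst h; exact ⟨by simp, hc⟩
    · have := ih h; exact ⟨by simp [this.1], this.2⟩

theorem tryCandidates_none {lex : Preference K → List (Preference K)} {cs : List (Preference K)}
    (h : (tryCandidates π lex cs).1 = none) : ∀ p ∈ cs, ¬ subroutine π p (lex p) := by
  induction cs with
  | nil => simp
  | cons c cs ih =>
    rw [tryCandidates] at h
    split_ifs at h with hc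
    exact List.forall_mem_cons.2 ⟨hc, ih h⟩

/-- In descending order the leading elements of maximal value are all elements of maximal value. -/
theorem takeWhile_eq_filter {α : Type*} {f : α → ℕ} {l : List α} {v : ℕ}
    (h : l.Pairwise fun p q => f q ≤ f p) (hv : ∀ p ∈ l, f p ≤ v) :
    l.takeWhile (fun p => decide (f p = v)) = l.filter fun p => decide (f p = v) := by
  induction l with
  | nil => rfl
  | cons p l ih =>
    rw [List.pairwise_cons] at h
    by_cases hp : f p = v
    · simp [hp, ih h.2 fun q hq => hv q (by simp [hq])]
    · have : ∀ q ∈ l, ¬ f q = v := fun q hq => by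
        have := h.1 q hq; have := hv p (by simp); omega
      simpa [hp] using this

theorem le_headD {α : Type*} {f : α → ℕ} {l : List α} (h : l.Pairwise fun p q => f q ≤ f p) :
    ∀ p ∈ l, f p ≤ (l.map f).headD 0 := by
  cases l with
  | nil => simp
  | cons p l => simpa using (List.pairwise_cons.1 h).1

theorem detect_correct {lex : Preference K → List (Preference K)} (hl : IsFreqOrder π l)
    (hlex : ∀ c, IsLexOrder π c (lex c)) :
    (∀ p, (detect π l lex).1 = some p → LevelOneConsensus π p) ∧
      ((detect π l lex).1 = none ↔ ¬ ∃ p, LevelOneConsensus π p) := by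
  classical
  have h1 : ∀ p, (detect π l lex).1 = some p → LevelOneConsensus π p := by
    intro p hp
    rw [detect] at hp
    split_ifs at hp with h
    obtain ⟨-, hs⟩ := tryCandidates_some hp
    refine levelOneConsensus_of_subroutine (hlex p) hs ?_
    have := (hlex p).perm hl
    simpa only [this.mem_iff, this.length_eq] using h
  refine ⟨h1, fun h => ?_, fun h => ?_⟩
  · rintro ⟨p, hp⟩
    have hs := subroutine_of_levelOneConsensus (hlex p) hp
    obtain ⟨hp1, a, b, -, hab⟩ := hp
    -- No preference is closer to p than p itself, so the centre of a consensus has maximal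
    -- frequency and is tried.
    have hmax : ∀ q, freq π q ≤ freq π p := fun q => hp1 p q (by rw [invDist_self]; omega)
    have hpl : p ∈ l := hl.mem_iff.2 (by have := hmax a; omega)
    rw [detect] at h
    split_ifs at h with h0
    -- When all K! preferences occur equally often, condition (2) is violated, so the early answer
    -- cannot be wrong.
    · have hall : ∀ q, q ∈ l := by
        have : l.toFinset = Finset.univ := by
          rw [← Finset.card_eq_iff_eq_univ, List.toFinset_card_of_nodup hl.1, h0.2, Preference.card]
        intro q; rw [← List.mem_toFinset, this]; exact Finset.mem_univ _
      have := h0.1 a (hall a) b (hall b); omega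
    · refine tryCandidates_none h p ?_ hs
      rw [takeWhile_eq_filter hl.2.2 (le_headD hl.2.2), List.mem_filter, decide_eq_true_eq]
      refine ⟨hpl, le_antisymm (le_headD hl.2.2 p hpl) ?_⟩
      cases l with
      | nil => simp
      | cons q l => simpa using hmax q
  · cases hd : (detect π l lex).1 with
    | none => rfl
    | some p => exact absurd ⟨p, h1 p hd⟩ h

end correctness

/-! ### Inversions of sequences -/

theorem ofFn_val (K : ℕ) : List.ofFn (fun i : Fin K => (i : ℕ)) = List.range K :=
  List.ext_getElem (by simp) fun i _ _ => by simp

theorem countP_ofFn {k : ℕ} (f : Fin k → ℕ) (x : ℕ) :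
    (List.ofFn f).countP (fun y => y < x) = (Finset.univ.filter fun j => f j < x).card := by
  induction k with
  | zero => simp
  | succ k ih =>
    rw [List.ofFn_succ, List.countP_cons, ih, Finset.card_filter, Finset.card_filter,
      Fin.sum_univ_succ, add_comm]
    simp

theorem invL_ofFn {k n : ℕ} (f : Fin k → Fin n) :
    invL (List.ofFn fun i => (f i : ℕ)) = inversionCount f := by
  induction k with
  | zero => simp [invL, inversionCount]
  | succ k ih =>
    rw [List.ofFn_succ, invL, ih, inversionCount_succ, countP_ofFn]
    simp

/-- Padding a permutation to length N by larger increasing values creates no inversions. -/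
theorem invL_append_range {l : List ℕ} {K : ℕ} (hl : ∀ x ∈ l, x < K) (r : ℕ) :
    invL (l ++ (List.range r).map (K + ·)) = invL l := by
  induction r with
  | zero => simp
  | succ r ih =>
    rw [List.range_succ, List.map_append, ← List.append_assoc, List.map_singleton,
      invL_concat, ih, List.countP_eq_zero.2, add_zero]
    intro x hx
    rw [List.mem_append, List.mem_map] at hx
    rcases hx with hx | ⟨y, hy, rfl⟩
    · have := hl x hx; simp; omega
    · rw [List.mem_range] at hy; simp; omega

theorem ofFn_perm {K : ℕ} (σ : Equiv.Perm (Fin K)) :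
    (List.ofFn fun i => (σ i : ℕ)).Perm (List.range K) := by
  rw [← ofFn_val]; exact σ.ofFn_comp_perm fun i => (i : ℕ)

/-! ### Sort keys -/

section keys

open ArrayRam

variable {K n : ℕ} {π : Profile K n} {c p q : Preference K} {l D : List (Preference K)}

/-- The diagonal is never counted. The strict bound makes the distance a digit in base K * K, so
that it can be read off a sort key. -/
theorem invDist_lt (hK : 0 < K) (p q : Preference K) : invDist p q < K * K := by
  classical
  have : invDist p q < (Finset.univ : Finset (Fin K × Fin K)).card := by
    refine Finset.card_lt_card (Finset.ssubset_iff_of_subset (Finset.subset_univ _) |>.2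
      ⟨(⟨0, hK⟩, ⟨0, hK⟩), Finset.mem_univ _, ?_⟩)
    simpa using fun h => absurd h (p.irrefl _)
  simpa using this

/-- The rank of a preference by frequency among the preferences in `D`. -/
noncomputable def freqRank (π : Profile K n) (D : List (Preference K)) (p : Preference K) : ℕ :=
  rankIn (D.map (freq π)) (freq π p)

theorem freqRank_lt_iff (hp : p ∈ D) (hq : q ∈ D) :
    freqRank π D q < freqRank π D p ↔ freq π p < freq π q :=
  rankIn_lt_iff (List.mem_map_of_mem hp) (List.mem_map_of_mem hq)

theorem freqRank_lt_length (hp : p ∈ D) : freqRank π D p < D.length := by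
  have : freqRank π D p < (D.map (freq π)).length := by
    rw [freqRank, rankIn]
    refine lt_of_le_of_ne List.countP_le_length fun h => ?_
    have := List.countP_eq_length.1 h _ (List.mem_map_of_mem hp)
    simp at this
  simpa using this

theorem freqRank_eq_zero_iff : freqRank π D p = 0 ↔ ∀ q ∈ D, freq π q ≤ freq π p := by
  rw [freqRank, rankIn, List.countP_eq_zero]
  simp

/-- The sort key of `p` for the candidate `c`. -/
noncomputable def sortKey (π : Profile K n) (D : List (Preference K)) (c p : Preference K) : ℕ :=
  freqRank π D p * (K * K) + invDist p c

theorem sortKey_div (hK : 0 < K) (p : Preference K) :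
    sortKey π D c p / (K * K) = freqRank π D p := by
  rw [sortKey, mul_comm, Nat.mul_add_div (by positivity), Nat.div_eq_of_lt (invDist_lt hK p c),
    add_zero]

theorem sortKey_mod (hK : 0 < K) (p : Preference K) :
    sortKey π D c p % (K * K) = invDist p c := by
  rw [sortKey, Nat.mul_add_mod', Nat.mod_eq_of_lt (invDist_lt hK p c)]

theorem sortKey_lt (hK : 0 < K) (hp : p ∈ D) : sortKey π D c p < D.length * (K * K) :=
  mul_add_lt_mul (freqRank_lt_length hp) (invDist_lt hK p c)

theorem sortKey_le_iff (hK : 0 < K) (hp : p ∈ D) (hq : q ∈ D) :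
    sortKey π D c p ≤ sortKey π D c q ↔ LexLE π c p q := by
  have h1 := freqRank_lt_iff (π := π) hq hp
  have h2 := freqRank_lt_iff (π := π) hp hq
  have d1 := invDist_lt hK p c
  have d2 := invDist_lt hK q c
  rw [LexLE, sortKey, sortKey]
  rcases lt_trichotomy (freqRank π D p) (freqRank π D q) with h | h | h
  · have := mul_add_lt_mul h d1
    exact ⟨fun _ => Or.inl (h1.1 h), fun _ => by omega⟩
  · rw [h]; omega
  · have := mul_add_lt_mul h d2
    omega

theorem IsLexOrder.perm_of_mem (h : IsLexOrder π c l) (hD : D.Nodup)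
    (hm : ∀ p, p ∈ D ↔ ∃ i, π i = p) : l.Perm D :=
  (List.perm_ext_iff_of_nodup h.1 hD).2 fun p => by rw [h.2.1, hm]

/-- A sorted arrangement of numbers is unique. However ties between preferences are broken, the keys
appear in the same order, and the machine never needs to know which preference a key belongs to. -/
theorem eq_map_sortKey (hK : 0 < K) (h : IsLexOrder π c l) (hD : D.Nodup)
    (hm : ∀ p, p ∈ D ↔ ∃ i, π i = p) {L : List ℕ} (hL : L.Perm (D.map (sortKey π D c)))
    (hs : L.Pairwise (· ≤ ·)) : L = l.map (sortKey π D c) := by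
  have hp := h.perm_of_mem hD hm
  refine List.Perm.eq_of_pairwise (fun a b _ _ => le_antisymm) hs ?_ (hL.trans (hp.symm.map _))
  rw [List.pairwise_map]
  exact h.2.2.imp_of_mem fun ha hb hab =>
    (sortKey_le_iff hK (hp.subset ha) (hp.subset hb)).2 hab

theorem eq_map_freqRank (h : IsFreqOrder π l) (hD : D.Nodup)
    (hm : ∀ p, p ∈ D ↔ ∃ i, π i = p) {L : List ℕ} (r : ℕ)
    (hL : L.Perm (D.map fun p => freqRank π D p * r))
    (hs : L.Pairwise (· ≤ ·)) : L = l.map fun p => freqRank π D p * r := by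
  have hp : l.Perm D := (List.perm_ext_iff_of_nodup h.1 hD).2 fun p => by rw [h.2.1, hm]
  refine List.Perm.eq_of_pairwise (fun a b _ _ => le_antisymm) hs ?_ (hL.trans (hp.symm.map _))
  rw [List.pairwise_map]
  refine h.2.2.imp_of_mem fun {a b} ha hb hab => Nat.mul_le_mul_right _ ?_
  rw [← not_lt, freqRank_lt_iff (hp.subset ha) (hp.subset hb)]
  omega

theorem exists_lexOrder (hK : 0 < K) (hD : D.Nodup) (hm : ∀ p, p ∈ D ↔ ∃ i, π i = p) :
    ∃ lex : Preference K → List (Preference K), ∀ c, IsLexOrder π c (lex c) := by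
  refine ⟨fun c => D.mergeSort fun p q => decide (sortKey π D c p ≤ sortKey π D c q), fun c => ?_⟩
  have hp := List.mergeSort_perm D fun p q => decide (sortKey π D c p ≤ sortKey π D c q)
  refine ⟨hp.nodup_iff.2 hD, fun p => by rw [hp.mem_iff, hm], ?_⟩
  refine (List.pairwise_mergeSort ?_ ?_ D).imp_of_mem fun ha hb hab => ?_
  · simp only [decide_eq_true_eq]; omega
  · simp only [Bool.or_eq_true, decide_eq_true_eq]; omega
  · exact (sortKey_le_iff hK (hp.subset ha) (hp.subset hb)).1 (by simpa using hab)

/-- The program tries the candidates in their order in D. Putting exactly these in front, and the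
rest sorted behind them, gives an admissible order whose leading stretch is the program's list of
candidates. -/
theorem exists_freqOrder (hD : D.Nodup) (hm : ∀ p, p ∈ D ↔ ∃ i, π i = p) :
    ∃ l, IsFreqOrder π l ∧ (l.takeWhile fun p => decide (freq π p = (l.map (freq π)).headD 0)) =
      D.filter fun p => decide (freqRank π D p = 0) := by
  set B := (D.filter fun p => !decide (freqRank π D p = 0)).mergeSort
    fun p q => decide (freq π q ≤ freq π p) with hB
  have hBp : B.Perm (D.filter fun p => !decide (freqRank π D p = 0)) := List.mergeSort_perm _ _
  set A := D.filter fun p => decide (freqRank π D p = 0) with hA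
  have hp : (A ++ B).Perm D := (hBp.append_left A).trans (List.filter_append_perm _ D)
  have hAm : ∀ p ∈ A, ∀ q ∈ D, freq π q ≤ freq π p := fun p h => by
    rw [hA, List.mem_filter, decide_eq_true_eq, freqRank_eq_zero_iff] at h; exact h.2
  have hl : IsFreqOrder π (A ++ B) := by
    refine ⟨hp.nodup_iff.2 hD, fun p => by rw [hp.mem_iff, hm], ?_⟩
    refine List.pairwise_append.2 ⟨?_, ?_, fun p h q h' => ?_⟩
    · exact List.pairwise_of_forall_mem_list fun p h q h' => hAm p h q (List.mem_of_mem_filter h')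
    · refine (List.pairwise_mergeSort ?_ ?_ _).imp fun hab => by simpa using hab
      · simp only [decide_eq_true_eq]; omega
      · simp only [Bool.or_eq_true, decide_eq_true_eq]; omega
    · exact hAm p h q (hp.subset (List.mem_append_right _ h'))
  refine ⟨A ++ B, hl, ?_⟩
  rw [takeWhile_eq_filter hl.2.2 (le_headD hl.2.2)]
  have hcong : ∀ p ∈ A ++ B, decide (freq π p = ((A ++ B).map (freq π)).headD 0) =
      decide (freqRank π D p = 0) := by
    intro p hpm
    rw [decide_eq_decide, freqRank_eq_zero_iff]
    constructor
    · intro h q hq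
      rw [h]; exact le_headD hl.2.2 q (hp.symm.subset hq)
    · intro h
      refine le_antisymm (le_headD hl.2.2 p hpm) ?_
      cases hAB : A ++ B with
      | nil => simp
      | cons q l' => simpa using h q (hp.subset (by rw [hAB]; simp))
  rw [List.filter_congr hcong, List.filter_append, List.filter_eq_self.2, List.filter_eq_nil_iff.2,
    List.append_nil]
  · intro p h
    have := (List.mem_filter.1 (hBp.subset h)).2
    simpa using this
  · intro p h
    rw [hA, List.mem_filter] at h; exact h.2

theorem scan_iff_getElem : scan π c l ↔ ∀ (i : ℕ) (h : i + 1 < l.length),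
    ¬ (freq π l[i + 1] < freq π l[i] ∧ invDist l[i + 1] c ≤ invDist l[i] c) := by
  induction l with
  | nil => simp [scan]
  | cons p l ih =>
    cases l with
    | nil => simp [scan]
    | cons q l =>
      rw [scan, ih]
      constructor
      · rintro ⟨h1, h2⟩ i hi
        cases i with
        | zero => exact h1
        | succ i => exact h2 i (by simpa using hi)
      · intro h
        exact ⟨h 0 (by simp), fun i hi => h (i + 1) (by simpa using hi)⟩

end keys

namespace ArrayRam

variable {M : ℕ} {s s' : St}

/-! ### The subroutine -/

open Reg Arr in
/-- Emit preference number `r`. -/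
def emitPref (r : Reg) : Com := .loop a K (.emit (COD⟦r * K + a⟧))

open Reg Arr in
/-- Set `X` to the sequence whose inversions are the pairs that preferences `y` and `ci` rank
differently. -/
def relabel : Com :=
  .loop a K (X⟦COD⟦y * K + a⟧⟧ ⇐ COD⟦ci * K + a⟧) ;; .loop a (N - K) (X⟦K + a⟧ ⇐ K + a)

open Reg Arr in
/-- Compute all sort keys for candidate `ci`. -/
def distances : Com :=
  .loop y m (relabel ;; inversions ;; KEY⟦y⟧ ⇐ RK⟦y⟧ * KK + res)

open Reg Arr in
/-- Emit the frequencies and distances. -/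
def emitPairs : Com := .loop i m (.emit (FR⟦KEY⟦i⟧ / KK⟧) ;; .emit (KEY⟦i⟧ % KK))

open Reg Arr in
/-- The scan of adjacent pairs. -/
def scanKeys : Com :=
  v ≔ 1 ;;
  .loop i (m - 1) (
    .ite (KEY⟦i⟧ / KK ≺ KEY⟦i + 1⟧ / KK)
      (.ite (KEY⟦i⟧ % KK ≺ KEY⟦i + 1⟧ % KK) .skip (v ≔ 0)) .skip)

open Reg Arr in
/-- The test by counting. -/
def testCount : Com :=
  dh ≔ KEY⟦m - 1⟧ % KK ;;
  .ite (dh ≺ m) (.ite (BA⟦dh⟧ ≐ m) .skip (v ≔ 0)) (v ≔ 0)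

open Reg Arr in
/-- The subroutine. -/
def candidate : Com :=
  emitPref ci ;; distances ;; sort ;; emitPairs ;; scanKeys ;;
  (testCount ;; .emit v ;; .ite v (found ≔ 1 ;; ans ≔ ci) .skip)

section candidate

variable {K n N g dg gm L : ℕ} {π : Profile K n} {D l : List (Preference K)} {c p : Preference K}

/-- The tables for the profile `π` with distinct preferences `D`. -/
structure Tab (π : Profile K n) (D : List (Preference K)) (s : St) : Prop where
  regK : s.reg .K = K
  regm : s.reg .m = D.length
  regKK : s.reg .KK = K * K
  cod : ∀ j (hj : j < D.length) (a : Fin K), s.arr .COD (j * K + a) = D[j].rank a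
  rk : ∀ j (hj : j < D.length), s.arr .RK j = freqRank π D D[j]
  fr : ∀ p ∈ D, s.arr .FR (freqRank π D p) = freq π p

theorem Tab.frame {c : Com} (h : Tab π D s) (f : Frame c s s')
    (hc : (∀ r ∈ [Reg.K, .m, .KK], r ∉ c.regs) ∧ ∀ a ∈ [Arr.COD, .RK, .FR], a ∉ c.arrs) :
    Tab π D s' := by
  simp only [List.forall_mem_cons] at hc
  obtain ⟨⟨h1, h2, h3, -⟩, h4, h5, h6, -⟩ := hc
  exact ⟨by rw [f.reg _ h1, h.regK], by rw [f.reg _ h2, h.regm], by rw [f.reg _ h3, h.regKK],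
    by rw [f.arr _ h4]; exact h.cod, by rw [f.arr _ h5]; exact h.rk,
    by rw [f.arr _ h6]; exact h.fr⟩

theorem emitPref_spec {r : Reg} {j : ℕ} (hT : Tab π D s) (hj : j < D.length) (hr : s.reg r = j)
    (hra : r ≠ .a) (hKM : K < M) :
    wp M (emitPref r) s (2 * K + 1) fun s' => s'.out = s.out ++ D[j].code := by
  refine (wp.loop (n := K) (τ := 1) (fun i s' => s'.out = s.out ++ D[j].code.take i)
    (by simp) (by simpa using hT.regK) hKM (by simp)
    fun i hi s₁ f₁ hi₁ h₁ => wp.basic' (by simp [Com.ticks]) ?_).mono (by omega) fun s₁ _ h₁ => ?_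
  · have hr₁ : s₁.reg r = j := by rw [f₁.reg r (by simpa [Com.regs] using hra), hr]
    have hK₁ : s₁.reg .K = K := by rw [f₁.reg .K (by simp [Com.regs]), hT.regK]
    have hC₁ : s₁.arr .COD = s.arr .COD := f₁.arr .COD (by simp [Com.arrs])
    have hc := hT.cod j hj ⟨i, hi⟩
    simp only at hc
    simp only [vc, hr₁, hK₁, hC₁, hi₁, hc, Expr.ok_reg, Expr.ok_arr, Expr.ok_add, Expr.ok_mul,
      Expr.eval_reg, Expr.eval_arr, Expr.eval_add, Expr.eval_mul, true_and, St.out_setReg,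
      St.out_emit, h₁, and_self]
    rw [List.append_assoc, List.take_succ_eq_append_getElem (by simpa [Preference.code] using hi)]
    simp [Preference.code]
  · rw [h₁.2, List.take_of_length_le (by simp [Preference.code])]

/-- The cell at the rank in D[j] receives the rank in D[i]. The ranks in D[j] exhaust the numbers
below K, so no cell of the segment keeps an old value. -/
theorem relabel_spec {i j : ℕ} (hT : Tab π D s) (hi : i < D.length) (hj : j < D.length)
    (hci : s.reg .ci = i) (hy : s.reg .y = j) (hN : s.reg .N = N) (hKN : K ≤ N) (hM : N < M) :
    wp M relabel s (2 * N + 2) fun s' => seg (s'.arr .X) 0 N =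
      (List.ofFn fun t : Fin K => ((((D[j].perm).symm.trans D[i].perm) t : Fin K) : ℕ)) ++
        (List.range (N - K)).map (K + ·) := by
  set σ := (D[j].perm).symm.trans D[i].perm with hσ
  refine (wp.seq (wp.loop (n := K) (τ := 1) (fun e s' => ∀ (b : Fin K), b < e →
      s'.arr .X (D[j].rank b) = D[i].rank b) (by simp) (by simpa using hT.regK) (by omega) (by simp)
      fun e he s₁ f₁ he₁ h₁ => wp.basic' (by decide) ?_)
    fun s₁ f₁ h₁ => (wp.loop (n := N - K) (τ := 1) (fun e s' =>
      (∀ b < K, s'.arr .X b = s₁.arr .X b) ∧ ∀ b < e, s'.arr .X (K + b) = K + b) (by simp) ?_ (by omega)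
      (by simp) fun e he s₂ f₂ he₂ h₂ => wp.basic' (by decide) ?_).mono le_rfl
      fun s₂ f₂ h₂ => ?_ :
    wp M relabel s ((1 + K * (1 + 1)) + (1 + (N - K) * (1 + 1))) _).mono (by omega) fun _ _ h => h
  · have hT₁ := hT.frame f₁ (by decide)
    have hci₁ : s₁.reg .ci = i := by rw [f₁.reg .ci (by decide), hci]
    have hy₁ : s₁.reg .y = j := by rw [f₁.reg .y (by decide), hy]
    have ci := hT₁.cod i hi ⟨e, he⟩
    have cj := hT₁.cod j hj ⟨e, he⟩
    simp only at ci cj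
    simp only [vc, hci₁, hy₁, he₁, hT₁.regK, ci, cj, Expr.ok_reg, Expr.ok_arr, Expr.ok_add,
      Expr.ok_mul, Expr.eval_reg, Expr.eval_arr, Expr.eval_add, Expr.eval_mul, true_and, and_true,
      St.arr_setReg, St.arr_setArr, if_true]
    refine ⟨(D[i].rank_lt _).trans (by omega), fun b hb => ?_⟩
    by_cases hbe : b = ⟨e, he⟩
    · rw [hbe, Function.update_self]
    · rw [Function.update_of_ne fun h => hbe (D[j].rank_injective h)]
      exact h₁ b (by have : (b : ℕ) ≠ e := fun h => hbe (Fin.ext h); omega)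
  · simp [f₁.reg .N (by decide), f₁.reg .K (by decide), hN, hT.regK]
  · have hK₂ : s₂.reg .K = K := by rw [f₂.reg .K (by decide), f₁.reg .K (by decide), hT.regK]
    simp only [vc, he₂, hK₂, Expr.ok_reg, Expr.ok_add, Expr.eval_reg, Expr.eval_add, true_and,
      and_true, St.arr_setReg, St.arr_setArr, if_true]
    refine ⟨by omega, fun b hb => ?_, fun b hb => ?_⟩
    · rw [Function.update_of_ne (by omega), h₂.1 b hb]
    · rw [Function.update_apply]
      split_ifs with h
      · omega
      · exact h₂.2 b (by omega)
  · obtain ⟨-, h3, h4⟩ := h₂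
    obtain ⟨-, h1⟩ := h₁
    obtain ⟨r, rfl⟩ := Nat.exists_eq_add_of_le hKN
    rw [Nat.add_sub_cancel_left] at h4 ⊢
    rw [seg_add]
    congr 1
    · refine List.ext_getElem (by simp) fun t ht _ => ?_
      rw [length_seg] at ht
      have := h1 ((D[j].perm).symm ⟨t, ht⟩) (Fin.is_lt _)
      rw [← Preference.val_perm, Equiv.apply_symm_apply] at this
      simp only at this
      simp [getElem_seg, h3 t ht, this, hσ, Preference.val_perm]
    · refine List.map_congr_left fun t ht => ?_
      rw [zero_add, h4 t (List.mem_range.1 ht)]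

/-- The dominant cost: one inversion count, of O(N * g) steps, for each distinct preference. -/
theorem distances_spec {i : ℕ} (hT : Tab π D s) (hi : i < D.length) (hci : s.reg .ci = i)
    (hC : Ctx s N g dg) (hF : Fits M L N gm g dg) (hL : s.reg .L = L) (hgm : s.reg .gm = gm)
    (hK : 0 < K) (hKN : K ≤ N) (hM : D.length * (K * K) < M) :
    wp M distances s (1 + D.length * (2 * N + 1500 * (N * g) + 4)) fun s' =>
      seg (s'.arr .KEY) 0 D.length = D.map (sortKey π D D[i]) := by
  obtain ⟨l1, l2, l3, l4, l5, l6⟩ := hF.lt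
  have hNM : N < M := by
    have h5 := hF.M_lt
    have h6 := hF.pos
    have := Nat.le_mul_of_pos_right N h6.2.1
    rw [mul_assoc] at h5
    omega
  have hDM : D.length < M := (Nat.le_mul_of_pos_right _ (by positivity)).trans_lt hM
  refine (wp.loop (n := D.length) (τ := (2 * N + 2) + (1500 * (N * g) + 1)) (fun j s' =>
    ∀ t < j, ∀ ht : t < D.length, s'.arr .KEY t = sortKey π D D[i] D[t]) (by simp)
    (by simpa using hT.regm) hDM (by simp) fun j hj s₁ f₁ hj₁ h₁ => ?_).mono ?_ fun s₁ _ h₁ => ?_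
  · have hT₁ := hT.frame f₁ (by decide)
    refine wp.seq (relabel_spec hT₁ hi hj ?_ hj₁ ?_ hKN hNM) fun s₂ f₂ h₂ => wp.seq
      (inversions_spec ((hC.frame f₁ (by decide)).frame f₂ (by decide)) hF ?_ h₂ ?_ ?_)
      fun s₃ f₃ h₃ => wp.basic' (by decide) ?_
    · rw [f₁.reg .ci (by decide), hci]
    · rw [f₁.reg .N (by decide), hC.regN]
    · obtain ⟨r, rfl⟩ := Nat.exists_eq_add_of_le hKN
      rw [Nat.add_sub_cancel_left, List.range_add]
      exact (ofFn_perm _).append_right _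
    · rw [f₂.reg .L (by decide), f₁.reg .L (by decide), hL]
    · rw [f₂.reg .gm (by decide), f₁.reg .gm (by decide), hgm]
    · rw [invL_append_range (fun x hx => ?_), invL_ofFn, Equiv.coe_trans] at h₃
      · have hres : s₃.reg .res = invDist D[j] D[i] := by rw [h₃, invDist_eq]; rfl
        have hT₃ := (hT₁.frame f₂ (by decide)).frame f₃ (by decide)
        have hy₃ : s₃.reg .y = j := by rw [f₃.reg .y (by decide), f₂.reg .y (by decide), hj₁]
        have hK₃ : s₃.arr .KEY = s₁.arr .KEY := by
          rw [f₃.arr .KEY (by decide), f₂.arr .KEY (by decide)]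
        have hk : freqRank π D D[j] * (K * K) + invDist D[j] D[i] = sortKey π D D[i] D[j] := rfl
        have hlt := sortKey_lt (π := π) (c := D[i]) hK (List.getElem_mem hj)
        simp only [vc, hres, hy₃, hT₃.rk j hj, hT₃.regKK, hK₃, hk, Expr.ok_reg, Expr.ok_arr,
          Expr.ok_add, Expr.ok_mul, Expr.eval_reg, Expr.eval_arr, Expr.eval_add, Expr.eval_mul,
          true_and, St.arr_setReg, St.arr_setArr, if_true]
        refine ⟨by omega, fun t ht ht' => ?_⟩
        rw [Function.update_apply]
        split_ifs with h
        · subst h; rfl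
        · exact h₁ t (by omega) ht'
      · rw [List.mem_ofFn] at hx
        obtain ⟨t, rfl⟩ := hx
        exact Fin.is_lt _
  · exact (add_le_add_iff_left _).2 (Nat.mul_le_mul_left _ (by omega))
  · refine (seg_eq_iff (by simp)).2 fun t ht => ?_
    simp only [length_seg, List.length_map] at ht
    rw [zero_add, h₁.2 t (by omega) (by omega), List.getElem_map]

/-- The keys in the order `l`. -/
def Keys (π : Profile K n) (D : List (Preference K)) (c : Preference K) (l : List (Preference K))
    (s : St) : Prop :=
  ∀ t (ht : t < l.length), s.arr .KEY t = sortKey π D c l[t]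

theorem emitPairs_spec (hT : Tab π D s) (hl : l.Perm D) (hk : Keys π D c l s) (hK : 0 < K)
    (hM : D.length < M) :
    wp M emitPairs s (1 + D.length * 3) fun s' =>
      s'.out = s.out ++ l.flatMap fun p => [freq π p, invDist p c] := by
  refine (wp.loop (n := D.length) (τ := 2) (fun i s' =>
    s'.out = s.out ++ (l.take i).flatMap fun p => [freq π p, invDist p c]) (by simp)
    (by simpa using hT.regm) hM (by simp) fun i hi s₁ f₁ hi₁ h₁ => wp.basic' (by decide) ?_).mono
    le_rfl fun s₁ _ h₁ => ?_
  · have hT₁ := hT.frame f₁ (by decide)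
    have hil : i < l.length := by rw [hl.length_eq]; exact hi
    have hki : s₁.arr .KEY i = sortKey π D c l[i] := by rw [f₁.arr .KEY (by decide), hk i hil]
    simp only [vc, hi₁, hki, hT₁.regKK, sortKey_div hK, sortKey_mod hK,
      hT₁.fr _ (hl.subset (List.getElem_mem hil)), h₁, Expr.ok_reg, Expr.ok_arr, Expr.ok_div,
      Expr.ok_mod, Expr.eval_reg, Expr.eval_arr, Expr.eval_div, Expr.eval_mod, true_and, and_true,
      and_self, St.out_setReg, St.out_emit, St.arr_emit, St.reg_emit]
    rw [List.take_succ_eq_append_getElem hil, List.flatMap_append]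
    simp
  · rw [h₁.2, List.take_of_length_le hl.length_eq.le]

/-- Ranks run against frequencies: a drop in frequency is a rise of the quotient of the key by K *
K. -/
theorem scanKeys_spec (hT : Tab π D s) (hl : l.Perm D) (hk : Keys π D c l s) (hK : 0 < K)
    (hM : D.length + 1 < M) :
    wp M scanKeys s (4 * D.length + 2) fun s' =>
      (s'.reg .v = 0 ∨ s'.reg .v = 1) ∧ (s'.reg .v ≠ 0 ↔ scan π c l) := by
  refine (wp.seq (wp.basic' (T := 1) (Q := fun s' => s'.reg .v = 1) (by decide)
    (by simp [vc]; omega)) fun s₁ f₁ h₁ => (wp.loop (n := D.length - 1) (τ := 3) (fun i s' =>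
      (s'.reg .v = 0 ∨ s'.reg .v = 1) ∧ (s'.reg .v ≠ 0 ↔ ∀ t < i, ∀ (h : t + 1 < l.length),
      ¬ (freq π l[t + 1] < freq π l[t] ∧ invDist l[t + 1] c ≤ invDist l[t] c)))
    (by simp) (by simp [f₁.reg .m (by decide), hT.regm]) (by omega) (by simp [h₁])
    fun i hi s₂ f₂ hi₂ h₂ => wp.basic' (by decide) ?_).mono
      le_rfl fun s₂ _ h₂ => ?_ :
    wp M scanKeys s (1 + (1 + (D.length - 1) * (3 + 1))) _).mono (by omega) fun _ _ h => h
  · have hT₂ := (hT.frame f₁ (by decide)).frame f₂ (by decide)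
    have hil : i + 1 < l.length := by rw [hl.length_eq]; omega
    have hKEY : s₂.arr .KEY = s.arr .KEY := by rw [f₂.arr .KEY (by decide), f₁.arr .KEY (by decide)]
    have hr := freqRank_lt_iff (π := π) (hl.subset (List.getElem_mem hil))
      (hl.subset (List.getElem_mem (show i < l.length by omega)))
    have hsucc : (∀ t < i + 1, ∀ (h : t + 1 < l.length),
        ¬ (freq π l[t + 1] < freq π l[t] ∧ invDist l[t + 1] c ≤ invDist l[t] c)) ↔
        (∀ t < i, ∀ (h : t + 1 < l.length),
        ¬ (freq π l[t + 1] < freq π l[t] ∧ invDist l[t + 1] c ≤ invDist l[t] c)) ∧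
        ¬ (freq π l[i + 1] < freq π l[i] ∧ invDist l[i + 1] c ≤ invDist l[i] c) := by
      constructor
      · exact fun h => ⟨fun t ht => h t (by omega), h i (by omega) hil⟩
      · rintro ⟨h1, h2⟩ t ht h
        rcases Nat.lt_succ_iff_lt_or_eq.1 ht with ht | rfl
        exacts [h1 t ht h, h2]
    simp only [vc, hi₂, hKEY, hk i (by omega), hk (i + 1) hil, hT₂.regKK, sortKey_div hK,
      sortKey_mod hK, Expr.ok_reg, Expr.ok_arr, Expr.ok_bin, Expr.ok_div, Expr.ok_mod, Expr.ok_add,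
      Expr.ok_ofNat, Expr.eval_reg, Expr.eval_arr, Expr.eval_div, Expr.eval_mod, Expr.eval_add,
      Expr.eval_lt, Expr.eval_ofNat, true_and, and_self, St.reg_setReg, reduceCtorEq, if_true,
      if_false, hr, hsucc]
    refine ⟨fun h => ⟨fun h' => ?_, fun h' => ?_⟩, fun h => ?_⟩
    · have h' : invDist l[i] c < invDist l[i + 1] c := by by_contra hh; simp [hh] at h'
      refine ⟨h₂.1, h₂.2.trans ⟨fun h3 => ⟨h3, by omega⟩, fun h3 => h3.1⟩⟩
    · have h : freq π l[i + 1] < freq π l[i] := by by_contra hh; simp [hh] at h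
      have h' : ¬ invDist l[i] c < invDist l[i + 1] c := by intro hh; simp [hh] at h'
      refine ⟨by omega, by simp, ?_⟩
      simp only [ne_eq, not_true_eq_false, false_iff, not_and, not_not]
      exact fun _ h3 => h3 h (by omega)
    · have h : ¬ freq π l[i + 1] < freq π l[i] := by intro hh; simp [hh] at h
      refine ⟨h₂.1, h₂.2.trans ⟨fun h3 => ⟨h3, by omega⟩, fun h3 => h3.1⟩⟩
  · refine ⟨h₂.2.1, h₂.2.2.trans (scan_iff_getElem.trans ?_).symm⟩
    exact ⟨fun h t _ h' => h t h', fun h t h' => h t (by rw [hl.length_eq] at h'; omega) h'⟩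

/-- Distances outside the table fail the test by `lt_sum_mahonian`, and inside it the cut-off at m +
1 does not affect equality with m. -/
theorem testCount_spec (hT : Tab π D s) (hl : l.Perm D) (hk : Keys π D c l s) (hK : 0 < K)
    (hD : 0 < D.length) (hB : ∀ d < D.length, s.arr .BA d = min (D.length + 1) (ball K d))
    (hv : s.reg .v = 0 ∨ s.reg .v = 1) (hM : K * K + 1 < M) :
    wp M testCount s 4 fun s' =>
      (s'.reg .v = 0 ∨ s'.reg .v = 1) ∧ (s'.reg .v ≠ 0 ↔ s.reg .v ≠ 0 ∧ countTest c l) := by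
  have hlen := hl.length_eq
  have hl1 : D.length - 1 < l.length := by omega
  set p := l[D.length - 1] with hp
  have hlast : l.getLast? = some p := by
    rw [List.getLast?_eq_getElem?, List.getElem?_eq_getElem (by omega), hp]
    simp [hlen]
  have hct : countTest c l ↔ ball K (invDist p c) = D.length := by
    rw [countTest, hlast, ← hlen]
    simp only [Option.mem_def, Option.some.injEq, exists_eq_left', ← sum_mahonian_eq_ball]
  have hdl := invDist_lt hK p c
  have hbl := lt_sum_mahonian p c
  rw [sum_mahonian_eq_ball] at hbl
  refine wp.basic' (by decide) ?_
  simp only [testCount, vc, hT.regm, hT.regKK, hk _ hl1, ← hp, sortKey_mod hK, Expr.ok_reg, Expr.ok_arr,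
    Expr.ok_bin, Expr.ok_mod, Expr.ok_sub, Expr.ok_ofNat, Expr.eval_reg, Expr.eval_arr,
    Expr.eval_mod, Expr.eval_sub, Expr.eval_lt, Expr.eval_eq, Expr.eval_ofNat, true_and, and_self,
    St.reg_setReg, St.arr_setReg, reduceCtorEq, if_true, if_false, hct]
  refine ⟨by omega, fun h => ?_, fun h => ?_⟩
  · have h : invDist p c < D.length := by by_contra hh; simp [hh] at h
    rw [hB _ h]
    refine ⟨fun h' => ?_, fun h' => ?_⟩
    · have h' : min (D.length + 1) (ball K (invDist p c)) = D.length := by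
        by_contra hh; simp [hh] at h'
      omega
    · have h' : ¬ min (D.length + 1) (ball K (invDist p c)) = D.length := by
        intro hh; simp [hh] at h'
      exact ⟨by omega, by simp, by omega⟩
  · have h : ¬ invDist p c < D.length := by intro hh; simp [hh] at h
    exact ⟨by omega, by simp, by omega⟩

theorem candidate_spec {i : ℕ} {lex : List (Preference K)} (hT : Tab π D s) (hi : i < D.length)
    (hci : s.reg .ci = i) (hC : Ctx s N g dg) (hF : Fits M L N gm g dg) (hL : s.reg .L = L)
    (hgm : s.reg .gm = gm) (hK : 0 < K) (hKN : K ≤ N)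
    (hB : ∀ d < D.length, s.arr .BA d = min (D.length + 1) (ball K d))
    (hNB : D.length * K * K ≤ 2 ^ s.reg .NB) (hNB' : 2 ^ s.reg .NB ≤ 2 * (D.length * K * K))
    (hM : 2 * (D.length * K * K) + 1 < M) (hM' : K * K + 1 < M) (hmM : 2 * D.length + 1 < M)
    (hnd : D.Nodup) (hm : ∀ p, p ∈ D ↔ ∃ i, π i = p) (hlex : IsLexOrder π D[i] lex) :
    wp M candidate s (2 * K + D.length * (2 * N + 1500 * (N * g) + 11) +
        s.reg .NB * (12 * D.length + 8) + 15) fun s' =>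
      s'.out = s.out ++ subroutineRecord π D[i] lex ∧
      (subroutine π D[i] lex → s'.reg .found = 1 ∧ s'.reg .ans = i) ∧
      (¬ subroutine π D[i] lex → s'.reg .found = s.reg .found ∧ s'.reg .ans = s.reg .ans) := by
  have hKK : K ≤ K * K := Nat.le_mul_self K
  have hlD := hlex.perm_of_mem hnd hm
  have hassoc : D.length * K * K = D.length * (K * K) := by ring
  refine (wp.seq (emitPref_spec hT hi hci (by decide) (by omega)) fun s₁ f₁ h₁ =>
    wp.seq (distances_spec (hT.frame f₁ (by decide)) hi ?_ (hC.frame f₁ (by decide)) hF ?_ ?_ hK hKN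
      (by omega)) fun s₂ f₂ h₂ => wp.seq (sort_spec (m := D.length) (NB := s.reg .NB) ?_ ?_ ?_ ?_ hmM)
    fun s₃ f₃ h₃ => ?_ : wp M candidate s (2 * K + 1 + (1 + D.length * (2 * N + 1500 * (N * g) + 4)
      + (s.reg .NB * (12 * D.length + 8) + 2 + (1 + D.length * 3 + (4 * D.length + 2 +
      (4 + (1 + 3))))))) _).mono ?_ fun _ _ h => h
  · rw [f₁.reg .ci (by decide), hci]
  · rw [f₁.reg .L (by decide), hL]
  · rw [f₁.reg .gm (by decide), hgm]
  · rw [f₂.reg .m (by decide), f₁.reg .m (by decide), hT.regm]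
  · rw [f₂.reg .NB (by decide), f₁.reg .NB (by decide)]
  · intro t ht
    have h := (seg_eq_iff (by simp)).1 h₂ t (by simpa using ht)
    rw [zero_add, List.getElem_map] at h
    rw [h]
    have := sortKey_lt (π := π) (c := D[i]) hK (List.getElem_mem ht)
    omega
  · omega
  · have hT₃ := ((hT.frame f₁ (by decide)).frame f₂ (by decide)).frame f₃ (by decide)
    rw [h₂] at h₃
    have hkeys : Keys π D D[i] lex s₃ := by
      have := eq_map_sortKey hK hlex hnd hm h₃.1 h₃.2
      intro t ht
      have h := (seg_eq_iff (by simp [hlD.length_eq])).1 this t (by simpa using ht)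
      rw [zero_add, List.getElem_map] at h
      exact h
    refine wp.seq (emitPairs_spec hT₃ hlD hkeys hK (by omega)) fun s₄ f₄ h₄ => ?_
    have hT₄ := hT₃.frame f₄ (by decide)
    have hk₄ : Keys π D D[i] lex s₄ := fun t ht => by rw [f₄.arr .KEY (by decide), hkeys t ht]
    refine wp.seq (scanKeys_spec hT₄ hlD hk₄ hK (by omega)) fun s₅ f₅ h₅ => ?_
    have hT₅ := hT₄.frame f₅ (by decide)
    have hk₅ : Keys π D D[i] lex s₅ := fun t ht => by rw [f₅.arr .KEY (by decide), hk₄ t ht]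
    refine wp.seq (testCount_spec hT₅ hlD hk₅ hK (by omega) ?_ h₅.1 hM') fun s₆ f₆ h₆ => ?_
    · rw [f₅.arr .BA (by decide), f₄.arr .BA (by decide), f₃.arr .BA (by decide),
        f₂.arr .BA (by decide), f₁.arr .BA (by decide)]
      exact hB
    have hci₆ : s₆.reg .ci = i := by
      rw [f₆.reg .ci (by decide), f₅.reg .ci (by decide), f₄.reg .ci (by decide),
        f₃.reg .ci (by decide), f₂.reg .ci (by decide), f₁.reg .ci (by decide), hci]
    have hfo : s₆.reg .found = s.reg .found := by
      rw [f₆.reg .found (by decide), f₅.reg .found (by decide), f₄.reg .found (by decide),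
        f₃.reg .found (by decide), f₂.reg .found (by decide), f₁.reg .found (by decide)]
    have han : s₆.reg .ans = s.reg .ans := by
      rw [f₆.reg .ans (by decide), f₅.reg .ans (by decide), f₄.reg .ans (by decide),
        f₃.reg .ans (by decide), f₂.reg .ans (by decide), f₁.reg .ans (by decide)]
    have hout : s₆.out = s.out ++ (D[i].code ++ lex.flatMap fun p => [freq π p, invDist p D[i]]) := by
      rw [f₆.out (by decide), f₅.out (by decide), h₄, f₃.out (by decide), f₂.out (by decide), h₁,
        List.append_assoc]
    have hsub : s₆.reg .v ≠ 0 ↔ subroutine π D[i] lex := h₆.2.trans (and_congr_left' h₅.2)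
    refine wp.basic' (by decide) ?_
    simp only [vc, Expr.ok_reg, Expr.ok_ofNat, Expr.eval_reg, Expr.eval_ofNat, true_and,
      St.reg_setReg, St.reg_emit, St.out_setReg, St.out_emit, reduceCtorEq, if_true, if_false, hout,
      hci₆, hfo, han, subroutineRecord]
    refine ⟨fun h => ?_, fun h => ?_⟩
    · have hs := hsub.1 h
      have hv : s₆.reg .v = 1 := h₆.1.resolve_left h
      refine ⟨by omega, by omega, ?_, fun _ => trivial, fun h' => absurd hs h'⟩
      simp [hv, hs]
    · have hs : ¬ subroutine π D[i] lex := fun h' => hsub.2 h' h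
      refine ⟨?_, fun h' => absurd h' hs, fun _ => trivial⟩
      simp [h, hs]
  · have : D.length * (2 * N + 1500 * (N * g) + 11) =
      D.length * (2 * N + 1500 * (N * g) + 4) + 7 * D.length := by ring
    omega

end candidate

end ArrayRam

namespace ArrayRam

variable {M : ℕ} {s s' : St}

/-! ### The main algorithm -/

open Reg Arr in
/-- Emit the frequencies in descending order. -/
def listFreqs : Com :=
  .loop i m (KEY⟦i⟧ ⇐ RK⟦i⟧ * KK) ;; sort ;; .loop i m (.emit (FR⟦KEY⟦i⟧ / KK⟧))

open Reg Arr in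
/-- Compute all tables, and emit the number of distinct preferences and their frequencies. -/
def prepare : Com :=
  dedup ;; .emit m ;; ranks ;; keyBits ;; params ;; listFreqs ;; balls ;; factorial ;; unequal

open Reg Arr in
/-- Try the candidates of maximal frequency. -/
def tryAll : Com :=
  .loop ci m (.ite (found ≐ 0) (.ite (RK⟦ci⟧ ≐ 0) candidate .skip) .skip)

open Reg Arr in
/-- Emit the answer. -/
def answer : Com := .ite found (.emit 1 ;; emitPref ans) (.emit 0)

open Reg Arr in
/-- The main algorithm. -/
def main : Com :=
  prepare ;; found ≔ 0 ;; .ite ((ne ≐ 0) * (fc ≐ m)) .skip tryAll ;; answer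

section main

variable {K n N g dg gm L R : ℕ} {π : Profile K n} {D l : List (Preference K)}
  {pref : ℕ → Preference K} {μ : ℕ → ℕ}

/-- The entries of the rows of ranks. -/
noncomputable def entry (pref : ℕ → Preference K) (r c : ℕ) : ℕ :=
  if h : c < K then (pref r).rank ⟨c, h⟩ else 0

theorem rep_entry_eq_iff {r t : ℕ} :
    rep (entry pref) K r = rep (entry pref) K t ↔ pref r = pref t := by
  rw [rep_eq_iff]
  constructor
  · intro h
    refine Preference.perm_injective (Equiv.ext fun a => Fin.ext ?_)
    have := h a a.is_lt
    simpa [entry, ← Preference.val_perm] using this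
  · intro h e _
    simp [entry, h]

/-- The distinct preferences in the order of their first appearance. -/
noncomputable def distinct (pref : ℕ → Preference K) (R : ℕ) : List (Preference K) :=
  (firsts (entry pref) K R).map pref

theorem nodup_distinct : (distinct pref R).Nodup := by
  refine (nodup_firsts _ K R).map_on fun r hr t ht h => ?_
  rw [mem_firsts] at hr ht
  rw [← hr.2, ← ht.2]
  exact rep_entry_eq_iff.2 h

theorem mem_distinct {p : Preference K} : p ∈ distinct pref R ↔ ∃ r < R, pref r = p := by
  rw [distinct, List.mem_map]
  constructor
  · rintro ⟨r, hr, rfl⟩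
    exact ⟨r, ((mem_firsts _ K).1 hr).1, rfl⟩
  · rintro ⟨r, hr, rfl⟩
    refine ⟨rep (entry pref) K r, (mem_firsts _ K).2 ⟨(rep_le_self _ K r).trans_lt hr,
      rep_rep _ K r⟩, rep_entry_eq_iff.1 (rep_rep _ K r)⟩

theorem length_distinct : (distinct pref R).length = (firsts (entry pref) K R).length := by
  simp [distinct]

open Classical in
/-- The input describes the profile `π` by the rows `pref` with multiplicities `μ`. -/
structure Input (π : Profile K n) (inp : List ℕ) (R : ℕ) (pref : ℕ → Preference K) (μ : ℕ → ℕ) :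
    Prop where
  rows : Rows inp K R (entry pref) μ
  occurs : ∀ p, (∃ r < R, pref r = p) ↔ ∃ i, π i = p
  freq : ∀ p, ∑ t ∈ Finset.range R with pref t = p, μ t = freq π p
  sum : ∑ t ∈ Finset.range R, μ t = n

/-- Ranks are brought into the format of sort keys with distance 0, so the same bit length and the
same sorting program serve. -/
theorem listFreqs_spec (hT : Tab π D s) (hK : 0 < K)
    (hNB : D.length * K * K ≤ 2 ^ s.reg .NB) (hNB' : 2 ^ s.reg .NB ≤ 2 * (D.length * K * K))
    (hM : 2 * (D.length * K * K) + 1 < M) (hmM : 2 * D.length + 1 < M)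
    (hnd : D.Nodup) (hm : ∀ p, p ∈ D ↔ ∃ i, π i = p) (hl : IsFreqOrder π l) :
    wp M listFreqs s (s.reg .NB * (12 * D.length + 8) + 4 * D.length + 4) fun s' =>
      s'.out = s.out ++ l.map (freq π) := by
  have hlD : l.Perm D := (List.perm_ext_iff_of_nodup hl.1 hnd).2 fun p => by rw [hl.2.1, hm]
  have hassoc : D.length * K * K = D.length * (K * K) := by ring
  have hlt : ∀ p ∈ D, freqRank π D p * (K * K) < D.length * (K * K) := fun p hp =>
    Nat.mul_lt_mul_of_pos_right (freqRank_lt_length hp) (by positivity)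
  refine (wp.seq (P := fun s' => seg (s'.arr .KEY) 0 D.length =
      D.map fun p => freqRank π D p * (K * K)) ((wp.loop (n := D.length) (τ := 1) (fun j s' =>
    ∀ t < j, ∀ ht : t < D.length, s'.arr .KEY t = freqRank π D D[t] * (K * K)) (by simp)
    (by simpa using hT.regm) (by omega) (by simp) fun j hj s₁ f₁ hj₁ h₁ =>
      wp.basic' (by decide) ?_).mono le_rfl fun s₁ _ h₁ => ?_) fun s₁ f₁ h₁ =>
    wp.seq (sort_spec (m := D.length) (NB := s.reg .NB) ?_ ?_ ?_ ?_ hmM)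
    fun s₂ f₂ h₂ => (wp.loop (n := D.length) (τ := 1) (fun i s' =>
      s'.out = s.out ++ (l.take i).map (freq π)) (by simp)
      ?_ (by omega) ?_ fun i hi s₃ f₃ hi₃ h₃ => wp.basic' (by decide) ?_).mono
      le_rfl fun s₃ _ h₃ => ?_ : wp M listFreqs s ((1 + D.length * (1 + 1)) + ((s.reg .NB *
        (12 * D.length + 8) + 2) + (1 + D.length * (1 + 1)))) _).mono (by omega) fun _ _ h => h
  · have hT₁ := hT.frame f₁ (by decide)
    simp only [vc, hj₁, hT₁.rk j hj, hT₁.regKK, Expr.ok_reg, Expr.ok_arr, Expr.ok_mul,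
      Expr.eval_reg, Expr.eval_arr, Expr.eval_mul, true_and, St.arr_setReg, St.arr_setArr, if_true]
    refine ⟨(hlt _ (List.getElem_mem hj)).trans (by omega), fun t ht ht' => ?_⟩
    rw [Function.update_apply]
    split_ifs with h
    · subst h; rfl
    · exact h₁ t (by omega) ht'
  · refine (seg_eq_iff (by simp)).2 fun t ht => ?_
    simp only [length_seg, List.length_map] at ht
    rw [zero_add, h₁.2 t (by omega) (by omega), List.getElem_map]
  · rw [f₁.reg .m (by decide), hT.regm]
  · exact f₁.reg .NB (by decide)
  · intro t ht
    have h := (seg_eq_iff (by simp)).1 h₁ t (by simpa using ht)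
    rw [zero_add, List.getElem_map] at h
    rw [h]
    have := hlt _ (List.getElem_mem ht)
    omega
  · omega
  · simp [f₂.reg .m (by decide), f₁.reg .m (by decide), hT.regm]
  · simp [f₂.out (by decide), f₁.out (by decide)]
  · have hT₃ := ((hT.frame f₁ (by decide)).frame f₂ (by decide)).frame f₃ (by decide)
    have hil : i < l.length := by rw [hlD.length_eq]; exact hi
    rw [h₁] at h₂
    have h := (seg_eq_iff (by simp [hlD.length_eq])).1 (eq_map_freqRank hl hnd hm _ h₂.1 h₂.2) i
      (by simpa using hil)
    rw [zero_add, List.getElem_map] at h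
    have hki : s₃.arr .KEY i = freqRank π D l[i] * (K * K) := by rw [f₃.arr .KEY (by decide), h]
    simp only [vc, hi₃, hki, hT₃.regKK, Nat.mul_div_cancel _ (show 0 < K * K by positivity),
      hT₃.fr _ (hlD.subset (List.getElem_mem hil)), h₃, Expr.ok_reg, Expr.ok_arr, Expr.ok_div,
      Expr.eval_reg, Expr.eval_arr, Expr.eval_div, true_and, and_true, and_self, St.out_setReg,
      St.out_emit]
    rw [List.take_succ_eq_append_getElem hil, List.map_append]
    simp
  · rw [h₃.2, List.take_of_length_le hlD.length_eq.le]

/-- The state after the preparations. -/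
structure Ready (M : ℕ) (π : Profile K n) (D : List (Preference K)) (N g dg gm L : ℕ) (s : St) :
    Prop where
  tab : Tab π D s
  ctx : Ctx s N g dg
  fits : Fits M L N gm g dg
  regL : s.reg .L = L
  reggm : s.reg .gm = gm
  K_le : K ≤ N
  lt_K : N < 2 * K
  sq : 2 * (g * g) ≤ L
  ba : ∀ d < D.length, s.arr .BA d = min (D.length + 1) (ball K d)
  bits : D.length * K * K ≤ 2 ^ s.reg .NB
  bits' : 2 ^ s.reg .NB ≤ 2 * (D.length * K * K)

theorem Ready.frame {c : Com} (h : Ready M π D N g dg gm L s) (f : Frame c s s')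
    (hc : (∀ r ∈ [Reg.K, .m, .KK, .N, .g, .D, .DG, .L, .gm, .NB], r ∉ c.regs) ∧
      ∀ a ∈ [Arr.COD, .RK, .FR, .PW, .BA], a ∉ c.arrs) :
    Ready M π D N g dg gm L s' := by
  simp only [List.forall_mem_cons] at hc
  obtain ⟨⟨h1, h2, h3, h4, h5, h6, h7, h8, h9, h10, -⟩, h11, h12, h13, h14, h15, -⟩ := hc
  refine ⟨h.tab.frame f ?_, h.ctx.frame f ?_, h.fits, by rw [f.reg _ h8, h.regL],
    by rw [f.reg _ h9, h.reggm], h.K_le, h.lt_K, h.sq, by rw [f.arr _ h15]; exact h.ba,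
    by rw [f.reg _ h10]; exact h.bits, by rw [f.reg _ h10]; exact h.bits'⟩
  · simp only [List.forall_mem_cons]
    exact ⟨⟨h1, h2, h3, by simp⟩, h11, h12, h13, by simp⟩
  · simp only [List.forall_mem_cons]
    exact ⟨⟨h4, h5, h6, h7, by simp⟩, h14⟩

theorem prepare_spec (hI : Input π s.inp R pref μ) (hTR : ∀ k, s.arr .TR k = 0)
    (hF0 : ∀ k, s.arr .F k = 0) (hK : 3 ≤ K) (hR : 0 < R) {X : ℕ} (hX : R * K + n ≤ X)
    (hn : 0 < n) (hMX : 16 * (X * X) ≤ M) (hMK : 20 * (K * K) < M)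
    (hl : IsFreqOrder π l) :
    let D := distinct pref R
    wp M prepare s (R * (8 * K + 8) + D.length * (3 * D.length) + K * (8 * D.length) + 55 * K +
        18 * D.length + (2 * (D.length * K * K)).log2 * (12 * D.length + 8) + 20) fun s' =>
      (∃ N g dg gm L, Ready M π D N g dg gm L s') ∧
      (s'.reg .ne = 0 ↔ ∀ p ∈ D, freqRank π D p = 0) ∧
      (s'.reg .fc = D.length ↔ K.factorial = D.length) ∧
      s'.out = s.out ++ l.length :: l.map (freq π) := by
  intro D
  have hDR : D.length ≤ R := by
    simpa [D, distinct] using length_firsts_le (entry pref) K R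
  have hnd : D.Nodup := nodup_distinct
  have hm : ∀ p, p ∈ D ↔ ∃ i, π i = p := fun p => mem_distinct.trans (hI.occurs p)
  have hD0 : 0 < D.length := List.length_pos_of_mem (mem_distinct.2 ⟨0, hR, rfl⟩)
  have hlD : l.Perm D := (List.perm_ext_iff_of_nodup hl.1 hnd).2 fun p => by rw [hl.2.1, hm]
  have hRK : R * 3 ≤ R * K := Nat.mul_le_mul_left R hK
  have hKR : K ≤ R * K := Nat.le_mul_of_pos_left K hR
  have hX4 : 4 * X ≤ X * X := Nat.mul_le_mul_right X (by omega)
  have hDK : D.length * K ≤ R * K := Nat.mul_le_mul_right K hDR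
  have hDKK : D.length * K * K ≤ X * X := Nat.mul_le_mul (by omega) (by omega)
  have hRKK : (K * R + 1) * K ≤ X * X := Nat.mul_le_mul (by rw [mul_comm]; omega) (by omega)
  have hDD : (D.length + 1) * (D.length + 1) ≤ X * X := Nat.mul_le_mul (by omega) (by omega)
  have hdl : D.length = (firsts (entry pref) K R).length := length_distinct
  have hD : ∀ j (hj : j < D.length), D[j] = pref ((firsts (entry pref) K R)[j]'(hdl ▸ hj)) :=
    fun j hj => by simp [D, distinct]
  have hle : ∀ x, 2 ^ x ≤ 2 * (D.length * K * K) → x ≤ (2 * (D.length * K * K)).log2 := fun x h =>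
    (Nat.le_log2 (by have : 0 < D.length * K * K := by positivity
                     omega)).2 h
  suffices h : wp M prepare s ((R * (8 * K + 8) + 4) + (1 + ((D.length * (3 * D.length + 5) + 1) +
      ((4 * D.length + 8 * K + 3) + (40 * K + (((2 * (D.length * K * K)).log2 * (12 * D.length + 8) +
      4 * D.length + 4) + (((1 + D.length * 2) + (1 + K * (8 * D.length + 4))) + ((3 * K + 2) +
      (3 * D.length + 2))))))))) _ by
    refine h.mono ?_ fun _ _ h => h
    have e1 : D.length * (3 * D.length + 5) = D.length * (3 * D.length) + 5 * D.length := by ring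
    have e2 : K * (8 * D.length + 4) = K * (8 * D.length) + 4 * K := by ring
    omega
  refine wp.seq (dedup_spec hI.rows hTR hF0 (by omega) (by omega) (by omega)
    (by rw [hI.sum]; omega)) fun s₁ f₁ h₁ => ?_
  obtain ⟨k1, k2, k3, k4⟩ := h₁
  rw [← hdl] at k3
  refine wp.seq (wp.basic' (Q := fun s' => s'.out = s.out ++ [D.length]) (by decide)
    (by simp [vc, k3, f₁.out (by decide)])) fun s₂ f₂ h₂ => ?_
  have hF : ∀ j (hj : j < D.length), s₂.arr .F j = freq π D[j] := by
    intro j hj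
    classical
    rw [f₂.arr .F (by decide), (k4 j (hdl ▸ hj)).2, ← hI.freq]
    refine Finset.sum_congr (Finset.ext fun t => ?_) fun _ _ => rfl
    rw [Finset.mem_filter, Finset.mem_filter, hD j hj, ← rep_entry_eq_iff, ((mem_firsts _ K).1 (List.getElem_mem (hdl ▸ hj))).2]
  have hfn : ∀ p, freq π p ≤ n := fun p => by
    classical
    simpa [freq] using Finset.card_filter_le (Finset.univ : Finset (Fin n)) fun i => π i = p
  have hseg : seg (s₂.arr .F) 0 D.length = D.map (freq π) :=
    (seg_eq_iff (by simp)).2 fun j hj => by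
      rw [zero_add, hF j (by simpa using hj), List.getElem_map]
  refine wp.seq (ranks_spec (m := D.length) (by rw [f₂.reg .m (by decide), k3]) (by omega)
    fun j hj => ?_) fun s₃ f₃ h₃ => ?_
  · rw [hF j hj]
    have := hfn D[j]; omega
  rw [hseg] at h₃
  have hK₃ : s₃.reg .K = K := by rw [f₃.reg .K (by decide), f₂.reg .K (by decide), k1]
  have hm₃ : s₃.reg .m = D.length := by rw [f₃.reg .m (by decide), f₂.reg .m (by decide), k3]
  refine wp.seq (keyBits_spec hm₃ hK₃ hD0 (by omega) (by omega) (by omega)) fun s₄ f₄ h₄ => ?_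
  refine wp.seq (params_spec (by rw [f₄.reg .K (by decide), hK₃]) hK hMK) fun s₅ f₅ h₅ => ?_
  obtain ⟨L, N, gm, g, dg, hC, hFits, hL, hgm, hKK, hKN, hNK, hsq⟩ := h₅
  have hNB : s₅.reg .NB = s₄.reg .NB := f₅.reg .NB (by decide)
  have hT : Tab π D s₅ := by
    refine ⟨?_, ?_, hKK, fun j hj a => ?_, fun j hj => ?_, fun p hp => ?_⟩
    · rw [f₅.reg .K (by decide), f₄.reg .K (by decide), hK₃]
    · rw [f₅.reg .m (by decide), f₄.reg .m (by decide), hm₃]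
    · rw [f₅.arr .COD (by decide), f₄.arr .COD (by decide), f₃.arr .COD (by decide),
        f₂.arr .COD (by decide), (k4 j (hdl ▸ hj)).1 a a.is_lt, hD j hj]
      simp [entry]
    · rw [f₅.arr .RK (by decide), f₄.arr .RK (by decide), (h₃ j hj).1, hF j hj, freqRank]
    · obtain ⟨j, hj, rfl⟩ := List.getElem_of_mem hp
      have := (h₃ j hj).2
      rw [hF j hj] at this
      rw [f₅.arr .FR (by decide), f₄.arr .FR (by decide), freqRank, this]
  refine wp.seq ((listFreqs_spec hT (by omega) (by rw [hNB]; exact h₄.1) (by rw [hNB]; exact h₄.2)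
    (by omega) (by omega) hnd hm hl).mono ?_ fun _ _ h => h) fun s₆ f₆ h₆ => ?_
  · have := Nat.mul_le_mul_right (12 * D.length + 8) (hle _ h₄.2)
    rw [hNB]; omega
  have hT₆ := hT.frame f₆ (by decide)
  refine wp.seq (balls_spec hT₆.regm hT₆.regK (by omega) (by omega)) fun s₇ f₇ h₇ => ?_
  have hT₇ := hT₆.frame f₇ (by decide)
  refine wp.seq (factorial_spec hT₇.regm hT₇.regK (by omega) (by omega)) fun s₈ f₈ h₈ => ?_
  have hT₈ := hT₇.frame f₈ (by decide)
  refine (unequal_spec hT₈.regm (by omega)).mono le_rfl fun s₉ f₉ h₉ => ?_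
  refine ⟨⟨N, g, dg, gm, L, hT₈.frame f₉ (by decide), (((hC.frame f₆ (by decide)).frame f₇
    (by decide)).frame f₈ (by decide)).frame f₉ (by decide), hFits, ?_, ?_, hKN, hNK, hsq, ?_, ?_, ?_⟩,
    ?_, ?_, ?_⟩
  · rw [f₉.reg .L (by decide), f₈.reg .L (by decide), f₇.reg .L (by decide), f₆.reg .L (by decide), hL]
  · rw [f₉.reg .gm (by decide), f₈.reg .gm (by decide), f₇.reg .gm (by decide),
      f₆.reg .gm (by decide), hgm]
  · rw [f₉.arr .BA (by decide), f₈.arr .BA (by decide)]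
    exact h₇
  · rw [f₉.reg .NB (by decide), f₈.reg .NB (by decide), f₇.reg .NB (by decide),
      f₆.reg .NB (by decide), hNB]
    exact h₄.1
  · rw [f₉.reg .NB (by decide), f₈.reg .NB (by decide), f₇.reg .NB (by decide),
      f₆.reg .NB (by decide), hNB]
    exact h₄.2
  · rw [h₉]
    constructor
    · intro h p hp
      obtain ⟨j, hj, rfl⟩ := List.getElem_of_mem hp
      rw [← hT₈.rk j hj]; exact h j hj
    · intro h j hj
      rw [hT₈.rk j hj]; exact h _ (List.getElem_mem hj)
  · rw [f₉.reg .fc (by decide)]; exact h₈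
  · rw [f₉.out (by decide), f₈.out (by decide), f₇.out (by decide), h₆, f₅.out (by decide),
      f₄.out (by decide), f₃.out (by decide), h₂, hlD.length_eq, List.append_assoc]
    rfl

/-- The cost of one call of the subroutine. -/
def candidateCost (K m g : ℕ) : ℕ :=
  2 * K + m * (4 * K + 1500 * (2 * K * g) + 11) + (2 * (m * K * K)).log2 * (12 * m + 8) + 15

theorem candidate_spec' {i : ℕ} {lex : List (Preference K)} (hr : Ready M π D N g dg gm L s)
    (hi : i < D.length) (hci : s.reg .ci = i) (hK : 0 < K)
    (hM : 2 * (D.length * K * K) + 1 < M) (hM' : K * K + 1 < M) (hmM : 2 * D.length + 1 < M)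
    (hnd : D.Nodup) (hm : ∀ p, p ∈ D ↔ ∃ i, π i = p) (hlex : IsLexOrder π D[i] lex) :
    wp M candidate s (candidateCost K D.length g) fun s' =>
      s'.out = s.out ++ subroutineRecord π D[i] lex ∧
      (subroutine π D[i] lex → s'.reg .found = 1 ∧ s'.reg .ans = i) ∧
      (¬ subroutine π D[i] lex → s'.reg .found = s.reg .found ∧ s'.reg .ans = s.reg .ans) := by
  refine (candidate_spec hr.tab hi hci hr.ctx hr.fits hr.regL hr.reggm hK hr.K_le hr.ba hr.bits
    hr.bits' hM hM' hmM hnd hm hlex).mono ?_ fun _ _ h => h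
  rw [candidateCost]
  have hpos : 0 < D.length * K * K := by have := hi.pos; positivity
  have h1 : N * g ≤ 2 * K * g := Nat.mul_le_mul_right g hr.lt_K.le
  have h2 := hr.lt_K
  have h3 : s.reg .NB ≤ (2 * (D.length * K * K)).log2 := (Nat.le_log2 (by omega)).2 hr.bits'
  gcongr ?_ + ?_ * ?_ + ?_ * _ + _ <;> omega

/-- The language has no exit from loops; after a success the remaining iterations do nothing.
Accordingly the invariant has two states: nothing found, and the candidates still to come account
for the rest of the record; or found, and the record is complete. -/
theorem tryAll_spec {lex : Preference K → List (Preference K)} (hr : Ready M π D N g dg gm L s)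
    (hK : 0 < K) (hM : 2 * (D.length * K * K) + 1 < M) (hM' : K * K + 1 < M)
    (hmM : 2 * D.length + 1 < M) (hnd : D.Nodup) (hm : ∀ p, p ∈ D ↔ ∃ i, π i = p)
    (hlex : ∀ c, IsLexOrder π c (lex c)) (hf : s.reg .found = 0) :
    let t := tryCandidates π lex (D.filter fun p => decide (freqRank π D p = 0))
    wp M tryAll s (1 + D.length * (candidateCost K D.length g + 3)) fun s' =>
      s'.out = s.out ++ t.2 ∧
      (s'.reg .found = 0 ∧ t.1 = none ∨ s'.reg .found = 1 ∧
        ∃ h : s'.reg .ans < D.length, t.1 = some D[s'.reg .ans]) := by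
  intro t
  refine (wp.loop (n := D.length) (τ := candidateCost K D.length g + 1 + 1) (fun i s' =>
    (s'.reg .found = 0 ∧
      s'.out ++ (tryCandidates π lex ((D.drop i).filter fun p => decide (freqRank π D p = 0))).2 =
        s.out ++ t.2 ∧
      (tryCandidates π lex ((D.drop i).filter fun p => decide (freqRank π D p = 0))).1 = t.1) ∨
    (s'.reg .found = 1 ∧ s'.out = s.out ++ t.2 ∧
      ∃ h : s'.reg .ans < D.length, t.1 = some D[s'.reg .ans])) (by simp)
    (by simpa using hr.tab.regm) (by omega) (Or.inl (by simp [hf, t]))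
    fun i hi s₁ f₁ hi₁ h₁ => ?_).mono le_rfl fun s₁ _ h₁ => ?_
  · have hr₁ := hr.frame f₁ (by decide)
    have hrk := hr₁.tab.rk i hi
    have hdrop : D.drop i = D[i] :: D.drop (i + 1) := List.drop_eq_getElem_cons hi
    have hcost : (Com.skip).ticks ≤ candidateCost K D.length g := by
      simp only [Com.ticks, candidateCost]; omega
    refine wp.ite (by simp) (fun hc => ?_) fun hc => (wp.basic' (T := 1) (by decide) ?_).mono
      (by omega) fun _ _ h => h
    · have hfound : s₁.reg .found = 0 := by by_contra hh; simp [hh] at hc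
      obtain ⟨-, h2, h3⟩ := h₁.resolve_right (by rw [hfound]; simp)
      rw [hdrop, List.filter_cons] at h2 h3
      refine wp.ite (by simp) (fun hc' => ?_) fun hc' => wp.basic' hcost ?_
      · have hz : freqRank π D D[i] = 0 := by
          by_contra hh; simp [hi₁, hrk, hh] at hc'
        simp only [hz, decide_true, if_true, tryCandidates] at h2 h3
        refine (candidate_spec' hr₁ hi hi₁ hK hM hM' hmM hnd hm (hlex D[i])).mono le_rfl
          fun s₂ f₂ h₂ => ?_
        obtain ⟨l1, l2, l3⟩ := h₂
        by_cases hs : subroutine π D[i] (lex D[i])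
        · obtain ⟨m1, m2⟩ := l2 hs
          simp only [hs, if_true] at h2 h3
          refine Or.inr ⟨by simpa using m1, ?_, ?_⟩
          · simp only [St.out_setReg]; rw [l1, h2]
          · simp only [St.reg_setReg, reduceCtorEq, if_false, m2]
            exact ⟨hi, h3.symm⟩
        · obtain ⟨m1, m2⟩ := l3 hs
          simp only [hs, if_false] at h2 h3
          refine Or.inl ⟨by simpa [hfound] using m1, ?_, h3⟩
          simp only [St.out_setReg]
          rw [l1, List.append_assoc, h2]
      · have hz : ¬ freqRank π D D[i] = 0 := by
          intro hh; simp [hi₁, hrk, hh] at hc'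
        simp only [hz, decide_false, Bool.false_eq_true, if_false] at h2 h3
        exact Or.inl ⟨by simpa using hfound, h2, h3⟩
    · have hfound : s₁.reg .found ≠ 0 := by intro hh; simp [hh] at hc
      obtain ⟨h1, h2, h3⟩ := h₁.resolve_left fun h => hfound h.1
      refine Or.inr ⟨by simpa using h1, h2, ?_⟩
      simpa only [St.reg_setReg, reduceCtorEq, if_false] using h3
  · rcases h₁.2 with ⟨h1, h2, h3⟩ | ⟨h1, h2, h3⟩
    · simp only [List.drop_length, List.filter_nil, tryCandidates, List.append_nil] at h2 h3
      exact ⟨h2, Or.inl ⟨h1, h3.symm⟩⟩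
    · exact ⟨h2, Or.inr ⟨h1, h3⟩⟩

theorem answer_spec {r : Option (Preference K)} (hT : Tab π D s) (hK : K < M)
    (h : s.reg .found = 0 ∧ r = none ∨ s.reg .found = 1 ∧
        ∃ h : s.reg .ans < D.length, r = some D[s.reg .ans]) :
    wp M answer s (2 * K + 3) fun s' => s'.out = s.out ++ answerCode r := by
  refine (wp.ite (T := 1 + (2 * K + 1)) (by simp) (fun hc => ?_) fun hc =>
    (wp.basic' (T := 1) (by decide) ?_).mono (by omega) fun _ _ h => h).mono (by omega) fun _ _ h => h
  · obtain ⟨-, hlt, rfl⟩ := h.resolve_left fun h => hc (by simpa using h.1)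
    refine wp.seq (wp.basic' (Q := fun s' => s'.out = s.out ++ [1]) (by decide) (by simp [vc]))
      fun s₁ f₁ h₁ => ?_
    have hT₁ := hT.frame f₁ (by decide)
    refine (emitPref_spec hT₁ hlt (f₁.reg .ans (by decide)) (by decide) hK).mono le_rfl
      fun s₂ _ h₂ => ?_
    rw [h₂, h₁, List.append_assoc]; rfl
  · simp only [Expr.eval_reg] at hc
    obtain ⟨-, rfl⟩ := h.resolve_right fun h => by omega
    simp [vc, answerCode]

theorem main_spec (hI : Input π s.inp R pref μ) (hTR : ∀ k, s.arr .TR k = 0)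
    (hF0 : ∀ k, s.arr .F k = 0) (hK : 3 ≤ K) (hR : 0 < R) {X : ℕ} (hX : R * K + n ≤ X)
    (hn : 0 < n) (hMX : 16 * (X * X) ≤ M) (hMK : 20 * (K * K) < M) :
    ∃ (l : List (Preference K)) (lex : Preference K → List (Preference K)) (g L : ℕ),
      IsFreqOrder π l ∧ (∀ p, IsLexOrder π p (lex p)) ∧ 0 < g ∧ 2 * (g * g) ≤ L ∧
      2 ^ L < 2 * K ∧
      let m := (distinct pref R).length
      wp M main s (R * (8 * K + 8) + m * (3 * m) + K * (8 * m) + 57 * K +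
        18 * m + (2 * (m * K * K)).log2 * (12 * m + 8) + m * (candidateCost K m g + 3) + 26) fun s' =>
      s'.out = s.out ++ transcript π l lex := by
  set D := distinct pref R with hD
  have hnd : D.Nodup := nodup_distinct
  have hm : ∀ p, p ∈ D ↔ ∃ i, π i = p := fun p => mem_distinct.trans (hI.occurs p)
  obtain ⟨lex, hlex⟩ := exists_lexOrder (by omega) hnd hm
  obtain ⟨l, hl, htake⟩ := exists_freqOrder hnd hm
  have hlD : l.Perm D := (List.perm_ext_iff_of_nodup hl.1 hnd).2 fun p => by rw [hl.2.1, hm]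
  have hDR : D.length ≤ R := by
    simpa [hD, distinct] using length_firsts_le (entry pref) K R
  have hRK : R * 3 ≤ R * K := Nat.mul_le_mul_left R hK
  have hKR : K ≤ R * K := Nat.le_mul_of_pos_left K hR
  have hX4 : 4 * X ≤ X * X := Nat.mul_le_mul_right X (by omega)
  have hDK : D.length * K ≤ R * K := Nat.mul_le_mul_right K hDR
  have hDKK : D.length * K * K ≤ X * X := Nat.mul_le_mul (by omega) (by omega)
  have hprep := prepare_spec hI hTR hF0 hK hR hX hn hMX hMK hl
  -- The parameters are read off the final state of the preparations already here, because g enters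
  -- the time bound and must be fixed before that bound is stated.
  obtain ⟨N, g, dg, gm, L, hr₀⟩ := hprep.2.2.1
  refine ⟨l, lex, g, L, hl, hlex, hr₀.fits.pos.1, hr₀.sq, ?_, ?_⟩
  · have := hr₀.lt_K; rwa [hr₀.fits.eqN] at this
  intro m
  refine (wp.seq (P := fun s' => Ready M π D N g dg gm L s' ∧
      (s'.reg .ne = 0 ↔ ∀ p ∈ D, freqRank π D p = 0) ∧
      (s'.reg .fc = D.length ↔ K.factorial = D.length) ∧
      s'.out = s.out ++ l.length :: l.map (freq π)) ⟨hprep.1, hprep.2.1, hr₀, hprep.2.2.2⟩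
    fun s₁ f₁ h₁ => ?_ : wp M main s (_ + (1 + ((1 + m * (candidateCost K m g + 3) + 1) +
      (2 * K + 3)))) _).mono ?_ fun _ _ h => h
  · obtain ⟨hr, hne, hfc, hout⟩ := h₁
    refine wp.seq (wp.basic' (Q := fun s' => s'.reg .found = 0) (by decide)
      (by simp [vc]; omega)) fun s₂ f₂ h₂ => ?_
    have hr₂ := hr.frame f₂ (by decide)
    have hne₂ : s₂.reg .ne = s₁.reg .ne := f₂.reg .ne (by decide)
    have hfc₂ : s₂.reg .fc = s₁.reg .fc := f₂.reg .fc (by decide)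
    have hcond : (∀ p ∈ l, ∀ q ∈ l, freq π p = freq π q) ∧ l.length = K.factorial ↔
        s₁.reg .ne = 0 ∧ s₁.reg .fc = D.length := by
      rw [hne, hfc, hlD.length_eq, eq_comm (a := D.length)]
      refine and_congr_left' ?_
      simp only [freqRank_eq_zero_iff, hlD.mem_iff]
      exact ⟨fun h p hp q hq => (h q hq p hp).le, fun h p hp q hq =>
        le_antisymm (h q hq p hp) (h p hp q hq)⟩
    refine wp.seq (P := fun s' => s'.out = s₂.out ++ (detect π l lex).2 ∧
        (s'.reg .found = 0 ∧ (detect π l lex).1 = none ∨ s'.reg .found = 1 ∧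
        ∃ h : s'.reg .ans < D.length, (detect π l lex).1 = some D[s'.reg .ans]))
      (wp.ite (by simp) (fun hc => (wp.basic' (T := 1) (by decide) ?_).mono (by omega) fun _ _ h => h)
        fun hc => ?_) fun s₃ f₃ h₃ => (answer_spec (hr₂.tab.frame f₃ (by decide)) (by omega)
          h₃.2).mono le_rfl fun s₄ _ h₄ => ?_
    · have hc' : s₁.reg .ne = 0 ∧ s₁.reg .fc = D.length := by
        by_contra hh
        rw [not_and_or] at hh
        rcases hh with hh | hh <;> simp [hne₂, hfc₂, hr₂.tab.regm, hh] at hc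
      rw [← hcond] at hc'
      simp [vc, detect, if_pos hc', h₂]
    · have hc' : ¬ (s₁.reg .ne = 0 ∧ s₁.reg .fc = D.length) := by
        intro hh
        simp [hne₂, hfc₂, hr₂.tab.regm, hh] at hc
      rw [← hcond] at hc'
      rw [detect, if_neg hc', htake]
      exact tryAll_spec hr₂ (by omega) (by omega) (by omega) (by omega) hnd hm hlex h₂
    · rw [h₄, h₃.1, f₂.out (by decide), hout, transcript]
      simp
  · simp only [m, ← hD]
    omega

end main

end ArrayRam

namespace ArrayRam

/-! ### The input -/

theorem getD_flatMap {α : Type*} {f : α → List ℕ} {k : ℕ} {l : List α}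
    (hf : ∀ x ∈ l, (f x).length = k) {i c : ℕ} (hi : i < l.length) (hc : c < k) :
    (l.flatMap f).getD (i * k + c) 0 = (f l[i]).getD c 0 := by
  induction l generalizing i with
  | nil => simp at hi
  | cons x l ih =>
    have hx := hf x (by simp)
    rw [List.flatMap_cons]
    cases i with
    | zero => rw [List.getD_append _ _ _ _ (by omega)]; simp
    | succ i =>
      rw [List.getD_append_right _ _ _ _ (by rw [hx, Nat.succ_mul]; omega), hx,
        show (i + 1) * k + c - k = i * k + c by rw [Nat.succ_mul]; omega,
        ih (fun y hy => hf y (by simp [hy])) (by simpa using hi)]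
      rfl

theorem length_flatMap_const {α : Type*} {f : α → List ℕ} {k : ℕ} {l : List α}
    (hf : ∀ x ∈ l, (f x).length = k) : (l.flatMap f).length = l.length * k := by
  rw [List.length_flatMap, List.map_congr_left hf, List.map_const', List.sum_replicate, smul_eq_mul]

variable {K n : ℕ} {π : Profile K n}

theorem rows_inputWords (rows : List (Preference K × ℕ)) (p₀ : Preference K) :
    Rows (inputWords rows) K rows.length (entry fun r => (rows.getD r (p₀, 0)).1)
      fun r => (rows.getD r (p₀, 0)).2 := by
  have hlen : ∀ r ∈ rows, (r.1.code ++ [r.2]).length = K + 1 := fun r _ => by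
    simp [Preference.code]
  refine ⟨?_, rfl, rfl, fun i hi c hc => ?_, fun i hi => ?_, fun i hi c hc => ?_⟩
  · rw [inputWords, List.length_cons, List.length_cons, length_flatMap_const hlen]; omega
  · rw [inputWords, show 2 + i * (K + 1) + c = i * (K + 1) + c + 1 + 1 by omega, List.getD_cons_succ,
      List.getD_cons_succ, getD_flatMap hlen hi (by omega)]
    rw [List.getD_append _ _ _ _ (by simpa [Preference.code] using hc)]
    simp [entry, hc, hi, Preference.code]
  · rw [inputWords, show 2 + i * (K + 1) + K = i * (K + 1) + K + 1 + 1 by omega, List.getD_cons_succ,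
      List.getD_cons_succ, getD_flatMap hlen hi (by omega)]
    rw [List.getD_append_right _ _ _ _ (by simp [Preference.code])]
    simp [Preference.code, hi]
  · simpa [entry, hc] using Preference.rank_lt _ _

theorem sum_freq (π : Profile K n) : ∑ p, freq π p = n := by
  classical
  have := Finset.card_eq_sum_card_fiberwise (f := π) (s := Finset.univ) (t := Finset.univ)
    (fun _ _ => by simp)
  rw [Finset.card_univ, Fintype.card_fin] at this
  refine Eq.trans (Finset.sum_congr rfl fun p _ => ?_) this.symm
  rw [freq]

open Classical in
theorem input_of_freq {rows : List (Preference K × ℕ)} {p₀ : Preference K}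
    (ho : ∀ p, p ∈ rows.map Prod.fst ↔ ∃ i, π i = p)
    (hf : ∀ p, ∑ t ∈ Finset.range rows.length with (rows.getD t (p₀, 0)).1 = p,
      (rows.getD t (p₀, 0)).2 = freq π p) :
    Input π (inputWords rows) rows.length (fun r => (rows.getD r (p₀, 0)).1)
      fun r => (rows.getD r (p₀, 0)).2 where
  rows := rows_inputWords rows p₀
  occurs p := by
    rw [← ho, List.mem_map]
    constructor
    · rintro ⟨r, hr, rfl⟩
      exact ⟨rows[r], List.getElem_mem hr, by simp [hr]⟩
    · rintro ⟨x, hx, rfl⟩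
      obtain ⟨r, hr, rfl⟩ := List.getElem_of_mem hx
      exact ⟨r, hr, by simp [hr]⟩
  freq := hf
  sum := by
    rw [← Finset.sum_fiberwise (Finset.range rows.length) fun t => (rows.getD t (p₀, 0)).1,
      Finset.sum_congr rfl fun p _ => hf p, sum_freq]

theorem input_of_isBallotList {rows : List (Preference K × ℕ)} (h : IsBallotList π rows)
    (p₀ : Preference K) :
    Input π (inputWords rows) rows.length (fun r => (rows.getD r (p₀, 0)).1)
      fun r => (rows.getD r (p₀, 0)).2 := by
  classical
  have hlen : rows.length = n := by rw [h, List.length_ofFn]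
  have hget : ∀ i : Fin n, rows.getD i (p₀, 0) = (π i, 1) := fun i => by
    rw [List.getD_eq_getElem _ _ (by rw [hlen]; exact i.is_lt)]
    simp [show rows = _ from h]
  refine input_of_freq (fun p => ?_) fun p => ?_
  · rw [show rows = _ from h]
    simp
  · rw [Finset.sum_filter, hlen, Finset.sum_range, freq, Finset.card_filter]
    refine Finset.sum_congr rfl fun i _ => ?_
    simp only [hget]

theorem nodup_fst_of_isFreqTable {rows : List (Preference K × ℕ)} (h : IsFreqTable π rows) :
    (rows.map Prod.fst).Nodup := by
  refine h.1.map_on fun x hx y hy hxy => ?_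
  have h1 := ((h.2 x.1 x.2).1 hx).2
  have h2 := ((h.2 y.1 y.2).1 hy).2
  exact Prod.ext hxy (by rw [h1, h2, hxy])

theorem mem_fst_of_isFreqTable {rows : List (Preference K × ℕ)} (h : IsFreqTable π rows)
    (p : Preference K) : p ∈ rows.map Prod.fst ↔ ∃ i, π i = p := by
  rw [List.mem_map]
  constructor
  · rintro ⟨x, hx, rfl⟩
    exact ((h.2 x.1 x.2).1 hx).1
  · intro hp
    exact ⟨(p, freq π p), (h.2 _ _).2 ⟨hp, rfl⟩, rfl⟩

theorem input_of_isFreqTable {rows : List (Preference K × ℕ)} (h : IsFreqTable π rows)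
    (p₀ : Preference K) :
    Input π (inputWords rows) rows.length (fun r => (rows.getD r (p₀, 0)).1)
      fun r => (rows.getD r (p₀, 0)).2 := by
  classical
  refine input_of_freq (mem_fst_of_isFreqTable h) fun p => ?_
  by_cases hp : ∃ i, π i = p
  · obtain ⟨t, ht, htp⟩ := List.getElem_of_mem ((h.2 p (freq π p)).2 ⟨hp, rfl⟩)
    rw [Finset.sum_eq_single_of_mem t]
    · rw [List.getD_eq_getElem _ _ ht, htp]
    · rw [Finset.mem_filter, Finset.mem_range, List.getD_eq_getElem _ _ ht, htp]
      exact ⟨ht, rfl⟩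
    · intro t' ht' hne
      rw [Finset.mem_filter, Finset.mem_range] at ht'
      obtain ⟨ht', hp'⟩ := ht'
      rw [List.getD_eq_getElem _ _ ht'] at hp'
      refine absurd ?_ hne
      refine (List.Nodup.getElem_inj_iff (nodup_fst_of_isFreqTable h) (hi := by simpa using ht')
        (hj := by simpa using ht)).1 ?_
      simp only [List.getElem_map, hp', htp]
  · have h0 : freq π p = 0 := by
      by_contra hh; exact hp (freq_pos_iff.1 (Nat.pos_of_ne_zero hh))
    rw [h0, Finset.sum_eq_zero]
    intro t ht
    rw [Finset.mem_filter, Finset.mem_range] at ht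
    obtain ⟨ht, htp⟩ := ht
    rw [List.getD_eq_getElem _ _ ht] at htp
    exact absurd ((mem_fst_of_isFreqTable h p).1 (List.mem_map.2 ⟨_, List.getElem_mem ht, htp⟩)) hp

/-! ### The machine program -/

open WordRam in
/-- The program: compute the end of the input, then run the main algorithm. -/
def program : WordRam.Cmd :=
  .seq (.set 0 (.bin .add (.bin .mul (.load (.const 1)) (.bin .add (.load (.const 0)) (.const 1)))
    (.const 2))) main.comp

/-- The initial state. -/
def St.init (inp : List ℕ) : St := ⟨fun _ => 0, fun _ _ => 0, [], inp⟩

theorem repr_init {inp : List ℕ} {M : ℕ} (hM : 0 < M) (hlen : inp.length < M)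
    (hlt : ∀ x ∈ inp, x < M) :
    Repr M (St.init inp) { WordRam.State.init inp with
      reg := Function.update (WordRam.State.init inp).reg 0 inp.length } where
  reg r := by
    have : r.adr ≠ 0 := by simp [Reg.adr]
    simp [this, WordRam.State.init, St.init]
  arr a i := by simp [WordRam.State.init, St.init]
  inp i hi := rfl
  base := by simp [St.init]
  out := rfl
  reg_lt _ := hM
  arr_lt _ _ := hM
  inp_lt i := by
    change inp.getD i 0 < M
    by_cases hi : i < inp.length
    · rw [List.getD_eq_getElem _ _ hi]; exact hlt _ (List.getElem_mem hi)
    · rw [List.getD_eq_default _ _ (by omega)]; exact hM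
  len_lt := hlen

/-- The bound for the number of commands executed. -/
def mainCost (K R m g : ℕ) : ℕ :=
  R * (8 * K + 8) + m * (3 * m) + K * (8 * m) + 57 * K +
    18 * m + (2 * (m * K * K)).log2 * (12 * m + 8) + m * (candidateCost K m g + 3) + 26

/-- The bound M is the fourth power of X = R * K + n, which exceeds all values that the program
assigns; the word length is chosen such that M ^ `main.size` still fits. -/
theorem program_spec {inp : List ℕ} {R : ℕ} {pref : ℕ → Preference K} {μ : ℕ → ℕ} {w : ℕ}
    (hI : Input π inp R pref μ) (hK : 3 ≤ K) (hn : 0 < n) (hR : 0 < R)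
    (hw : (R * K + n) ^ (4 * main.size + 4) ≤ 2 ^ w) :
    ∃ (l : List (Preference K)) (lex : Preference K → List (Preference K)) (g L t : ℕ)
      (s : WordRam.State), IsFreqOrder π l ∧ (∀ p, IsLexOrder π p (lex p)) ∧ 0 < g ∧
      2 * (g * g) ≤ L ∧ 2 ^ L < 2 * K ∧ WordRam.Exec w program (WordRam.State.init inp) t s ∧
      s.out = transcript π l lex ∧
      t ≤ 20 + main.weight * mainCost K R (distinct pref R).length g := by
  set X := R * K + n with hX
  have hKR : K ≤ R * K := Nat.le_mul_of_pos_left K hR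
  have hRK : R * 3 ≤ R * K := Nat.mul_le_mul_left R hK
  have hX4 : 4 * X ≤ X * X := Nat.mul_le_mul_right X (by omega)
  set M := (X * X) * (X * X) with hMdef
  have hMpow : M = X ^ 4 := by rw [hMdef]; ring
  have hMX : 16 * (X * X) ≤ M := Nat.mul_le_mul_right _ (by omega)
  have hMK : 20 * (K * K) < M := by
    have h1 : (K + 1) * (K + 1) ≤ X * X := Nat.mul_le_mul (by omega) (by omega)
    have h2 : (K + 1) * (K + 1) = K * K + 2 * K + 1 := by ring
    have h3 : 3 * K ≤ K * K := Nat.mul_le_mul_right K hK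
    -- The case X = 4 has K = 3 and is checked by numbers: 20 * 9 < 256.
    rcases Nat.lt_or_ge X 5 with h5 | h5
    · have : K = 3 := by omega
      subst this; omega
    · have h6 : 5 * X ≤ X * X := Nat.mul_le_mul_right X h5
      have : 20 * (X * X) ≤ M := Nat.mul_le_mul_right _ (by omega)
      omega
  have hMw : M ≤ 2 ^ w := by
    rw [hMpow]
    exact (Nat.pow_le_pow_right (by omega) (by omega)).trans hw
  have hRows := hI.rows
  have hlen : inp.length < M := by
    rw [hRows.length]
    have : R * (K + 1) = R * K + R := by ring
    omega
  have hRM : R < M := by omega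
  have hlt : ∀ x ∈ inp, x < M := by
    intro x hx
    obtain ⟨i, hi, rfl⟩ := List.getElem_of_mem hx
    rw [← List.getD_eq_getElem _ 0 hi]
    rcases Nat.lt_or_ge i 2 with h2 | h2
    · interval_cases i
      · rw [hRows.zero]; omega
      · rw [hRows.one]; omega
    · obtain ⟨j, rfl⟩ := Nat.exists_eq_add_of_le h2
      rw [hRows.length] at hi
      have hjR : j / (K + 1) < R := by
        rw [Nat.div_lt_iff_lt_mul (by omega)]; omega
      have hmod := Nat.mod_lt j (show 0 < K + 1 by omega)
      have hj : 2 + j = 2 + j / (K + 1) * (K + 1) + j % (K + 1) := by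
        have := Nat.div_add_mod' j (K + 1); omega
      rw [hj]
      rcases Nat.lt_succ_iff_lt_or_eq.1 hmod with h | h
      · rw [hRows.row _ hjR _ h]
        have := hRows.lt _ hjR _ h; omega
      · rw [h, hRows.mult _ hjR]
        have h1 := Finset.single_le_sum (f := μ) (fun _ _ => Nat.zero_le _)
          (Finset.mem_range.2 hjR)
        rw [hI.sum] at h1; omega
  obtain ⟨l, lex, g, L, hl, hlex, hg0, hg, hL, hwp⟩ := main_spec (M := M) (s := St.init inp) hI
    (fun _ => rfl) (fun _ => rfl) hK hR hX.ge hn hMX hMK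
  obtain ⟨hsafe, hcost, hout⟩ := hwp
  have hsize : M ^ main.size ≤ 2 ^ w := by
    rw [hMpow, ← pow_mul]
    exact (Nat.pow_le_pow_right (by omega) (by omega)).trans hw
  obtain ⟨T, t', hex, hrep, hT, -⟩ := exec_comp (by omega) (by decide) hsize hsafe
    (repr_init (by omega) hlen hlt)
  have hev : (WordRam.Expr.bin .add (.bin .mul (.load (.const 1)) (.bin .add (.load (.const 0))
      (.const 1))) (.const 2)).eval w (WordRam.State.init inp) = inp.length := by
    have e : ∀ x, x < M → x % 2 ^ w = x := fun x hx => Nat.mod_eq_of_lt (hx.trans_le hMw)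
    have e0 : (WordRam.State.init inp).mem 0 = K := hRows.zero
    have e1 : (WordRam.State.init inp).mem 1 = R := hRows.one
    have hl2 : R * (K + 1) + 2 = inp.length := by rw [hRows.length]; omega
    simp only [WordRam.Expr.eval, WordRam.Op.eval]
    rw [e 0 (by omega), e 1 (by omega), e0, e1, e 2 (by omega), e (K + 1) (by omega),
      e (R * (K + 1)) (by omega), hl2, e _ hlen]
  rw [← hev] at hex
  refine ⟨l, lex, g, L, _, t', hl, hlex, hg0, hg, hL, .seq (.set _ _ _) hex, ?_, ?_⟩
  · rw [hrep.out, hout]; rfl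
  · have := Nat.mul_le_mul_left main.weight hcost
    refine Nat.add_le_add (by decide) (hT.trans this)

/-! ### Time -/

theorem length_distinct_le {inp : List ℕ} {R : ℕ} {pref : ℕ → Preference K} {μ : ℕ → ℕ}
    (hI : Input π inp R pref μ) : (distinct pref R).length ≤ min K.factorial n := by
  classical
  rw [← List.toFinset_card_of_nodup nodup_distinct]
  refine le_min ?_ ?_
  · rw [← Preference.card]; exact Finset.card_le_univ _
  · have : (distinct pref R).toFinset ⊆ Finset.univ.image π := fun p hp => by
      rw [List.mem_toFinset, mem_distinct, hI.occurs] at hp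
      simpa using hp
    simpa using (Finset.card_le_card this).trans Finset.card_image_le

/-- Reading the input, counting inversions and sorting are the three leading terms; since m, g ≥ 1
and K ≥ 3 they absorb all others. -/
theorem mainCost_le {R m g : ℕ} (hK : 3 ≤ K) (hm : 0 < m) (hg : 0 < g) :
    mainCost K R m g ≤ 4000 * (R * K + m * m * (K * g) + m * m * (2 * (m * K * K)).log2) := by
  set lg := (2 * (m * K * K)).log2
  have h1 : R * 3 ≤ R * K := Nat.mul_le_mul_left R hK
  have h2 : m * m * 1 ≤ m * m * (K * g) := Nat.mul_le_mul_left _ (Nat.mul_pos (by omega) hg)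
  have h3 : K * 1 ≤ K * g := Nat.mul_le_mul_left K hg
  have h4 : 1 * (K * g) ≤ m * m * (K * g) := Nat.mul_le_mul_right _ (Nat.mul_pos hm hm)
  have h5 : m * 1 ≤ m * m := Nat.mul_le_mul_left m hm
  have h6 : m * K ≤ m * m * (K * g) := Nat.mul_le_mul (by omega) (by omega)
  have h7 : m * lg ≤ m * m * lg := Nat.mul_le_mul_right _ (by omega)
  have h8 : 1 * lg ≤ m * lg := Nat.mul_le_mul_right _ hm
  have h9 : m * m * K ≤ m * m * (K * g) := Nat.mul_le_mul_left _ (by omega)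
  have e : mainCost K R m g = 8 * (R * K) + 8 * R + 3 * (m * m) + 8 * (m * K) + 57 * K + 18 * m +
      12 * (m * lg) + 8 * lg + 2 * (m * K) + 4 * (m * m * K) + 3000 * (m * m * (K * g)) +
      11 * (m * m) + 12 * (m * m * lg) + 8 * (m * lg) + 18 * m + 26 := by
    simp only [mainCost, candidateCost]; ring
  rw [e]; omega

/-- Holds because e < 3. It lets √log K absorb constants. -/
theorem one_le_log {K : ℕ} (hK : 3 ≤ K) : 1 ≤ Real.log K := by
  rw [Real.le_log_iff_exp_le (by positivity)]
  have : (3 : ℝ) ≤ K := by exact_mod_cast hK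
  linarith [Real.exp_one_lt_d9]

theorem log_two_pow_le {L x : ℕ} (h : 2 ^ L ≤ x) : (L : ℝ) * (2 / 3) ≤ Real.log x := by
  have h1 : Real.log ((2 : ℝ) ^ L) ≤ Real.log x :=
    Real.log_le_log (by positivity) (by exact_mod_cast h)
  rw [Real.log_pow] at h1
  have : (2 : ℝ) / 3 ≤ Real.log 2 := by linarith [Real.log_two_gt_d9]
  nlinarith [(Nat.cast_nonneg L : (0 : ℝ) ≤ L)]

/-- From 2g² ≤ L and L * (2 / 3) ≤ log (2K) < 1 + log K ≤ 2 log K. -/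
theorem le_sqrt_log {g L : ℕ} (hK : 3 ≤ K) (hg : 2 * (g * g) ≤ L) (hL : 2 ^ L < 2 * K) :
    (g : ℝ) ≤ 2 * √(Real.log K) := by
  have h1 := one_le_log hK
  have h2 := log_two_pow_le hL.le
  push_cast at h2
  rw [Real.log_mul (by norm_num) (by positivity)] at h2
  have h3 : Real.log 2 < 1 := by linarith [Real.log_two_lt_d9]
  have h4 : (2 : ℝ) * (g * g) ≤ L := by exact_mod_cast hg
  have h5 : (g : ℝ) ^ 2 ≤ (2 * √(Real.log K)) ^ 2 := by
    rw [mul_pow, Real.sq_sqrt (by linarith)]; nlinarith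
  exact le_of_sq_le_sq h5 (by positivity)

/-- The part of the key length that depends on K is absorbed by K √log K, so only log m remains as a
separate term. -/
theorem log2_le {m : ℕ} (hK : 3 ≤ K) (hm : 0 < m) :
    ((2 * (m * K * K)).log2 : ℝ) ≤ 2 * Real.log m + 5 * (K * √(Real.log K)) := by
  have hpos : 2 * (m * K * K) ≠ 0 := by positivity
  have h1 := one_le_log hK
  have h2 := log_two_pow_le ((Nat.le_log2 hpos).1 le_rfl)
  have hm' : (m : ℝ) ≠ 0 := by positivity
  have hK' : (K : ℝ) ≠ 0 := by positivity
  push_cast at h2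
  rw [Real.log_mul (by norm_num) (by positivity), Real.log_mul (by positivity) hK',
    Real.log_mul hm' hK'] at h2
  have h3 : Real.log 2 < 1 := by linarith [Real.log_two_lt_d9]
  have h4 : 0 ≤ Real.log m := Real.log_natCast_nonneg m
  have h5 : Real.log K ≤ K * √(Real.log K) := by
    have h6 : √(Real.log K) ≤ K := by
      refine (Real.sqrt_le_left (by positivity)).2 ?_
      have := Real.log_le_self (Nat.cast_nonneg (α := ℝ) K)
      have h7 : (1 : ℝ) ≤ K := by exact_mod_cast (by omega : 1 ≤ K)
      nlinarith
    calc Real.log K = √(Real.log K) * √(Real.log K) := (Real.mul_self_sqrt (by linarith)).symm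
      _ ≤ _ := mul_le_mul_of_nonneg_right h6 (Real.sqrt_nonneg _)
  linarith

/-- The second part is for frequency tables: they have m rows, so reading them is already covered by
the bound. -/
theorem cost_le_timeBound {R m g L : ℕ} (hK : 3 ≤ K) (hm : 0 < m) (hg0 : 0 < g)
    (hg : 2 * (g * g) ≤ L) (hL : 2 ^ L < 2 * K) (hmn : m ≤ min K.factorial n) :
    (mainCost K R m g : ℝ) ≤ 4000 * (R * K + 7 * timeBound K n) ∧ (m : ℝ) * K ≤ timeBound K n := by
  have h1 := one_le_log hK
  have hs1 : 1 ≤ √(Real.log K) := Real.one_le_sqrt.2 h1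
  have hsg := le_sqrt_log hK hg hL
  have hlg := log2_le hK hm
  have hm1 : (1 : ℝ) ≤ m := by exact_mod_cast hm
  have hmn' : (m : ℝ) ≤ ((min K.factorial n : ℕ) : ℝ) := by exact_mod_cast hmn
  have hlog0 : 0 ≤ Real.log m := Real.log_natCast_nonneg m
  have hlog : Real.log m ≤ Real.log ((min K.factorial n : ℕ) : ℝ) :=
    Real.log_le_log (by linarith) hmn'
  have htb : (m : ℝ) ^ 2 * K * √(Real.log K) + (m : ℝ) ^ 2 * Real.log m ≤ timeBound K n := by
    rw [timeBound]; gcongr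
  have hmc : (mainCost K R m g : ℝ) ≤ 4000 * (R * K + m * m * (K * g) +
      m * m * ((2 * (m * K * K)).log2 : ℝ)) := by
    exact_mod_cast mainCost_le (R := R) hK hm hg0
  set σ := √(Real.log K)
  set N' := ((2 * (m * K * K)).log2 : ℝ)
  have a1 : (m : ℝ) * m * (K * g) ≤ 2 * ((m : ℝ) ^ 2 * K * σ) := by
    calc (m : ℝ) * m * (K * g) ≤ m * m * (K * (2 * σ)) := by gcongr
      _ = _ := by ring
  have a2 : (m : ℝ) * m * N' ≤ 2 * ((m : ℝ) ^ 2 * Real.log m) + 5 * ((m : ℝ) ^ 2 * K * σ) := by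
    calc (m : ℝ) * m * N' ≤ m * m * (2 * Real.log m + 5 * (K * σ)) := by gcongr
      _ = _ := by ring
  have a3 : 0 ≤ (m : ℝ) ^ 2 * Real.log m := by positivity
  have a4 : (m : ℝ) * K ≤ (m : ℝ) ^ 2 * K * σ := by
    calc (m : ℝ) * K = m * K * 1 * 1 := by ring
      _ ≤ m * K * m * σ := by gcongr
      _ = _ := by ring
  constructor <;> linarith

/-- The crude estimates g ≤ K and log₂ x ≤ x suffice for a polynomial bound. -/
theorem cost_le_pow {R m g L : ℕ} (hK : 3 ≤ K) (hm : 0 < m) (hg0 : 0 < g)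
    (hg : 2 * (g * g) ≤ L) (hL : 2 ^ L < 2 * K) (hmn : m ≤ n) (hRn : R ≤ n) :
    mainCost K R m g ≤ 16000 * (n * K) ^ 3 := by
  have h1 : 1 ≤ n * K := Nat.mul_pos (by omega) (by omega)
  have hgg : g ≤ g * g := Nat.le_mul_self g
  have hL' := Nat.lt_two_pow_self (n := L)
  have hgK : g ≤ K := by omega
  have hlg : (2 * (m * K * K)).log2 ≤ 2 * (m * K * K) := Nat.log2_le_self _
  have b1 : R * K ≤ (n * K) ^ 3 :=
    (Nat.mul_le_mul_right K hRn).trans (Nat.le_self_pow (by omega) _)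
  have b2 : m * m * (K * g) ≤ (n * K) ^ 3 := by
    calc m * m * (K * g) ≤ n * n * (K * K) := by gcongr
      _ = (n * K) ^ 2 := by ring
      _ ≤ _ := Nat.pow_le_pow_right h1 (by omega)
  have b3 : m * m * (2 * (m * K * K)).log2 ≤ 2 * (n * K) ^ 3 := by
    calc m * m * (2 * (m * K * K)).log2 ≤ n * n * (2 * (n * K * K)) :=
          Nat.mul_le_mul (Nat.mul_le_mul hmn hmn) (hlg.trans (by gcongr))
      _ = 2 * (n * n * n * K * K * 1) := by ring
      _ ≤ 2 * (n * n * n * K * K * K) := by gcongr; omega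
      _ = _ := by ring
  have := mainCost_le (R := R) hK hm hg0
  omega

end ArrayRam
theorem mainTheorem5 :
    -- the algorithm is correct, however ties are broken
    (∀ (K n : ℕ), 3 ≤ K → ∀ (π : Profile K n) (l : List (Preference K))
        (lex : Preference K → List (Preference K)),
        IsFreqOrder π l → (∀ c, IsLexOrder π c (lex c)) →
        (∀ p, (detect π l lex).1 = some p → LevelOneConsensus π p) ∧
        ((detect π l lex).1 = none ↔ ¬ ∃ p, LevelOneConsensus π p)) ∧
    -- a word RAM program carries it out within the time bound
    (∃ (P : WordRam.Cmd) (c : ℕ) (C : ℝ) (Q : Polynomial ℕ),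
      ∀ (K n : ℕ), 3 ≤ K → 1 ≤ n → ∀ (π : Profile K n) (rows : List (Preference K × ℕ)),
        (IsFreqTable π rows ∨ IsBallotList π rows) →
        ∀ w : ℕ, (rows.length * K + n) ^ c ≤ 2 ^ w →
        ∃ (l : List (Preference K)) (lex : Preference K → List (Preference K))
          (t : ℕ) (s : WordRam.State),
          IsFreqOrder π l ∧ (∀ p, IsLexOrder π p (lex p)) ∧
          WordRam.Exec w P (WordRam.State.init (inputWords rows)) t s ∧
          s.out = transcript π l lex ∧
          (IsFreqTable π rows → (t : ℝ) ≤ C * timeBound K n) ∧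
          (IsBallotList π rows → (t : ℝ) ≤ C * ((n : ℝ) * K + timeBound K n)) ∧
          t ≤ Q.eval (n * K)) := by
  refine ⟨fun K n _ π l lex hl hlex => detect_correct hl hlex, ArrayRam.program,
    -- The exponent is the word length condition of `program_spec`; the constant leaves room for
    -- 4000 * (1 + 7).
    4 * ArrayRam.main.size + 4, 60000 * (ArrayRam.main.weight + 1),
    Polynomial.C (16000 * (ArrayRam.main.weight + 1)) * Polynomial.X ^ 3,
    fun K n hK hn π rows hrows w hw => ?_⟩
  set p₀ := π ⟨0, hn⟩
  have hI := hrows.elim (fun h => ArrayRam.input_of_isFreqTable h p₀)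
    fun h => ArrayRam.input_of_isBallotList h p₀
  obtain ⟨r₀, hr₀, -⟩ := (hI.occurs p₀).2 ⟨_, rfl⟩
  obtain ⟨l, lex, g, L, t, s, hl, hlex, hg0, hg, hL, hexec, hout, ht⟩ :=
    ArrayRam.program_spec hI hK hn (by omega) hw
  set D := ArrayRam.distinct (fun r => (rows.getD r (p₀, 0)).1) rows.length
  generalize ArrayRam.main.weight = W at ht ⊢
  have hm0 : 0 < D.length := List.length_pos_of_mem (ArrayRam.mem_distinct.2 ⟨r₀, hr₀, rfl⟩)
  have hmn : D.length ≤ min K.factorial n := ArrayRam.length_distinct_le hI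
  -- A frequency table has one row for each distinct preference, so its linear reading time is m * K
  -- and disappears in the bound; for ballots it is n * K and remains.
  have hRtable : IsFreqTable π rows → rows.length = D.length := fun h => by
    have : (rows.map Prod.fst).Perm D :=
      (List.perm_ext_iff_of_nodup (ArrayRam.nodup_fst_of_isFreqTable h) ArrayRam.nodup_distinct).2
        fun p => (ArrayRam.mem_fst_of_isFreqTable h p).trans
          (ArrayRam.mem_distinct.trans (hI.occurs p)).symm
    simpa using this.length_eq
  have hRballot : IsBallotList π rows → rows.length = n := fun h => by
    rw [show rows = _ from h, List.length_ofFn]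
  have hRn : rows.length ≤ n := hrows.elim
    (fun h => (hRtable h).trans_le (hmn.trans (min_le_right _ _))) fun h => (hRballot h).le
  obtain ⟨hcost, hmK⟩ := ArrayRam.cost_le_timeBound (R := rows.length) hK hm0 hg0 hg hL hmn
  have hpow := ArrayRam.cost_le_pow (R := rows.length) hK hm0 hg0 hg hL
    (hmn.trans (min_le_right _ _)) hRn
  -- Lets one additional multiple of the cost absorb the steps that locate the end of the input.
  have hc20 : 20 ≤ ArrayRam.mainCost K rows.length D.length g := by
    simp only [ArrayRam.mainCost]; omega
  have htW : t ≤ (W + 1) * ArrayRam.mainCost K rows.length D.length g := by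
    rw [Nat.succ_mul]; omega
  have htR : (t : ℝ) ≤ (W + 1) * (4000 * (rows.length * K + 7 * timeBound K n)) := by
    refine le_trans (?_ : (t : ℝ) ≤ (W + 1) * ArrayRam.mainCost K rows.length D.length g)
      (mul_le_mul_of_nonneg_left hcost (by positivity))
    exact_mod_cast htW
  have htb : 0 ≤ timeBound K n := le_trans (by positivity) hmK
  refine ⟨l, lex, t, s, hl, hlex, hexec, hout, fun h => htR.trans ?_, fun h => htR.trans ?_, ?_⟩
  · rw [hRtable h, mul_comm (60000 : ℝ), mul_assoc]
    exact mul_le_mul_of_nonneg_left (by linarith) (by positivity)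
  · rw [hRballot h, mul_comm (60000 : ℝ), mul_assoc]
    have : 0 ≤ (n : ℝ) * K := by positivity
    exact mul_le_mul_of_nonneg_left (by linarith) (by positivity)
  · simp only [Polynomial.eval_mul, Polynomial.eval_C, Polynomial.eval_pow, Polynomial.eval_X]
    calc t ≤ (W + 1) * ArrayRam.mainCost K rows.length D.length g := htW
      _ ≤ (W + 1) * (16000 * (n * K) ^ 3) := Nat.mul_le_mul_left _ hpow
      _ = _ := by ring
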